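/- **Setting.** Let $X$ be a tubular graph of graphs: a finite connected graph of spaces whose vertex spaces are finite connected simplicial graphs, whose edge spaces are simplicial graphs homeomorphic to a circle, and whose attaching maps are simplicial immersions. Its geometric realisation, also denoted $X$, is a square complex: the edges of the vertex spaces are its vertical edges, each vertex $h$ of an edge space gives a horizontal edge $h\times[0,1]$, and each edge of an edge space gives a square. Assume that $X$ is Brady–Meier: every vertex link is connected, and stays connected after the removal of any simplex of the link. Let $G=\pi_1(X)$ act by deck transformations on the $\mathrm{CAT}(0)$ universal cover $\widetilde X$. **Lines.** A *line* in $\widetilde X$ is (the image of) an isometric embedding $\mathbb R\to\widetilde X$; it is *vertical* if it is a bi-infinite combinatorial path of vertical edges; it is *separating* if its complement is not connected. A *half-space* of a line $L$ is the closure of a component of $\widetilde X\setminus L$. Two separating lines $L,L'$ *cross* if $L$ is contained in no half-space of $L'$ and $L'$ is contained in no half-space of $L$. A line $L$ is *periodic* if it is an axis of some $g\in G$, $g\neq 1$: $gL\subset L$ and $d(x,gx)=\inf_{y\in\widetilde X}d(y,gy)$ for some $x\in L$. **Cycles.** A *vertical cycle* is an immersion of graphs $\phi:C\to X_s$ of a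 subdivided circle $C$ into a vertex space $X_s$. It is *maximal* if it is not an $n$-th power of a cycle with $n\ge 2$, i.e. if $\phi$ does not factor through an $n$-fold covering of circles followed by a cycle. It is *UC-separating* if its lifts $\widetilde C$ to $\widetilde X$ are separating lines. A *fundamental domain* $P_C=(v_0,\dots,v_m)$ of $C$ is the closed combinatorial path obtained by cutting $C$ open at a vertex, $m$ being the number of edges of $C$. **Spheres.** Subdivide each edge of $X$ into four edges and each square into sixteen squares. The regular neighbourhood $N(P_C)$ has one copy of a cell $c$ of this subdivision for each component of the pre-image of $c$ in $P_C$, and the regular sphere $\partial N(P_C)$ is the graph formed by the cells of $N(P_C)$ that are disjoint from $P_C$. The orthogonal sphere $\partial_{orth}N(P_C)$ is the closure of the complement in $\partial N(P_C)$ of the second cubical neighbourhoods of two vertices: the vertex near $v_0$ on the terminal edge $\{v_{m-1},v_m\}$ and the vertex near $v_m$ on the initial edge $\{v_0,v_1\}$. (The first cubical neighbourhood of a set $Y$ in a graph is the union of the closed cells that meet $\overline Y$; the second one is the first one of the first one.) If $e'$ is an edge of $P_C$ with image $e$, and $\mathsf s$ is a square containing $e$, the *pre-image of $\mathsf s$ around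 $e'$* is the segment of $\partial N(P_C)$ that runs along $e'$ inside $\mathsf s$. A UC-separating vertical cycle $C$ is *$k$-repetitive* if there are a vertical edge $e$ of $X$ and a fundamental domain $P_C$ of $C$ such that $k$ distinct edges $e_1,\dots,e_k$ of $P_C$ are mapped to $e$, and for each square $\mathsf s$ containing $e$ there is a component $K$ of $\partial_{orth}N(P_C)$ that contains the pre-image of $\mathsf s$ around $e_i$ for every $i\in\{1,\dots,k\}$. (A square that contains $e$ along both of its vertical sides counts as two squares.) **Proposition.** Let $C$ be a maximal UC-separating vertical cycle of $X$ that is $3$-repetitive, and let $\widetilde C\subset\widetilde X$ be a lift of $C$. Then there exists a periodic separating line $L'$ in $\widetilde X$, which can be taken to be vertical, such that $L'$ and $\widetilde C$ cross. -/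

import Mathlib

open scoped ENNReal

universe u v

/-- A graph of graphs, with all its spaces put together.
* `vert` is the disjoint union of the vertex spaces, a simplicial graph; the vertex spaces are its
  connected components;
* `strip` is the disjoint union of the edge spaces, a simplicial graph; the edge spaces are its
  connected components;
* `bd false` and `bd true` are the two (simplicial) attaching maps of the edge spaces.

Its geometric realisation is a `VH`-complex: the vertices are the elements of `V`, the vertical
edges are the edges of `vert`, each `h : H` is a horizontal edge from `bd false h` to `bd true h`,
and each edge `{h, h'}` of `strip` is a square with horizontal sides `h`, `h'` and vertical sides
`{bd σ h, bd σ h'}`, one for each `σ`. -/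
structure GraphOfGraphs where
  V : Type u
  H : Type u
  vert : SimpleGraph V
  strip : SimpleGraph H
  bd : Bool → (strip →g vert)

namespace GraphOfGraphs

/-! ### Edge paths and their homotopies -/

section EdgePaths

variable (X : GraphOfGraphs.{u})

/-- An oriented edge of the 1-skeleton from `a` to `b`: a vertical edge, or a horizontal edge `h`
run through from its `σ`-end to its other end. -/
inductive Step : X.V → X.V → Type u
  | vertical {a b : X.V} (hab : X.vert.Adj a b) : Step a b
  | horizontal {a b : X.V} (σ : Bool) (h : X.H) (ha : X.bd σ h = a) (hb : X.bd (!σ) h = b) :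
      Step a b

/-- The same edge with the opposite orientation. -/
def Step.reverse {X : GraphOfGraphs.{u}} : {a b : X.V} → X.Step a b → X.Step b a
  | _, _, .vertical hab => .vertical hab.symm
  | _, _, .horizontal σ h ha hb => .horizontal (!σ) h hb (by simpa using ha)

/-- Edge paths in the 1-skeleton. -/
inductive EdgePath : X.V → X.V → Type u
  | nil (a : X.V) : EdgePath a a
  | cons {a b c : X.V} (s : X.Step a b) (q : EdgePath b c) : EdgePath a c

/-- Concatenation of edge paths. -/
def EdgePath.comp {X : GraphOfGraphs.{u}} :
    {a b c : X.V} → X.EdgePath a b → X.EdgePath b c → X.EdgePath a c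
  | _, _, _, .nil _, r => r
  | _, _, _, .cons s q, r => .cons s (q.comp r)

/-- Homotopy of edge paths relative to the endpoints: the congruence generated by the removal of
backtracks and by pushing a path across a square. -/
inductive Homotopic : {a b : X.V} → X.EdgePath a b → X.EdgePath a b → Prop
  | refl {a b : X.V} (q : X.EdgePath a b) : Homotopic q q
  | symm {a b : X.V} {q r : X.EdgePath a b} : Homotopic q r → Homotopic r q
  | trans {a b : X.V} {q r t : X.EdgePath a b} : Homotopic q r → Homotopic r t → Homotopic q t
  | comp {a b c : X.V} {q q' : X.EdgePath a b} {r r' : X.EdgePath b c} :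
      Homotopic q q' → Homotopic r r' → Homotopic (q.comp r) (q'.comp r')
  | backtrack {a b : X.V} (s : X.Step a b) :
      Homotopic (.cons s (.cons s.reverse (.nil a))) (.nil a)
  | square (σ : Bool) {h h' : X.H} (hh : X.strip.Adj h h') :
      Homotopic
        (.cons (.horizontal σ h rfl rfl)
          (.cons (.vertical ((X.bd (!σ)).map_adj hh)) (.nil _)))
        (.cons (.vertical ((X.bd σ).map_adj hh))
          (.cons (.horizontal σ h' rfl rfl) (.nil _)))

/-- The complex is nonempty and connected. -/
def IsConnected : Prop :=
  Nonempty X.V ∧ ∀ a b : X.V, Nonempty (X.EdgePath a b)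

/-- The complex is connected and its edge-path group is trivial. -/
def IsSimplyConnected : Prop :=
  X.IsConnected ∧ ∀ (a b : X.V) (q r : X.EdgePath a b), X.Homotopic q r

end EdgePaths

/-! ### Tubular graphs of graphs and the Brady-Meier condition -/

section Tubular

variable (X : GraphOfGraphs.{u})

/-- A tubular graph of graphs: a finite connected graph of spaces whose vertex spaces are finite
(connected) simplicial graphs, whose edge spaces are simplicial graphs homeomorphic to a circle
(`X.strip` is finite and each of its vertices has valence two), and whose attaching maps are
immersions, that is, locally injective. -/
structure IsTubular : Prop where
  finite_V : Finite X.V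
  finite_H : Finite X.H
  circle : ∀ h : X.H, (X.strip.neighborSet h).ncard = 2
  immersion : ∀ (σ : Bool) (h : X.H), Set.InjOn (X.bd σ) (X.strip.neighborSet h)
  connected : X.IsConnected

/-- The half-edges at the vertex `a`: the vertical ones are given by the other endpoint, the
horizontal ones by a horizontal edge and one of its two ends. -/
abbrev HalfEdge (a : X.V) : Type u :=
  {b : X.V // X.vert.Adj a b} ⊕ {x : Bool × X.H // X.bd x.1 x.2 = a}

/-- The link of a vertex: a vertical and a horizontal half-edge are joined by an edge when they
are adjacent half-edges of a square. -/
def link (a : X.V) : SimpleGraph (X.HalfEdge a) :=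
  SimpleGraph.fromRel fun y z =>
    ∃ (b : {b : X.V // X.vert.Adj a b}) (x : {x : Bool × X.H // X.bd x.1 x.2 = a}),
      y = Sum.inl b ∧ z = Sum.inr x ∧
        ∃ h' : X.H, X.strip.Adj x.1.2 h' ∧ X.bd x.1.1 h' = b.1

/-- All vertex links are connected, and remain connected after the removal of any simplex
(a vertex, or an edge together with its endpoints). -/
def IsBradyMeier : Prop :=
  ∀ a : X.V, (X.link a).Connected ∧
    (∀ y : X.HalfEdge a, ((X.link a).induce {y}ᶜ).Connected) ∧
    ∀ y z : X.HalfEdge a, (X.link a).Adj y z → ((X.link a).induce {y, z}ᶜ).Connected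

end Tubular

/-! ### Combinatorial maps, coverings, deck transformations -/

/-- A combinatorial map, preserving the `VH`-structure and the orientation of the horizontal
edges. -/
structure Hom (Y : GraphOfGraphs.{v}) (X : GraphOfGraphs.{u}) where
  onV : Y.vert →g X.vert
  onH : Y.strip →g X.strip
  comm : ∀ (σ : Bool) (h : Y.H), onV (Y.bd σ h) = X.bd σ (onH h)

/-- The map is bijective on the half-edges at each vertex and on the squares along each horizontal
edge. -/
structure Hom.IsCovering {Y : GraphOfGraphs.{v}} {X : GraphOfGraphs.{u}} (p : Hom Y X) :
    Prop where
  vertical : ∀ a : Y.V, Set.BijOn p.onV (Y.vert.neighborSet a) (X.vert.neighborSet (p.onV a))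
  horizontal : ∀ (σ : Bool) (a : Y.V),
    Set.BijOn p.onH {h | Y.bd σ h = a} {h | X.bd σ h = p.onV a}
  square : ∀ h : Y.H, Set.BijOn p.onH (Y.strip.neighborSet h) (X.strip.neighborSet (p.onH h))

/-- `p : Y → X` is the universal covering of `X`. -/
def Hom.IsUniversalCover {Y : GraphOfGraphs.{v}} {X : GraphOfGraphs.{u}} (p : Hom Y X) : Prop :=
  p.IsCovering ∧ Y.IsSimplyConnected

/-- A deck transformation of `p : Y → X`. When `p` is the universal covering, these are the
elements of the fundamental group of `X`, with their action on `Y`. -/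
structure Deck {Y : GraphOfGraphs.{v}} {X : GraphOfGraphs.{u}} (p : Hom Y X) where
  onV : Y.vert ≃g Y.vert
  onH : Y.strip ≃g Y.strip
  comm : ∀ (σ : Bool) (h : Y.H), onV (Y.bd σ h) = Y.bd σ (onH h)
  over_V : ∀ a : Y.V, p.onV (onV a) = p.onV a
  over_H : ∀ h : Y.H, p.onH (onH h) = p.onH h

/-- The underlying combinatorial map. -/
def Deck.toHom {Y : GraphOfGraphs.{v}} {X : GraphOfGraphs.{u}} {p : Hom Y X} (g : Deck p) :
    Hom Y Y where
  onV := g.onV.toHom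
  onH := g.onH.toHom
  comm := g.comm

/-! ### The geometric realisation with its intrinsic metric -/

section Realization

variable (Y : GraphOfGraphs.{u})

/-- The disjoint union of the closed cells. A vertical edge and a square appear once for each
orientation of their vertical direction; in a square the first coordinate is vertical and the
second one is horizontal. -/
inductive CellPoint
  | vertex (a : Y.V)
  | vedge (d : Y.vert.Dart) (s : unitInterval)
  | hedge (h : Y.H) (t : unitInterval)
  | square (d : Y.strip.Dart) (s t : unitInterval)

/-- The end of the unit interval that belongs to a side. -/
def sideEnd (σ : Bool) : unitInterval := if σ then 1 else 0

/-- The gluing of the closed cells. -/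
inductive Glue : Y.CellPoint → Y.CellPoint → Prop
  | vedge_symm (d : Y.vert.Dart) (s : unitInterval) : Glue (.vedge d s) (.vedge d.symm (unitInterval.symm s))
  | vedge_start (d : Y.vert.Dart) : Glue (.vedge d 0) (.vertex d.fst)
  | hedge_end (h : Y.H) (σ : Bool) : Glue (.hedge h (sideEnd σ)) (.vertex (Y.bd σ h))
  | square_symm (d : Y.strip.Dart) (s t : unitInterval) :
      Glue (.square d s t) (.square d.symm (unitInterval.symm s) t)
  | square_start (d : Y.strip.Dart) (t : unitInterval) : Glue (.square d 0 t) (.hedge d.fst t)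
  | square_side (d : Y.strip.Dart) (s : unitInterval) (σ : Bool) :
      Glue (.square d s (sideEnd σ)) (.vedge ((Y.bd σ).mapDart d) s)

/-- The geometric realisation: all closed cells, glued along their faces. -/
def Realization : Type u := Quot Y.Glue

variable {Y}

/-- The point of the realisation given by a point of a closed cell. -/
def ofCell (x : Y.CellPoint) : Y.Realization := Quot.mk _ x

/-- `Near x y ℓ`: the points `x` and `y` lie in a common closed cell, at Euclidean distance `ℓ`
in that cell. -/
inductive Near : Y.Realization → Y.Realization → ℝ → Prop
  | vedge (d : Y.vert.Dart) (s s' : unitInterval) :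
      Near (ofCell (.vedge d s)) (ofCell (.vedge d s')) |(s : ℝ) - s'|
  | hedge (h : Y.H) (t t' : unitInterval) :
      Near (ofCell (.hedge h t)) (ofCell (.hedge h t')) |(t : ℝ) - t'|
  | square (d : Y.strip.Dart) (s t s' t' : unitInterval) :
      Near (ofCell (.square d s t)) (ofCell (.square d s' t'))
        (Real.sqrt (((s : ℝ) - s') ^ 2 + ((t : ℝ) - t') ^ 2))

/-- `Chain x y ℓ`: there is a finite string of points from `x` to `y`, any two consecutive points
of which lie in a common closed cell, of total length `ℓ`. -/
inductive Chain : Y.Realization → Y.Realization → ℝ → Prop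
  | nil (x : Y.Realization) : Chain x x 0
  | cons {x y z : Y.Realization} {ℓ m : ℝ} : Near x y ℓ → Chain y z m → Chain x z (ℓ + m)

theorem Near.nonneg {x y : Y.Realization} {ℓ : ℝ} (h : Near x y ℓ) : 0 ≤ ℓ := by
  cases h <;> positivity

theorem Near.swap {x y : Y.Realization} {ℓ : ℝ} (h : Near x y ℓ) : Near y x ℓ := by
  cases h with
  | vedge d s s' => rw [abs_sub_comm]; exact .vedge d s' s
  | hedge h t t' => rw [abs_sub_comm]; exact .hedge h t' t
  | square d s t s' t' =>
      have e : ((s : ℝ) - s') ^ 2 + ((t : ℝ) - t') ^ 2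
          = ((s' : ℝ) - s) ^ 2 + ((t' : ℝ) - t) ^ 2 := by ring
      rw [e]; exact .square d s' t' s t

theorem Chain.nonneg {x y : Y.Realization} {ℓ : ℝ} (h : Chain x y ℓ) : 0 ≤ ℓ := by
  induction h with
  | nil x => exact le_rfl
  | cons h _ ih => exact add_nonneg h.nonneg ih

theorem Chain.append {x y z : Y.Realization} {ℓ m : ℝ} (h : Chain x y ℓ) (h' : Chain y z m) :
    Chain x z (ℓ + m) := by
  induction h with
  | nil x => simpa using h'
  | cons h _ ih => rw [add_assoc]; exact .cons h (ih h')

theorem Chain.swap {x y : Y.Realization} {ℓ : ℝ} (h : Chain x y ℓ) : Chain y x ℓ := by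
  induction h with
  | nil x => exact .nil x
  | @cons x y z ℓ m h _ ih =>
      have hx : Chain y x (ℓ + 0) := .cons h.swap (.nil x)
      have := ih.append hx
      rwa [add_zero, add_comm] at this

/-- The intrinsic metric of the square complex, with its topology: the distance of two points is
the infimum of the lengths of the strings between them. On the universal covering of a
nonpositively curved complex this is the `CAT(0)` metric. -/
noncomputable instance : PseudoEMetricSpace Y.Realization where
  edist x y := ⨅ (ℓ : ℝ) (_ : Chain x y ℓ), ENNReal.ofReal ℓ
  edist_self x := le_antisymm ((iInf₂_le 0 (Chain.nil x)).trans (by simp)) (zero_le)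
  edist_comm x y := by
    apply le_antisymm <;>
    exact le_iInf₂ fun ℓ h => iInf₂_le ℓ h.swap
  edist_triangle x y z := by
    refine ENNReal.le_of_forall_pos_le_add fun ε hε hfin => ?_
    have hε' : (ε / 2 : ℝ≥0∞) ≠ 0 := by simp [hε.ne']
    obtain ⟨h1, h2⟩ := ENNReal.add_lt_top.1 hfin
    obtain ⟨ℓ, hℓ⟩ := iInf_lt_iff.1 (ENNReal.lt_add_right h1.ne hε')
    obtain ⟨c, hℓ⟩ := iInf_lt_iff.1 hℓ
    obtain ⟨m, hm⟩ := iInf_lt_iff.1 (ENNReal.lt_add_right h2.ne hε')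
    obtain ⟨c', hm⟩ := iInf_lt_iff.1 hm
    refine (iInf₂_le (ℓ + m) (c.append c')).trans ?_
    rw [ENNReal.ofReal_add c.nonneg c'.nonneg]
    refine (add_le_add hℓ.le hm.le).trans (le_of_eq ?_)
    rw [add_add_add_comm, ENNReal.add_halves]

/-- A combinatorial map on the points of closed cells. -/
def Hom.onCell {Z : GraphOfGraphs.{v}} (f : Hom Y Z) : Y.CellPoint → Z.CellPoint
  | .vertex a => .vertex (f.onV a)
  | .vedge d s => .vedge (f.onV.mapDart d) s
  | .hedge h t => .hedge (f.onH h) t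
  | .square d s t => .square (f.onH.mapDart d) s t

/-- The map of realisations induced by a combinatorial map. -/
def Hom.map {Z : GraphOfGraphs.{v}} (f : Hom Y Z) : Y.Realization → Z.Realization :=
  Quot.lift (fun x => ofCell (f.onCell x)) (by
    intro x y hxy
    cases hxy with
    | vedge_symm d s => exact Quot.sound (.vedge_symm (f.onV.mapDart d) s)
    | vedge_start d => exact Quot.sound (.vedge_start (f.onV.mapDart d))
    | hedge_end h σ =>
        have := Quot.sound (Glue.hedge_end (f.onH h) σ)
        rw [← f.comm] at this
        exact this
    | square_symm d s t => exact Quot.sound (.square_symm (f.onH.mapDart d) s t)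
    | square_start d t => exact Quot.sound (.square_start (f.onH.mapDart d) t)
    | square_side d s σ =>
        have e : f.onV.mapDart ((Y.bd σ).mapDart d) = (Z.bd σ).mapDart (f.onH.mapDart d) := by
          apply SimpleGraph.Dart.ext
          exact Prod.ext (f.comm σ d.fst) (f.comm σ d.snd)
        have := Quot.sound (Glue.square_side (f.onH.mapDart d) s σ)
        rw [← e] at this
        exact this)

end Realization

/-! ### Lines, half-spaces, crossing, axes -/

section Lines

variable {Y : GraphOfGraphs.{v}}

/-- A line: an isometrically embedded copy of the real line. -/
def IsLine (L : Set Y.Realization) : Prop :=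
  ∃ c : ℝ → Y.Realization, Isometry c ∧ Set.range c = L

/-- A separating line: a line with disconnected complement. -/
def IsSeparatingLine (L : Set Y.Realization) : Prop :=
  IsLine L ∧ ¬ IsPreconnected Lᶜ

/-- A half-space of `L`: the closure of a component of the complement of `L`. -/
def IsHalfSpace (L A : Set Y.Realization) : Prop :=
  ∃ x ∈ Lᶜ, A = closure (connectedComponentIn Lᶜ x)

/-- `L` crosses `L'`: no half-space of `L'` contains `L`. -/
def Crosses (L L' : Set Y.Realization) : Prop :=
  ∀ A : Set Y.Realization, IsHalfSpace L' A → ¬ L ⊆ A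

/-- A combinatorial immersed bi-infinite vertical path. -/
structure VerticalPath (Y : GraphOfGraphs.{v}) where
  toFun : ℤ → Y.V
  adj : ∀ i, Y.vert.Adj (toFun i) (toFun (i + 1))
  immersed : ∀ i, toFun i ≠ toFun (i + 2)

/-- The union of the edges of a vertical path. -/
def VerticalPath.carrier (γ : VerticalPath Y) : Set Y.Realization :=
  {x | ∃ (i : ℤ) (s : unitInterval), x = ofCell (.vedge ⟨(γ.toFun i, γ.toFun (i + 1)), γ.adj i⟩ s)}

/-- A vertical line: a combinatorial line that is contained in a vertical tree. -/
def IsVerticalLine (L : Set Y.Realization) : Prop :=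
  IsLine L ∧ ∃ γ : VerticalPath Y, γ.carrier = L

variable {X : GraphOfGraphs.{u}} {p : Hom Y X}

/-- The translation length of a deck transformation. -/
noncomputable def Deck.translationLength (g : Deck p) : ℝ≥0∞ :=
  ⨅ x : Y.Realization, edist x (g.toHom.map x)

/-- `L` is an axis of `g`. -/
def Deck.IsAxis (g : Deck p) (L : Set Y.Realization) : Prop :=
  IsLine L ∧ g.toHom.map '' L ⊆ L ∧ ∃ x ∈ L, edist x (g.toHom.map x) = g.translationLength

/-- A periodic line: an axis of a nontrivial element. -/
def IsPeriodicLine (p : Hom Y X) (L : Set Y.Realization) : Prop :=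
  ∃ g : Deck p, (∃ a : Y.V, g.onV a ≠ a) ∧ g.IsAxis L

end Lines

/-! ### The regular sphere and the orthogonal sphere around a vertical path -/

section Spheres

variable (X : GraphOfGraphs.{u})

/-- Labels for the vertices of the regular sphere around a vertical path `P 0, …, P m`, in the
second cubical subdivision:
* `horiz i σ h`: the point at distance `1/4` from `P i` on the horizontal edge `h`, whose `σ`-end
  is `P i`;
* `vert i b`: the point at distance `1/4` from `P i` on the vertical edge `{P i, b}`, which leaves
  the path;
* `corner i σ h h'`: the point of the square `{h, h'}` at distance `1/4` from both of its sides at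
  its corner `P i`, which is the `σ`-end of `h`;
* `mid j σ q`: the point of the square `q`, which contains the edge `{P j, P (j + 1)}` as its
  `σ`-side, at distance `1/4` from the midpoint of that edge.

The index records the place on the path, so that places with the same image are kept apart. -/
inductive SphereVertex
  | horiz (i : ℕ) (σ : Bool) (h : X.H)
  | vert (i : ℕ) (b : X.V)
  | corner (i : ℕ) (σ : Bool) (h h' : X.H)
  | mid (j : ℕ) (σ : Bool) (q : Sym2 X.H)

variable {X}

/-- The edges of the regular sphere around the path `P 0, …, P m`. -/
inductive SphereEdge (P : ℕ → X.V) (m : ℕ) : X.SphereVertex → X.SphereVertex → Prop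
  | horiz (i : ℕ) (σ : Bool) (h h' : X.H) (hi : i ≤ m) (hP : X.bd σ h = P i)
      (hh : X.strip.Adj h h') : SphereEdge P m (.horiz i σ h) (.corner i σ h h')
  | vert (i : ℕ) (σ : Bool) (h h' : X.H) (hi : i ≤ m) (hP : X.bd σ h = P i)
      (hh : X.strip.Adj h h') (hnext : i < m → X.bd σ h' ≠ P (i + 1))
      (hprev : 0 < i → X.bd σ h' ≠ P (i - 1)) :
      SphereEdge P m (.vert i (X.bd σ h')) (.corner i σ h h')
  | mid_left (j : ℕ) (σ : Bool) (h h' : X.H) (hj : j < m) (hP : X.bd σ h = P j)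
      (hP' : X.bd σ h' = P (j + 1)) (hh : X.strip.Adj h h') :
      SphereEdge P m (.mid j σ s(h, h')) (.corner j σ h h')
  | mid_right (j : ℕ) (σ : Bool) (h h' : X.H) (hj : j < m) (hP : X.bd σ h = P j)
      (hP' : X.bd σ h' = P (j + 1)) (hh : X.strip.Adj h h') :
      SphereEdge P m (.mid j σ s(h, h')) (.corner (j + 1) σ h' h)

/-- The regular sphere around the vertical path `P 0, …, P m`. (Labels that do not name a point of
the sphere are isolated vertices.) -/
def regularSphere (P : ℕ → X.V) (m : ℕ) : SimpleGraph X.SphereVertex :=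
  SimpleGraph.fromRel (SphereEdge P m)

/-- The first cubical neighbourhood of a vertex in the regular sphere (its vertices). -/
def sphereStar (P : ℕ → X.V) (m : ℕ) (x : X.SphereVertex) : Set X.SphereVertex :=
  {y | y = x ∨ (regularSphere P m).Adj x y}

/-- The orthogonal sphere around a closed path `P 0, …, P m = P 0`: the closure of the complement
in the regular sphere of the second cubical neighbourhoods of two points. These are the point at
`P 0` on the terminal edge of the path and the point at `P m` on its initial edge. An edge lies in
the second cubical neighbourhood exactly when one of its endpoints lies in the first one. -/
def orthogonalSphere (P : ℕ → X.V) (m : ℕ) : SimpleGraph X.SphereVertex where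
  Adj x y := (regularSphere P m).Adj x y ∧
    ∀ z, z = x ∨ z = y →
      z ∉ sphereStar P m (.vert 0 (P (m - 1))) ∧ z ∉ sphereStar P m (.vert m (P 1))
  symm := ⟨fun _ _ h => ⟨h.1.symm, fun z hz => h.2 z hz.symm⟩⟩
  loopless := ⟨fun _ h => h.1.ne rfl⟩

/-- The pre-image in the regular sphere of the square `q`, which contains the edge
`{P j, P (j + 1)}` as its `σ`-side, around the `j`-th edge of the path (its vertices). -/
def squarePreimage (P : ℕ → X.V) (j : ℕ) (σ : Bool) (q : Sym2 X.H) : Set X.SphereVertex :=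
  {x | ∃ h h' : X.H, q = s(h, h') ∧ X.bd σ h = P j ∧ X.bd σ h' = P (j + 1) ∧
    (x = .horiz j σ h ∨ x = .corner j σ h h' ∨ x = .mid j σ q ∨
      x = .corner (j + 1) σ h' h ∨ x = .horiz (j + 1) σ h')}

end Spheres

/-! ### Vertical cycles -/

/-- A vertical cycle: an immersion of a circle with `len` vertices and `len` edges into the
vertical 1-skeleton, written as a function on the integers of period `len`. -/
structure Cycle (X : GraphOfGraphs.{u}) where
  len : ℕ
  len_pos : 0 < len
  toFun : ℤ → X.V
  periodic : ∀ i, toFun (i + len) = toFun i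
  adj : ∀ i, X.vert.Adj (toFun i) (toFun (i + 1))
  immersed : ∀ i, toFun i ≠ toFun (i + 2)

namespace Cycle

variable {X : GraphOfGraphs.{u}} {Y : GraphOfGraphs.{v}}

/-- `C` is an `n`-th power of `D`: it factors through an `n`-fold covering of circles, which is of
the form `i ↦ ε i + k` with `ε = ±1`. -/
def IsPower (C D : X.Cycle) (n : ℕ) : Prop :=
  C.len = n * D.len ∧ ∃ (ε : ℤˣ) (k : ℤ), ∀ i, C.toFun i = D.toFun (ε * i + k)

/-- `C` is not a non-trivial power of any cycle. -/
def IsMaximal (C : X.Cycle) : Prop :=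
  ∀ (D : X.Cycle) (n : ℕ), 2 ≤ n → ¬ C.IsPower D n

/-- `γ` is a lift of `C`. -/
def IsLift (C : X.Cycle) (p : Hom Y X) (γ : Y.VerticalPath) : Prop :=
  ∀ i, p.onV (γ.toFun i) = C.toFun i

/-- `C` is UC-separating: its lifts to the universal covering are separating lines. -/
def IsUCSeparating (C : X.Cycle) (p : Hom Y X) : Prop :=
  ∀ γ : Y.VerticalPath, C.IsLift p γ → IsSeparatingLine γ.carrier

/-- The closed path `P 0, …, P C.len` is a fundamental domain of `C`. -/
def IsFundamentalDomain (C : X.Cycle) (P : ℕ → X.V) : Prop :=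
  ∃ (ε : ℤˣ) (k : ℤ), ∀ i : ℕ, i ≤ C.len → P i = C.toFun (ε * i + k)

/-- `C` is `k`-repetitive: there are a vertical edge `e` and a fundamental domain `P` such that
`k` distinct edges of `P` are mapped to `e`, and for each square `q` that contains `e` (as its
`σ`-side) some component of the orthogonal sphere around `P` contains the pre-images of `q` around
each of these `k` edges. -/
def IsRepetitive (C : X.Cycle) (k : ℕ) : Prop :=
  ∃ e ∈ X.vert.edgeSet, ∃ P : ℕ → X.V, C.IsFundamentalDomain P ∧
    ∃ f : Fin k → ℕ, Function.Injective f ∧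
      (∀ i, f i < C.len ∧ s(P (f i), P (f i + 1)) = e) ∧
      ∀ (σ : Bool) (q : Sym2 X.H), q ∈ X.strip.edgeSet → q.map (X.bd σ) = e →
        ∃ K : (orthogonalSphere P C.len).ConnectedComponent,
          ∀ i, squarePreimage P (f i) σ q ⊆ K.supp

end Cycle

end GraphOfGraphs

/-!
The universal covering `Y` is a tree of vertical trees, joined by strips along lines. The global
facts about `Y` that are needed come from one principle: a family of sets over the vertices on
which the oriented edges act compatibly with backtracks and squares (`Transport`) is trivial over a
simply connected complex.

* Letting edge paths act on normal forms (horizontal letters pushed to the left as far as possible)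
  shows that the number of vertical letters of a normal form is a well-defined function of the
  endpoints. It is invariant under horizontal edges and changes by one along vertical edges, hence
  it extends to a `1`-Lipschitz function on the realisation, which grows with slope one along
  immersed vertical paths: these are lines (`VerticalPath.isometry_curve`), and they do not meet
  both ends of a horizontal edge (`not_reachable_of_horizontal`).
* The action on the fibres of the covering gives the deck transformations (`exists_deck`), so that
  lifts of periodic paths are axes.
* For a vertical path in `X` with a locally constant labelling of the half-edges that leave it by
  two values (`LabelledPath`), the changes of side act on the two values. Therefore a lift of a
  labelled path separates (`exists_isSplitting_of_labelledPath`), and the labels name the sides.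
  Conversely a separating lift gives a labelling (`IsSplitting.exists_labelledPath`).

It remains to construct a suitable labelled path in `X`. By the Brady-Meier condition every label
at a vertex of a path reaches both neighbouring edges of the path, so that the labels of the squares
at one edge determine all labels; in particular a labelling of a periodic path is periodic, with a
possibly larger period, since there are finitely many labellings of the squares at an edge. The
three edges of a `3`-repetitive cycle that are mapped to `e` give three labelled paths through `e`,
with the same labels at `e`, since labels are constant on the components of the orthogonal sphere.
They are different because the cycle is maximal. The main point is that two labelled paths with the
same labels at a common edge always part to different sides (`LabelledPath.AgreeAt.vl_ne`): to the
right of `e` each of two paths lies on some side of the other one, and these sides are opposite, and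
likewise to the left. With three paths, one of them has the two others on different sides to the
right, and whichever side another path takes to its left, there is one on the other side to its
right. Following the former for a full period up to `e`, then the latter for a full period, and so
on, gives a periodic path that carries a labelling, hence a separating line, and this line and the
third path leave each other on different sides at both ends of their common segment
(`LabelledPath.exists_crossing`), which means that they cross (`IsSplitting.crosses_of_partsAt`).
-/

universe w

namespace GraphOfGraphs

/-! ### Transport along edge paths -/

/-- A flat family of sets over the vertices: every oriented edge acts on the fibres, the action of
the reversed edge undoes that of the edge, and the two ways around a square agree. -/
structure Transport (Y : GraphOfGraphs.{u}) (F : Y.V → Type w) where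
  map : ∀ {a b : Y.V}, Y.Step a b → F a → F b
  backtrack : ∀ {a b : Y.V} (s : Y.Step a b) (x : F a), map s.reverse (map s x) = x
  square : ∀ (σ : Bool) {h h' : Y.H} (hh : Y.strip.Adj h h') (x : F (Y.bd σ h)),
    map (.vertical ((Y.bd (!σ)).map_adj hh)) (map (.horizontal σ h rfl rfl) x) =
      map (.horizontal σ h' rfl rfl) (map (.vertical ((Y.bd σ).map_adj hh)) x)

namespace Transport

variable {Y : GraphOfGraphs.{u}} {F : Y.V → Type w} (T : Y.Transport F)

/-- The action of an edge path on the fibres. -/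
def along : {a b : Y.V} → Y.EdgePath a b → F a → F b
  | _, _, .nil _, x => x
  | _, _, .cons s q, x => along q (T.map s x)

theorem along_comp {a b c : Y.V} (q : Y.EdgePath a b) (r : Y.EdgePath b c) (x : F a) :
    T.along (q.comp r) x = T.along r (T.along q x) := by
  induction q with
  | nil => rfl
  | cons s q ih => exact ih r _

theorem along_homotopic {a b : Y.V} {q r : Y.EdgePath a b} (h : Y.Homotopic q r) (x : F a) :
    T.along q x = T.along r x := by
  induction h with
  | refl => rfl
  | symm _ ih => exact (ih x).symm
  | trans _ _ ih ih' => exact (ih x).trans (ih' x)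
  | comp _ _ ih ih' => rw [along_comp, along_comp, ih, ih']
  | backtrack s => exact T.backtrack s x
  | square σ hh => exact T.square σ hh x

/-- In a simply connected complex the transport depends on the endpoints only. -/
noncomputable def carry (hY : Y.IsSimplyConnected) {a b : Y.V} (x : F a) : F b :=
  T.along (hY.1.2 a b).some x

theorem along_eq_carry (hY : Y.IsSimplyConnected) {a b : Y.V} (q : Y.EdgePath a b) (x : F a) :
    T.along q x = T.carry hY x :=
  T.along_homotopic (hY.2 a b _ _) x

theorem carry_self (hY : Y.IsSimplyConnected) {a : Y.V} (x : F a) : T.carry hY x = x :=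
  (T.along_eq_carry hY (.nil a) x).symm

theorem carry_carry (hY : Y.IsSimplyConnected) {a b c : Y.V} (x : F a) :
    T.carry hY (T.carry hY x : F b) = (T.carry hY x : F c) := by
  obtain ⟨q⟩ := hY.1.2 a b
  obtain ⟨r⟩ := hY.1.2 b c
  rw [← T.along_eq_carry hY q, ← T.along_eq_carry hY r, ← along_comp, T.along_eq_carry hY]

theorem carry_step (hY : Y.IsSimplyConnected) {o a b : Y.V} (x : F o) (s : Y.Step a b) :
    T.carry hY x = T.map s (T.carry hY x : F a) := by
  rw [← T.carry_carry hY (b := a) x, ← T.along_eq_carry hY (.cons s (.nil b))]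
  rfl

end Transport

/-! ### Normal forms of edge paths -/

section NormalForm

variable (Y : GraphOfGraphs.{u})

/-- The attaching maps of the edge spaces are locally injective. -/
def IsImmersed : Prop :=
  ∀ (σ : Bool) (h : Y.H), Set.InjOn (Y.bd σ) (Y.strip.neighborSet h)

/-- An oriented edge of the 1-skeleton, the horizontal ones given by the end they start from. -/
inductive Letter
  | vert (d : Y.vert.Dart)
  | hor (σ : Bool) (h : Y.H)

variable {Y}

/-- The vertical edge `d` runs along the edge `{h', h}` of an edge space, on its `σ`-side, and ends
at `h`. -/
def RunsAlong (σ : Bool) (h : Y.H) (d : Y.vert.Dart) (h' : Y.H) : Prop :=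
  Y.strip.Adj h' h ∧ Y.bd σ h' = d.fst ∧ Y.bd σ h = d.snd

/-- The two letters `x y` may follow each other in a normal form, `x` after `y`: the word `y x` is
not a backtrack, and it is not a vertical edge `y` that can be pushed across the edge space of the
horizontal edge `x`. -/
def Follows : Y.Letter → Y.Letter → Prop
  | .vert d, .vert d' => d' ≠ d.symm
  | .vert _, .hor _ _ => True
  | .hor σ h, .vert d => ¬ ∃ h', RunsAlong σ h d h'
  | .hor σ h, .hor τ k => ¬ (τ = !σ ∧ k = h)

open Classical in
/-- Right multiplication of a normal form by a vertical edge. The last letter of the word is at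
the head of the list. -/
noncomputable def pushVert (d : Y.vert.Dart) : List Y.Letter → List Y.Letter
  | .vert d' :: S => if d' = d.symm then S else .vert d :: .vert d' :: S
  | S => .vert d :: S

open Classical in
/-- Right multiplication of a normal form by a horizontal edge: it is moved to the left past all
the vertical edges that run along its edge space. -/
noncomputable def pushHor (σ : Bool) : Y.H → List Y.Letter → List Y.Letter
  | h, .vert d :: S =>
      if H : ∃ h', RunsAlong σ h d h' then
        .vert ((Y.bd (!σ)).mapDart ⟨(H.choose, h), H.choose_spec.1⟩) :: pushHor σ H.choose S
      else .hor σ h :: .vert d :: S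
  | h, .hor τ k :: S => if τ = !σ ∧ k = h then S else .hor σ h :: .hor τ k :: S
  | h, [] => [.hor σ h]

theorem RunsAlong.unique (hY : Y.IsImmersed) {σ : Bool} {h h' h'' : Y.H} {d : Y.vert.Dart}
    (h1 : RunsAlong σ h d h') (h2 : RunsAlong σ h d h'') : h' = h'' :=
  hY σ h h1.1.symm h2.1.symm (h1.2.1.trans h2.2.1.symm)

theorem pushHor_along (hY : Y.IsImmersed) {σ : Bool} {h h' : Y.H} {d : Y.vert.Dart}
    (H : RunsAlong σ h d h') (S : List Y.Letter) :
    pushHor σ h (.vert d :: S) =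
      .vert ((Y.bd (!σ)).mapDart ⟨(h', h), H.1⟩) :: pushHor σ h' S := by
  have H' : ∃ h', RunsAlong σ h d h' := ⟨h', H⟩
  obtain rfl : H'.choose = h' := H'.choose_spec.unique hY H
  rw [pushHor, dif_pos H']

theorem pushHor_not_along {σ : Bool} {h : Y.H} {d : Y.vert.Dart}
    (H : ¬ ∃ h', RunsAlong σ h d h') (S : List Y.Letter) :
    pushHor σ h (.vert d :: S) = .hor σ h :: .vert d :: S := by
  rw [pushHor, dif_neg H]

theorem pushHor_cancel (σ : Bool) (h : Y.H) (S : List Y.Letter) :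
    pushHor σ h (.hor (!σ) h :: S) = S := by
  rw [pushHor, if_pos ⟨rfl, rfl⟩]

theorem pushVert_cancel (d : Y.vert.Dart) (S : List Y.Letter) :
    pushVert d (.vert d.symm :: S) = S := by
  rw [pushVert, if_pos rfl]

/-- A letter that may follow a normal form is simply appended. -/
theorem pushVert_of_follows {d : Y.vert.Dart} {S : List Y.Letter}
    (h : List.IsChain Follows (.vert d :: S)) : pushVert d S = .vert d :: S := by
  match S, h with
  | [], _ => rfl
  | .hor _ _ :: _, _ => rfl
  | .vert d' :: S, h =>
    rw [List.isChain_cons_cons] at h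
    rw [pushVert, if_neg h.1]

theorem pushHor_of_follows {σ : Bool} {h : Y.H} {S : List Y.Letter}
    (H : List.IsChain Follows (.hor σ h :: S)) : pushHor σ h S = .hor σ h :: S := by
  match S, H with
  | [], _ => rfl
  | .hor _ _ :: _, H =>
    rw [List.isChain_cons_cons] at H
    rw [pushHor, if_neg H.1]
  | .vert d' :: S, H =>
    rw [List.isChain_cons_cons] at H
    exact pushHor_not_along H.1 _

theorem isChain_pushVert (d : Y.vert.Dart) {S : List Y.Letter} (h : List.IsChain Follows S) :
    List.IsChain Follows (pushVert d S) := by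
  match S, h with
  | [], _ => exact List.isChain_singleton _
  | .hor _ _ :: _, h => exact List.isChain_cons_cons.2 ⟨trivial, h⟩
  | .vert d' :: S, h =>
    rw [pushVert]
    split_ifs with e
    · exact h.tail
    · exact List.isChain_cons_cons.2 ⟨e, h⟩

/-- If a vertical edge along the edge space of `h` may follow `S`, then the parallel edge on the
other side may follow the product of `S` with `h`. -/
theorem isChain_vert_pushHor (hY : Y.IsImmersed) {σ : Bool} {h h' : Y.H}
    (hh : Y.strip.Adj h h') {S : List Y.Letter}
    (hS : List.IsChain Follows (.vert ((Y.bd σ).mapDart ⟨(h, h'), hh⟩) :: S))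
    (hp : List.IsChain Follows (pushHor σ h S)) :
    List.IsChain Follows
      (.vert ((Y.bd (!σ)).mapDart ⟨(h, h'), hh⟩) :: pushHor σ h S) := by
  match S, hS, hp with
  | [], _, hp => exact List.isChain_cons_cons.2 ⟨trivial, hp⟩
  | .vert d :: S, hS, hp =>
    by_cases H : ∃ h'', RunsAlong σ h d h''
    · obtain ⟨h'', H⟩ := H
      rw [pushHor_along hY H] at hp ⊢
      refine List.isChain_cons_cons.2 ⟨fun e => ?_, hp⟩
      have e1 : Y.bd (!σ) h'' = Y.bd (!σ) h' := congrArg (fun d => d.fst) e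
      have e2 : h'' = h' := hY (!σ) h H.1.symm hh e1
      subst e2
      refine (List.isChain_cons_cons.1 hS).1 (SimpleGraph.Dart.ext _ _ (Prod.ext ?_ ?_))
      · exact H.2.1.symm
      · exact H.2.2.symm
    · rw [pushHor_not_along H] at hp ⊢
      exact List.isChain_cons_cons.2 ⟨trivial, hp⟩
  | .hor τ k :: S, hS, hp =>
    rw [pushHor] at hp ⊢
    split_ifs at hp ⊢ with e
    · obtain ⟨rfl, rfl⟩ := e
      have h2 := hS.tail
      clear hp hS
      match S, h2 with
      | [], _ => exact List.isChain_singleton _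
      | .hor _ _ :: _, h2 => exact List.isChain_cons_cons.2 ⟨trivial, h2.tail⟩
      | .vert d :: S, h2 =>
        refine List.isChain_cons_cons.2 ⟨fun e => ?_, h2.tail⟩
        subst e
        exact (List.isChain_cons_cons.1 h2).1 ⟨h', hh.symm, rfl, rfl⟩
    · exact List.isChain_cons_cons.2 ⟨trivial, hp⟩

theorem isChain_pushHor (hY : Y.IsImmersed) (σ : Bool) (h : Y.H) {S : List Y.Letter}
    (hS : List.IsChain Follows S) : List.IsChain Follows (pushHor σ h S) := by
  induction S generalizing h with
  | nil => exact List.isChain_singleton _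
  | cons x S ih =>
    match x, hS with
    | .hor τ k, hS =>
      rw [pushHor]
      split_ifs with e
      · exact hS.tail
      · exact List.isChain_cons_cons.2 ⟨e, hS⟩
    | .vert d, hS =>
      by_cases H : ∃ h', RunsAlong σ h d h'
      · obtain ⟨h', H⟩ := H
        rw [pushHor_along hY H]
        refine isChain_vert_pushHor hY H.1 ?_ (ih h' hS.tail)
        have e : d = (Y.bd σ).mapDart ⟨(h', h), H.1⟩ :=
          SimpleGraph.Dart.ext _ _ (Prod.ext H.2.1.symm H.2.2.symm)
        rwa [← e]
      · rw [pushHor_not_along H]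
        exact List.isChain_cons_cons.2 ⟨H, hS⟩

theorem pushVert_pushVert (d : Y.vert.Dart) {S : List Y.Letter} (hS : List.IsChain Follows S) :
    pushVert d.symm (pushVert d S) = S := by
  match S, hS with
  | [], _ => exact pushVert_cancel d.symm _
  | .hor _ _ :: _, _ => exact pushVert_cancel d.symm _
  | .vert d' :: S, hS =>
    rw [pushVert]
    split_ifs with e
    · subst e
      exact pushVert_of_follows hS
    · exact pushVert_cancel d.symm _

theorem pushHor_pushHor (hY : Y.IsImmersed) (σ : Bool) (h : Y.H) {S : List Y.Letter}
    (hS : List.IsChain Follows S) : pushHor (!σ) h (pushHor σ h S) = S := by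
  induction S generalizing h with
  | nil => simp [pushHor]
  | cons x S ih =>
    match x, hS with
    | .hor τ k, hS =>
      by_cases e : τ = !σ ∧ k = h
      · obtain ⟨rfl, rfl⟩ := e
        rw [pushHor_cancel]
        exact pushHor_of_follows hS
      · rw [pushHor, if_neg e]
        simp [pushHor]
    | .vert d, hS =>
      by_cases H : ∃ h', RunsAlong σ h d h'
      · obtain ⟨h', H⟩ := H
        rw [pushHor_along hY H,
          pushHor_along hY (h' := h') (σ := !σ) ⟨H.1, rfl, rfl⟩, ih h' hS.tail]
        congr 2
        refine SimpleGraph.Dart.ext _ _ (Prod.ext ?_ ?_)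
        · simpa using H.2.1
        · simpa using H.2.2
      · rw [pushHor_not_along H]
        simp [pushHor]

theorem pushHor_pushVert (hY : Y.IsImmersed) {σ : Bool} {h h' : Y.H} (hh : Y.strip.Adj h h')
    {S : List Y.Letter} (hS : List.IsChain Follows S) :
    pushVert ((Y.bd (!σ)).mapDart ⟨(h, h'), hh⟩) (pushHor σ h S) =
      pushHor σ h' (pushVert ((Y.bd σ).mapDart ⟨(h, h'), hh⟩) S) := by
  by_cases hc : List.IsChain Follows (.vert ((Y.bd σ).mapDart ⟨(h, h'), hh⟩) :: S)
  · rw [pushVert_of_follows hc, pushHor_along hY (h' := h) ⟨hh, rfl, rfl⟩,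
      pushVert_of_follows (isChain_vert_pushHor hY hh hc (isChain_pushHor hY σ h hS))]
  · match S, hS, hc with
    | [], _, hc => exact absurd (List.isChain_singleton _) hc
    | .hor _ _ :: _, hS, hc => exact absurd (List.isChain_cons_cons.2 ⟨trivial, hS⟩) hc
    | .vert d :: S, hS, hc =>
      have e : d = ((Y.bd σ).mapDart ⟨(h, h'), hh⟩).symm := by
        by_contra e
        exact hc (List.isChain_cons_cons.2 ⟨e, hS⟩)
      subst e
      rw [pushVert_cancel, pushHor_along hY (h' := h') ⟨hh.symm, rfl, rfl⟩]
      exact pushVert_cancel _ _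

/-- Right multiplication of a normal form by an oriented edge. -/
noncomputable def pushStep (hY : Y.IsImmersed) :
    {a b : Y.V} → Y.Step a b → {S : List Y.Letter // List.IsChain Follows S} →
      {S : List Y.Letter // List.IsChain Follows S}
  | _, _, .vertical hab, S => ⟨pushVert ⟨(_, _), hab⟩ S.1, isChain_pushVert _ S.2⟩
  | _, _, .horizontal σ h _ _, S => ⟨pushHor σ h S.1, isChain_pushHor hY σ h S.2⟩

/-- The action of the oriented edges on normal forms. -/
noncomputable def normalForms (hY : Y.IsImmersed) :
    Y.Transport fun _ => {S : List Y.Letter // List.IsChain Follows S} where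
  map := pushStep hY
  backtrack s S := by
    cases s with
    | vertical hab => exact Subtype.ext (pushVert_pushVert ⟨(_, _), hab⟩ S.2)
    | horizontal σ h ha hb => exact Subtype.ext (pushHor_pushHor hY σ h S.2)
  square σ h h' hh S := Subtype.ext (pushHor_pushVert hY hh S.2)

/-- The number of vertical letters of a word. It does not change under multiplication by a
horizontal edge, so it descends to the tree obtained by collapsing the horizontal edges. -/
def vertCount : List Y.Letter → ℕ
  | [] => 0
  | .vert _ :: S => vertCount S + 1
  | .hor _ _ :: S => vertCount S

theorem vertCount_pushHor (hY : Y.IsImmersed) (σ : Bool) (h : Y.H) (S : List Y.Letter) :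
    vertCount (pushHor σ h S) = vertCount S := by
  induction S generalizing h with
  | nil => rfl
  | cons x S ih =>
    match x with
    | .hor τ k =>
      rw [pushHor]
      split_ifs <;> rfl
    | .vert d =>
      by_cases H : ∃ h', RunsAlong σ h d h'
      · obtain ⟨h', H⟩ := H
        rw [pushHor_along hY H, vertCount, vertCount, ih]
      · rw [pushHor_not_along H]
        rfl

theorem vertCount_pushVert (d : Y.vert.Dart) (S : List Y.Letter) :
    vertCount (pushVert d S) = vertCount S + 1 ∨ vertCount S = vertCount (pushVert d S) + 1 := by
  match S with
  | [] => exact Or.inl rfl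
  | .hor _ _ :: _ => exact Or.inl rfl
  | .vert d' :: S =>
    rw [pushVert]
    split_ifs
    · exact Or.inr rfl
    · exact Or.inl rfl

end NormalForm

/-! ### Vertical geodesics of a simply connected complex -/

section Geodesics

variable {Y : GraphOfGraphs.{u}}

/-- The normal form of the paths from `o` to `a`. -/
noncomputable def normalForm (hI : Y.IsImmersed) (hY : Y.IsSimplyConnected) (o a : Y.V) :
    List Y.Letter :=
  ((normalForms hI).carry hY (a := o) (b := a) ⟨[], List.isChain_nil⟩).1

theorem normalForm_self (hI : Y.IsImmersed) (hY : Y.IsSimplyConnected) (o : Y.V) :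
    normalForm hI hY o o = [] := by
  rw [normalForm, Transport.carry_self]

theorem normalForm_vert (hI : Y.IsImmersed) (hY : Y.IsSimplyConnected) (o : Y.V) {a b : Y.V}
    (hab : Y.vert.Adj a b) :
    normalForm hI hY o b = pushVert ⟨(a, b), hab⟩ (normalForm hI hY o a) := by
  rw [normalForm, Transport.carry_step _ hY _ (.vertical hab)]
  rfl

theorem normalForm_hor (hI : Y.IsImmersed) (hY : Y.IsSimplyConnected) (o : Y.V) (σ : Bool)
    (h : Y.H) :
    normalForm hI hY o (Y.bd (!σ) h) = pushHor σ h (normalForm hI hY o (Y.bd σ h)) := by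
  rw [normalForm, Transport.carry_step _ hY _ (.horizontal σ h rfl rfl)]
  rfl

/-- The distance from `o` in the tree that is obtained by collapsing the horizontal edges. -/
noncomputable def treeDist (hI : Y.IsImmersed) (hY : Y.IsSimplyConnected) (o a : Y.V) : ℕ :=
  vertCount (normalForm hI hY o a)

theorem treeDist_hor (hI : Y.IsImmersed) (hY : Y.IsSimplyConnected) (o : Y.V) (σ τ : Bool)
    (h : Y.H) : treeDist hI hY o (Y.bd σ h) = treeDist hI hY o (Y.bd τ h) := by
  have key : ∀ σ, treeDist hI hY o (Y.bd (!σ) h) = treeDist hI hY o (Y.bd σ h) := fun σ => by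
    rw [treeDist, treeDist, normalForm_hor, vertCount_pushHor hI]
  cases σ <;> cases τ
  · rfl
  · exact key true
  · exact key false
  · rfl

theorem treeDist_vert (hI : Y.IsImmersed) (hY : Y.IsSimplyConnected) (o : Y.V) {a b : Y.V}
    (hab : Y.vert.Adj a b) :
    treeDist hI hY o b = treeDist hI hY o a + 1 ∨ treeDist hI hY o a = treeDist hI hY o b + 1 := by
  rw [treeDist, treeDist, normalForm_vert hI hY o hab]
  exact vertCount_pushVert _ _

/-- An immersed vertical path is its own normal form. -/
theorem normalForm_verticalPath (hI : Y.IsImmersed) (hY : Y.IsSimplyConnected)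
    (γ : Y.VerticalPath) (i : ℤ) (n : ℕ) :
    vertCount (normalForm hI hY (γ.toFun i) (γ.toFun (i + n))) = n ∧
      List.IsChain Follows (.vert ⟨(γ.toFun (i + n), γ.toFun (i + n + 1)), γ.adj _⟩ ::
        normalForm hI hY (γ.toFun i) (γ.toFun (i + n))) := by
  induction n with
  | zero =>
    have : normalForm hI hY (γ.toFun i) (γ.toFun (i + (0 : ℕ))) = [] := by
      rw [Nat.cast_zero, add_zero, normalForm_self]
    rw [this]
    exact ⟨rfl, List.isChain_singleton _⟩
  | succ n ih =>
    have e : i + ((n + 1 : ℕ) : ℤ) = i + n + 1 := by push_cast; ring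
    rw [e, normalForm_vert hI hY _ (γ.adj (i + n)), pushVert_of_follows ih.2]
    refine ⟨by rw [vertCount, ih.1], List.isChain_cons_cons.2 ⟨fun e => ?_, ih.2⟩⟩
    have e1 : γ.toFun (i + n) = γ.toFun (i + n + 1 + 1) := congrArg (fun d => d.fst) e
    rw [add_assoc (i + n)] at e1
    exact γ.immersed _ e1

theorem treeDist_verticalPath (hI : Y.IsImmersed) (hY : Y.IsSimplyConnected)
    (γ : Y.VerticalPath) {i j : ℤ} (hij : i ≤ j) :
    (treeDist hI hY (γ.toFun i) (γ.toFun j) : ℤ) = j - i := by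
  obtain ⟨n, hn⟩ := Int.eq_ofNat_of_zero_le (sub_nonneg.2 hij)
  obtain rfl : j = i + n := by omega
  rw [treeDist, (normalForm_verticalPath hI hY γ i n).1]
  ring

theorem VerticalPath.injective (hI : Y.IsImmersed) (hY : Y.IsSimplyConnected)
    (γ : Y.VerticalPath) : Function.Injective γ.toFun := by
  have key : ∀ i j, i ≤ j → γ.toFun i = γ.toFun j → i = j := fun i j hij e => by
    have h1 := treeDist_verticalPath hI hY γ hij
    rw [← e, treeDist, normalForm_self] at h1
    simp only [vertCount] at h1
    push_cast at h1
    omega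
  intro i j e
  rcases le_total i j with h | h
  · exact key i j h e
  · exact (key j i h e.symm).symm

/-- The vertices of a vertical path are joined by vertical edges of the path only. -/
theorem VerticalPath.eq_of_adj (hI : Y.IsImmersed) (hY : Y.IsSimplyConnected)
    (γ : Y.VerticalPath) {i j : ℤ} (h : Y.vert.Adj (γ.toFun i) (γ.toFun j)) :
    j = i + 1 ∨ i = j + 1 := by
  have hne : i ≠ j := fun e => h.ne (congrArg _ e)
  rcases le_total i j with hij | hij
  · have h1 := treeDist_verticalPath hI hY γ hij
    have h2 := treeDist_vert hI hY (γ.toFun i) h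
    rw [show treeDist hI hY (γ.toFun i) (γ.toFun i) = 0 by
      rw [treeDist, normalForm_self]; rfl] at h2
    omega
  · have h1 := treeDist_verticalPath hI hY γ hij
    have h2 := treeDist_vert hI hY (γ.toFun j) h
    rw [show treeDist hI hY (γ.toFun j) (γ.toFun j) = 0 by
      rw [treeDist, normalForm_self]; rfl] at h2
    omega

/-- The ends of a horizontal edge lie in different vertical trees. -/
theorem not_reachable_of_horizontal (hI : Y.IsImmersed) (hY : Y.IsSimplyConnected) (σ : Bool)
    (h : Y.H) : ¬ Y.vert.Reachable (Y.bd (!σ) h) (Y.bd σ h) := by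
  -- The letter `h` at the bottom of the normal form survives all vertical moves.
  have key : ∀ a b : Y.V, Y.vert.Reachable a b →
      (∃ S, normalForm hI hY (Y.bd σ h) a = S ++ [.hor σ h]) →
      ∃ S, normalForm hI hY (Y.bd σ h) b = S ++ [.hor σ h] := by
    rintro a b ⟨w⟩
    induction w with
    | nil => exact id
    | cons hab _ ih =>
      rintro ⟨S, hS⟩
      refine ih ?_
      rw [normalForm_vert hI hY _ hab, hS]
      match S with
      | [] => exact ⟨[_], rfl⟩
      | .hor _ _ :: S => exact ⟨_ :: _ :: S, rfl⟩
      | .vert d :: S =>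
        rw [List.cons_append, pushVert]
        split_ifs
        · exact ⟨S, rfl⟩
        · exact ⟨_ :: _ :: S, rfl⟩
  intro hr
  obtain ⟨S, hS⟩ := key _ _ hr ⟨[], by rw [normalForm_hor, normalForm_self]; rfl⟩
  rw [normalForm_self] at hS
  simp at hS

end Geodesics

/-! ### Functions on the realisation -/

section Hat

variable {Y : GraphOfGraphs.{u}}

/-- Linear interpolation. -/
def interp (t x y : ℝ) : ℝ := (1 - t) * x + t * y

theorem abs_interp_le {t x y K : ℝ} (h0 : 0 ≤ t) (h1 : t ≤ 1) (hx : |x| ≤ K) (hy : |y| ≤ K) :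
    |interp t x y| ≤ K := by
  rw [abs_le] at *
  constructor <;> unfold interp <;> nlinarith

/-- The multilinear extension of a function on the vertices, on the closed cells. -/
def hatCell (f : Y.V → ℝ) : Y.CellPoint → ℝ
  | .vertex a => f a
  | .vedge d s => interp s (f d.fst) (f d.snd)
  | .hedge h t => interp t (f (Y.bd false h)) (f (Y.bd true h))
  | .square d s t =>
      interp s (interp t (f (Y.bd false d.fst)) (f (Y.bd true d.fst)))
        (interp t (f (Y.bd false d.snd)) (f (Y.bd true d.snd)))

/-- The multilinear extension of a function on the vertices to the realisation. -/
def hat (f : Y.V → ℝ) : Y.Realization → ℝ :=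
  Quot.lift (hatCell f) (by
    intro x y hxy
    cases hxy with
    | vedge_symm d s =>
      simp [hatCell, interp]
      ring
    | vedge_start d => simp [hatCell, interp]
    | hedge_end h σ => cases σ <;> simp [hatCell, interp, sideEnd]
    | square_symm d s t =>
      simp [hatCell, interp]
      ring
    | square_start d t => simp [hatCell, interp]
    | square_side d s σ => cases σ <;> simp [hatCell, interp, sideEnd])

@[simp]
theorem hat_ofCell (f : Y.V → ℝ) (x : Y.CellPoint) : hat f (ofCell x) = hatCell f x := rfl

theorem abs_hat_sub_le_of_near {f : Y.V → ℝ} {A B : ℝ} (hAB : A + B ≤ 1) (hA0 : 0 ≤ A)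
    (hB0 : 0 ≤ B) (hA : ∀ a b, Y.vert.Adj a b → |f b - f a| ≤ A)
    (hB : ∀ h, |f (Y.bd true h) - f (Y.bd false h)| ≤ B) {x y : Y.Realization} {ℓ : ℝ}
    (h : Near x y ℓ) : |hat f x - hat f y| ≤ ℓ := by
  cases h with
  | vedge d s s' =>
    have e : hat f (ofCell (.vedge d s)) - hat f (ofCell (.vedge d s'))
        = ((s : ℝ) - s') * (f d.snd - f d.fst) := by
      simp [hatCell, interp]; ring
    rw [e, abs_mul]
    exact mul_le_of_le_one_right (abs_nonneg _) ((hA _ _ d.adj).trans (by linarith))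
  | hedge h t t' =>
    have e : hat f (ofCell (.hedge h t)) - hat f (ofCell (.hedge h t'))
        = ((t : ℝ) - t') * (f (Y.bd true h) - f (Y.bd false h)) := by
      simp [hatCell, interp]; ring
    rw [e, abs_mul]
    exact mul_le_of_le_one_right (abs_nonneg _) ((hB _).trans (by linarith))
  | square d s t s' t' =>
    have e : hat f (ofCell (.square d s t)) - hat f (ofCell (.square d s' t'))
        = ((s : ℝ) - s') * interp t (f (Y.bd false d.snd) - f (Y.bd false d.fst))
            (f (Y.bd true d.snd) - f (Y.bd true d.fst))
          + ((t : ℝ) - t') * interp s' (f (Y.bd true d.fst) - f (Y.bd false d.fst))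
            (f (Y.bd true d.snd) - f (Y.bd false d.snd)) := by
      simp [hatCell, interp]; ring
    have h1 := abs_interp_le t.2.1 t.2.2 (hA _ _ ((Y.bd false).map_adj d.adj))
      (hA _ _ ((Y.bd true).map_adj d.adj))
    have h2 := abs_interp_le s'.2.1 s'.2.2 (hB d.fst) (hB d.snd)
    have h3 : |(s : ℝ) - s'| ≤ Real.sqrt (((s : ℝ) - s') ^ 2 + ((t : ℝ) - t') ^ 2) :=
      Real.abs_le_sqrt (by nlinarith [sq_nonneg ((t : ℝ) - t')])
    have h4 : |(t : ℝ) - t'| ≤ Real.sqrt (((s : ℝ) - s') ^ 2 + ((t : ℝ) - t') ^ 2) :=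
      Real.abs_le_sqrt (by nlinarith [sq_nonneg ((s : ℝ) - s')])
    set r := Real.sqrt (((s : ℝ) - s') ^ 2 + ((t : ℝ) - t') ^ 2)
    have hr : 0 ≤ r := Real.sqrt_nonneg _
    rw [e]
    refine (abs_add_le _ _).trans ?_
    rw [abs_mul, abs_mul]
    calc _ ≤ r * A + r * B := add_le_add (mul_le_mul h3 h1 (abs_nonneg _) hr)
          (mul_le_mul h4 h2 (abs_nonneg _) hr)
      _ = r * (A + B) := by ring
      _ ≤ r := mul_le_of_le_one_right hr hAB

/-- The multilinear extension of a function that varies by at most `A` along the vertical edges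
and by at most `B` along the horizontal edges is `1`-Lipschitz when `A + B ≤ 1`. -/
theorem lipschitzWith_hat {f : Y.V → ℝ} {A B : ℝ} (hAB : A + B ≤ 1) (hA0 : 0 ≤ A)
    (hB0 : 0 ≤ B) (hA : ∀ a b, Y.vert.Adj a b → |f b - f a| ≤ A)
    (hB : ∀ h, |f (Y.bd true h) - f (Y.bd false h)| ≤ B) : LipschitzWith 1 (hat f) := by
  have key : ∀ {x y : Y.Realization} {ℓ : ℝ}, Chain x y ℓ → |hat f x - hat f y| ≤ ℓ := by
    intro x y ℓ h
    induction h with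
    | nil x => simp
    | @cons x y z ℓ m h _ ih =>
      exact (abs_sub_le _ (hat f y) _).trans
        (add_le_add (abs_hat_sub_le_of_near hAB hA0 hB0 hA hB h) ih)
  intro x y
  rw [ENNReal.coe_one, one_mul, edist_dist, Real.dist_eq]
  exact le_iInf₂ fun ℓ h => ENNReal.ofReal_le_ofReal (key h)

end Hat

/-! ### Distances in the realisation -/

section Distances

variable {Y : GraphOfGraphs.{u}}

theorem Near.edist_le {x y : Y.Realization} {ℓ : ℝ} (h : Near x y ℓ) :
    edist x y ≤ ENNReal.ofReal ℓ := by
  have h' : Chain x y (ℓ + 0) := .cons h (.nil y)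
  rw [add_zero] at h'
  exact iInf₂_le (f := fun (ℓ : ℝ) (_ : Chain x y ℓ) => ENNReal.ofReal ℓ) ℓ h'

theorem continuous_vedge (d : Y.vert.Dart) :
    Continuous fun s : unitInterval => (ofCell (.vedge d s) : Y.Realization) := by
  refine LipschitzWith.continuous (K := 1) fun s s' => ?_
  rw [ENNReal.coe_one, one_mul, edist_dist, Subtype.dist_eq, Real.dist_eq]
  exact (Near.vedge d s s').edist_le

theorem continuous_hedge (h : Y.H) :
    Continuous fun t : unitInterval => (ofCell (.hedge h t) : Y.Realization) := by
  refine LipschitzWith.continuous (K := 1) fun s s' => ?_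
  rw [ENNReal.coe_one, one_mul, edist_dist, Subtype.dist_eq, Real.dist_eq]
  exact (Near.hedge h s s').edist_le

theorem continuous_square (d : Y.strip.Dart) (s : unitInterval) :
    Continuous fun t : unitInterval => (ofCell (.square d s t) : Y.Realization) := by
  refine LipschitzWith.continuous (K := 1) fun t t' => ?_
  rw [ENNReal.coe_one, one_mul, edist_dist, Subtype.dist_eq, Real.dist_eq]
  have h := (Near.square d s t s t').edist_le
  rwa [sub_self, zero_pow two_ne_zero, zero_add, Real.sqrt_sq_eq_abs] at h

theorem ofCell_vedge_zero (d : Y.vert.Dart) :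
    (ofCell (.vedge d 0) : Y.Realization) = ofCell (.vertex d.fst) :=
  Quot.sound (.vedge_start d)

theorem ofCell_vedge_symm (d : Y.vert.Dart) (s : unitInterval) :
    (ofCell (.vedge d s) : Y.Realization) = ofCell (.vedge d.symm (unitInterval.symm s)) :=
  Quot.sound (.vedge_symm d s)

theorem ofCell_vedge_one (d : Y.vert.Dart) :
    (ofCell (.vedge d 1) : Y.Realization) = ofCell (.vertex d.snd) := by
  rw [ofCell_vedge_symm, unitInterval.symm_one, ofCell_vedge_zero]
  rfl

theorem ofCell_hedge_end (h : Y.H) (σ : Bool) :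
    (ofCell (.hedge h (sideEnd σ)) : Y.Realization) = ofCell (.vertex (Y.bd σ h)) :=
  Quot.sound (.hedge_end h σ)

theorem ofCell_square_zero (d : Y.strip.Dart) (t : unitInterval) :
    (ofCell (.square d 0 t) : Y.Realization) = ofCell (.hedge d.fst t) :=
  Quot.sound (.square_start d t)

theorem ofCell_square_side (d : Y.strip.Dart) (s : unitInterval) (σ : Bool) :
    (ofCell (.square d s (sideEnd σ)) : Y.Realization) =
      ofCell (.vedge ((Y.bd σ).mapDart d) s) :=
  Quot.sound (.square_side d s σ)

theorem exists_ofCell (x : Y.Realization) : ∃ c, ofCell c = x := Quot.exists_rep x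

theorem edist_vertex_step {a b : Y.V} (s : Y.Step a b) :
    edist (ofCell (.vertex a) : Y.Realization) (ofCell (.vertex b)) ≤ 1 := by
  cases s with
  | vertical hab =>
    have h := (Near.vedge (⟨(a, b), hab⟩ : Y.vert.Dart) 0 1).edist_le
    rw [ofCell_vedge_zero, ofCell_vedge_one] at h
    simpa using h
  | horizontal σ h ha hb =>
    subst ha hb
    have h := (Near.hedge h (sideEnd σ) (sideEnd !σ)).edist_le
    rw [ofCell_hedge_end, ofCell_hedge_end] at h
    cases σ <;> simpa [sideEnd] using h

theorem edist_ofCell_vertex_lt_top (x : Y.CellPoint) :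
    ∃ a, edist (ofCell x : Y.Realization) (ofCell (.vertex a)) < ⊤ := by
  cases x with
  | vertex a => exact ⟨a, by simp⟩
  | vedge d s =>
    refine ⟨d.fst, ?_⟩
    rw [← ofCell_vedge_zero]
    exact (Near.vedge d s 0).edist_le.trans_lt ENNReal.ofReal_lt_top
  | hedge h t =>
    refine ⟨Y.bd true h, ?_⟩
    rw [← ofCell_hedge_end]
    exact (Near.hedge h t _).edist_le.trans_lt ENNReal.ofReal_lt_top
  | square d s t =>
    refine ⟨Y.bd true d.fst, ?_⟩
    rw [← ofCell_hedge_end, ← ofCell_square_zero]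
    exact (Near.square d s t _ _).edist_le.trans_lt ENNReal.ofReal_lt_top

theorem edist_lt_top (hY : Y.IsConnected) (x y : Y.Realization) : edist x y < ⊤ := by
  have key : ∀ a b : Y.V, Y.EdgePath a b →
      edist (ofCell (.vertex a) : Y.Realization) (ofCell (.vertex b)) < ⊤ := by
    intro a b q
    induction q with
    | nil a => simp
    | cons s q ih =>
      exact (edist_triangle _ _ _).trans_lt
        (ENNReal.add_lt_top.2 ⟨(edist_vertex_step s).trans_lt ENNReal.one_lt_top, ih⟩)
  obtain ⟨x, rfl⟩ := exists_ofCell x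
  obtain ⟨y, rfl⟩ := exists_ofCell y
  obtain ⟨a, ha⟩ := edist_ofCell_vertex_lt_top x
  obtain ⟨b, hb⟩ := edist_ofCell_vertex_lt_top y
  obtain ⟨q⟩ := hY.2 a b
  refine (edist_triangle _ (ofCell (.vertex a)) _).trans_lt (ENNReal.add_lt_top.2 ⟨ha, ?_⟩)
  refine (edist_triangle _ (ofCell (.vertex b)) _).trans_lt
    (ENNReal.add_lt_top.2 ⟨key a b q, ?_⟩)
  rw [edist_comm]
  exact hb

/-- Combinatorial maps do not increase distances. -/
theorem Hom.edist_map_le {Z : GraphOfGraphs.{v}} (f : Hom Y Z) (x y : Y.Realization) :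
    edist (f.map x) (f.map y) ≤ edist x y := by
  have key : ∀ {x y : Y.Realization} {ℓ : ℝ}, Chain x y ℓ → Chain (f.map x) (f.map y) ℓ := by
    intro x y ℓ h
    induction h with
    | nil x => exact .nil _
    | cons h _ ih =>
      refine .cons ?_ ih
      cases h with
      | vedge d s s' => exact .vedge _ s s'
      | hedge h t t' => exact .hedge _ t t'
      | square d s t s' t' => exact .square _ s t s' t'
  exact le_iInf₂ fun ℓ h => iInf₂_le (f := fun (ℓ : ℝ) (_ : Chain (f.map x) (f.map y) ℓ) =>
    ENNReal.ofReal ℓ) ℓ (key h)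

end Distances

/-! ### Vertical paths are lines -/

section VerticalLines

variable {Y : GraphOfGraphs.{u}} (γ : Y.VerticalPath)

/-- The `i`-th edge of a vertical path. -/
def VerticalPath.dart (i : ℤ) : Y.vert.Dart := ⟨(γ.toFun i, γ.toFun (i + 1)), γ.adj i⟩

/-- The parametrisation of a vertical path by arc length. -/
noncomputable def VerticalPath.curve (t : ℝ) : Y.Realization :=
  ofCell (.vedge (γ.dart ⌊t⌋) ⟨Int.fract t, Int.fract_nonneg t, (Int.fract_lt_one t).le⟩)

theorem VerticalPath.curve_add (i : ℤ) (s : unitInterval) :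
    γ.curve (i + s) = ofCell (.vedge (γ.dart i) s) := by
  rcases s.2.2.lt_or_eq with hs | hs
  · have e : ⌊(i : ℝ) + s⌋ = i := by
      rw [Int.floor_eq_iff]
      exact ⟨by linarith [s.2.1], by linarith⟩
    rw [curve]
    congr 2
    · rw [e]
    · refine Subtype.ext ?_
      change Int.fract ((i : ℝ) + s) = s
      rw [Int.fract, e]
      ring
  · obtain rfl : s = 1 := Subtype.ext hs
    rw [ofCell_vedge_one, curve]
    have e : ⌊(i : ℝ) + (1 : unitInterval)⌋ = i + 1 := by
      rw [Int.floor_eq_iff]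
      simp
    have e' : (⟨Int.fract ((i : ℝ) + (1 : unitInterval)), Int.fract_nonneg _,
        (Int.fract_lt_one _).le⟩ : unitInterval) = 0 := by
      refine Subtype.ext ?_
      change Int.fract ((i : ℝ) + (1 : unitInterval)) = 0
      rw [Int.fract, e]
      simp
    rw [e', e, ofCell_vedge_zero]
    rfl

theorem VerticalPath.range_curve : Set.range γ.curve = γ.carrier := by
  ext x
  constructor
  · rintro ⟨t, rfl⟩
    exact ⟨_, _, rfl⟩
  · rintro ⟨i, s, rfl⟩
    exact ⟨i + s, γ.curve_add i s⟩

theorem VerticalPath.edist_curve_le {s t : ℝ} (hst : s ≤ t) :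
    edist (γ.curve s) (γ.curve t) ≤ ENNReal.ofReal (t - s) := by
  have one : ∀ s t : ℝ, s ≤ t → t ≤ ⌊s⌋ + 1 →
      edist (γ.curve s) (γ.curve t) ≤ ENNReal.ofReal (t - s) := by
    intro s t hst ht
    have hs := Int.floor_le s
    have e1 := γ.curve_add ⌊s⌋ ⟨s - ⌊s⌋, by linarith, by linarith⟩
    have e2 := γ.curve_add ⌊s⌋ ⟨t - ⌊s⌋, by linarith, by linarith⟩
    simp only [add_sub_cancel] at e1 e2
    rw [e1, e2]
    refine (Near.vedge _ _ _).edist_le.trans (ENNReal.ofReal_le_ofReal ?_)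
    rw [abs_sub_comm]
    refine le_of_eq ?_
    rw [show t - ⌊s⌋ - (s - ⌊s⌋) = t - s by ring, abs_of_nonneg (by linarith)]
  have key : ∀ (k : ℕ) (s t : ℝ), s ≤ t → t ≤ ⌊s⌋ + 1 + k →
      edist (γ.curve s) (γ.curve t) ≤ ENNReal.ofReal (t - s) := by
    intro k
    induction k with
    | zero => exact fun s t hst ht => one s t hst (by simpa using ht)
    | succ k ih =>
      intro s t hst ht
      rcases le_total t (⌊s⌋ + 1) with h | h
      · exact one s t hst h
      · have hs := Int.lt_floor_add_one s
        have e : ((⌊(⌊s⌋ + 1 : ℝ)⌋ : ℤ) : ℝ) = ⌊s⌋ + 1 := by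
          rw [Int.floor_add_one, Int.floor_intCast]
          push_cast
          rfl
        refine (edist_triangle _ (γ.curve (⌊s⌋ + 1)) _).trans ?_
        refine (add_le_add (one s _ hs.le le_rfl) (ih _ t h ?_)).trans (le_of_eq ?_)
        · rw [e]
          push_cast at ht
          linarith
        · rw [← ENNReal.ofReal_add (by linarith) (by linarith)]
          congr 1
          ring
  refine key ⌈t - s⌉₊ s t hst ?_
  have h1 := Nat.le_ceil (t - s)
  have h2 := Int.lt_floor_add_one s
  linarith

/-- The immersed vertical paths of a simply connected complex are geodesics: the distance in the
tree obtained by collapsing the horizontal edges gives a `1`-Lipschitz function that grows with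
slope one along the path. -/
theorem VerticalPath.isometry_curve (hI : Y.IsImmersed) (hY : Y.IsSimplyConnected) :
    Isometry γ.curve := by
  have key : ∀ s t : ℝ, s ≤ t → edist (γ.curve s) (γ.curve t) = ENNReal.ofReal (t - s) := by
    intro s t hst
    refine le_antisymm (γ.edist_curve_le hst) ?_
    let f : Y.V → ℝ := fun a => treeDist hI hY (γ.toFun ⌊s⌋) a
    have hf : LipschitzWith 1 (hat f) := by
      refine lipschitzWith_hat (A := 1) (B := 0) (by norm_num) zero_le_one le_rfl ?_ ?_
      · intro a b hab
        rcases treeDist_vert hI hY (γ.toFun ⌊s⌋) hab with h | h <;> simp [f, h]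
      · intro h
        simp [f, treeDist_hor hI hY _ true false h]
    have hval : ∀ r : ℝ, s ≤ r → hat f (γ.curve r) = r - ⌊s⌋ := by
      intro r hr
      have hle : ⌊s⌋ ≤ ⌊r⌋ := Int.floor_mono hr
      have e1 : f (γ.toFun ⌊r⌋) = ⌊r⌋ - ⌊s⌋ := by
        have := treeDist_verticalPath hI hY γ hle
        simp only [f]
        exact_mod_cast this
      have e2 : f (γ.toFun (⌊r⌋ + 1)) = ⌊r⌋ + 1 - ⌊s⌋ := by
        have := treeDist_verticalPath hI hY γ (show ⌊s⌋ ≤ ⌊r⌋ + 1 by omega)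
        simp only [f]
        exact_mod_cast this
      rw [curve, hat_ofCell]
      change interp (Int.fract r) (f (γ.toFun ⌊r⌋)) (f (γ.toFun (⌊r⌋ + 1))) = _
      rw [e1, e2, interp, Int.fract]
      ring
    have h := hf (γ.curve s) (γ.curve t)
    rw [ENNReal.coe_one, one_mul, edist_dist, Real.dist_eq, hval s le_rfl, hval t hst,
      abs_sub_comm, show t - ⌊s⌋ - (s - ⌊s⌋) = t - s by ring, abs_of_nonneg (by linarith)] at h
    exact h
  intro s t
  rw [edist_dist s t, Real.dist_eq]
  rcases le_total s t with h | h
  · rw [key s t h, abs_sub_comm, abs_of_nonneg (by linarith)]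
  · rw [edist_comm, key t s h, abs_of_nonneg (by linarith)]

theorem VerticalPath.isVerticalLine (hI : Y.IsImmersed) (hY : Y.IsSimplyConnected) :
    IsVerticalLine γ.carrier :=
  ⟨⟨γ.curve, γ.isometry_curve hI hY, γ.range_curve⟩, γ, rfl⟩

variable {X : GraphOfGraphs.{v}} {p : Hom Y X}

/-- A vertical path is an axis of every deck transformation that acts on it as a translation. -/
theorem VerticalPath.isPeriodicLine (hI : Y.IsImmersed) (hY : Y.IsSimplyConnected) (g : Deck p)
    {n : ℕ} (hn : 0 < n) (hg : ∀ i, g.onV (γ.toFun i) = γ.toFun (i + n)) :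
    IsPeriodicLine p γ.carrier := by
  have hiso := γ.isometry_curve hI hY
  have hmap : ∀ t, g.toHom.map (γ.curve t) = γ.curve (t + n) := by
    intro t
    have e := γ.curve_add (⌊t⌋ + n) ⟨Int.fract t, Int.fract_nonneg t, (Int.fract_lt_one t).le⟩
    have e' : ((⌊t⌋ + n : ℤ) : ℝ) + Int.fract t = t + n := by
      push_cast
      rw [Int.fract]
      ring
    change γ.curve (((⌊t⌋ + n : ℤ) : ℝ) + Int.fract t) = _ at e
    rw [e'] at e
    rw [e]
    change ofCell (.vedge (g.onV.toHom.mapDart (γ.dart ⌊t⌋)) _) = _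
    congr 2
    refine SimpleGraph.Dart.ext _ _ (Prod.ext (hg _) ((hg _).trans ?_))
    change γ.toFun _ = γ.toFun _
    congr 1
    ring
  refine ⟨g, ⟨γ.toFun 0, fun e => ?_⟩, (γ.isVerticalLine hI hY).1, ?_, γ.curve 0, ?_, ?_⟩
  · have := VerticalPath.injective hI hY γ ((hg 0).symm.trans e)
    omega
  · rintro _ ⟨x, hx, rfl⟩
    rw [← range_curve] at hx ⊢
    obtain ⟨t, rfl⟩ := hx
    exact ⟨_, (hmap t).symm⟩
  · rw [← range_curve]
    exact ⟨0, rfl⟩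
  · refine le_antisymm (le_iInf fun y => ?_) (iInf_le _ _)
    have h0 : edist (γ.curve 0) (g.toHom.map (γ.curve 0)) = ENNReal.ofReal n := by
      rw [hmap, hiso.edist_eq, edist_dist, Real.dist_eq]
      simp
    rw [h0]
    -- Otherwise the displacements of the powers of `g` at `y` would grow too slowly.
    set G := g.toHom.map with hG
    have hlip : ∀ x z, edist (G x) (G z) ≤ edist x z := g.toHom.edist_map_le
    have hlipk : ∀ (k : ℕ) (x z), edist (G^[k] x) (G^[k] z) ≤ edist x z := by
      intro k
      induction k with
      | zero => exact fun _ _ => le_rfl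
      | succ k ih => exact fun x z => (ih _ _).trans (hlip x z)
    have hy : ∀ k : ℕ, edist y (G^[k] y) ≤ k * edist y (G y) := by
      intro k
      induction k with
      | zero => simp
      | succ k ih =>
        rw [Function.iterate_succ_apply]
        refine (edist_triangle _ (G^[k] y) _).trans ?_
        push_cast
        rw [add_mul, one_mul]
        exact add_le_add ih (hlipk k _ _)
    have hx : ∀ k : ℕ, G^[k] (γ.curve 0) = γ.curve (k * n) := by
      intro k
      induction k with
      | zero => simp
      | succ k ih =>
        rw [Function.iterate_succ_apply', ih, hmap]
        congr 1
        push_cast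
        ring
    have hd : edist (γ.curve 0) y ≠ ⊤ := (edist_lt_top hY.1 _ _).ne
    have hD : edist y (G y) ≠ ⊤ := (edist_lt_top hY.1 _ _).ne
    have main : ∀ k : ℕ, (k : ℝ) * n ≤
        2 * (edist (γ.curve 0) y).toReal + k * (edist y (G y)).toReal := by
      intro k
      have h1 : ENNReal.ofReal (k * n) = edist (γ.curve 0) (G^[k] (γ.curve 0)) := by
        rw [hx, hiso.edist_eq, edist_dist, Real.dist_eq, zero_sub, abs_neg,
          abs_of_nonneg (by positivity)]
      have h2 : edist (γ.curve 0) (G^[k] (γ.curve 0)) ≤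
          edist (γ.curve 0) y + k * edist y (G y) + edist (γ.curve 0) y := by
        refine (edist_triangle _ (G^[k] y) _).trans (add_le_add ?_ ?_)
        · exact (edist_triangle _ y _).trans (add_le_add le_rfl (hy k))
        · rw [edist_comm (γ.curve 0)]
          exact hlipk k _ _
      rw [← h1] at h2
      have hk : (k : ℝ≥0∞) * edist y (G y) ≠ ⊤ := ENNReal.mul_ne_top (by simp) hD
      have h3 := ENNReal.toReal_mono (by simp [hd, hk]) h2
      rw [ENNReal.toReal_ofReal (by positivity), ENNReal.toReal_add (by simp [hd, hk]) hd,
        ENNReal.toReal_add hd hk, ENNReal.toReal_mul, ENNReal.toReal_natCast] at h3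
      linarith
    rw [← ENNReal.ofReal_toReal hD]
    refine ENNReal.ofReal_le_ofReal ?_
    by_contra hlt
    push Not at hlt
    obtain ⟨k, hk⟩ := exists_nat_gt
      (2 * (edist (γ.curve 0) y).toReal / (n - (edist y (G y)).toReal))
    rw [div_lt_iff₀ (by linarith)] at hk
    have := main k
    linarith

end VerticalLines

/-! ### Lifting to a covering -/

section Coverings

variable {X : GraphOfGraphs.{u}} {Y : GraphOfGraphs.{v}} {p : Hom Y X}

namespace Hom.IsCovering

variable (hp : p.IsCovering)
include hp

theorem vert_unique {a b b' : Y.V} (h : Y.vert.Adj a b) (h' : Y.vert.Adj a b')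
    (e : p.onV b = p.onV b') : b = b' :=
  (hp.vertical a).injOn h h' e

theorem exists_vert {a : Y.V} {b : X.V} (h : X.vert.Adj (p.onV a) b) :
    ∃ b', Y.vert.Adj a b' ∧ p.onV b' = b :=
  (hp.vertical a).surjOn h

theorem hor_unique {σ : Bool} {h h' : Y.H} (e : Y.bd σ h = Y.bd σ h')
    (e' : p.onH h = p.onH h') : h = h' :=
  (hp.horizontal σ (Y.bd σ h')).injOn e rfl e'

theorem exists_hor {σ : Bool} {a : Y.V} {h : X.H} (e : X.bd σ h = p.onV a) :
    ∃ h', Y.bd σ h' = a ∧ p.onH h' = h :=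
  (hp.horizontal σ a).surjOn e

theorem exists_strip {h : Y.H} {k : X.H} (e : X.strip.Adj (p.onH h) k) :
    ∃ k', Y.strip.Adj h k' ∧ p.onH k' = k :=
  (hp.square h).surjOn e

theorem isImmersed (hX : X.IsImmersed) : Y.IsImmersed := by
  intro σ h k hk k' hk' e
  refine (hp.square h).injOn hk hk' (hX σ (p.onH h) ?_ ?_ ?_)
  · exact p.onH.map_adj hk
  · exact p.onH.map_adj hk'
  · rw [← p.comm, ← p.comm, e]

end Hom.IsCovering

/-- The points with the same image as `a`. -/
abbrev Fibre (p : Hom Y X) (a : Y.V) : Type v := {a' : Y.V // p.onV a' = p.onV a}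

theorem exists_fibre_vert (hp : p.IsCovering) {a b : Y.V} (hab : Y.vert.Adj a b)
    (x : Fibre p a) : ∃ y : Fibre p b, Y.vert.Adj x.1 y.1 := by
  obtain ⟨y, hy, e⟩ := hp.exists_vert (a := x.1) (b := p.onV b)
    (by rw [x.2]; exact p.onV.map_adj hab)
  exact ⟨⟨y, e⟩, hy⟩

theorem exists_fibre_hor (hp : p.IsCovering) {a b : Y.V} {σ : Bool} {h : Y.H}
    (ha : Y.bd σ h = a) (hb : Y.bd (!σ) h = b) (x : Fibre p a) :
    ∃ y : Fibre p b, ∃ k, p.onH k = p.onH h ∧ Y.bd σ k = x.1 ∧ Y.bd (!σ) k = y.1 := by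
  obtain ⟨k, hk, e⟩ := hp.exists_hor (σ := σ) (a := x.1) (h := p.onH h)
    (by rw [x.2, ← ha, p.comm])
  exact ⟨⟨Y.bd (!σ) k, by rw [p.comm, e, ← p.comm, hb]⟩, k, e, hk, rfl⟩

/-- The end of the lift of an oriented edge that starts at a given point. -/
noncomputable def fibreStep (hp : p.IsCovering) : {a b : Y.V} → Y.Step a b → Fibre p a → Fibre p b
  | _, _, .vertical hab, x => (exists_fibre_vert hp hab x).choose
  | _, _, .horizontal _ _ ha hb, x => (exists_fibre_hor hp ha hb x).choose

theorem fibreStep_vert (hp : p.IsCovering) {a b : Y.V} (hab : Y.vert.Adj a b) (x : Fibre p a)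
    (y : Fibre p b) (h : Y.vert.Adj x.1 y.1) : fibreStep hp (.vertical hab) x = y :=
  Subtype.ext (hp.vert_unique (exists_fibre_vert hp hab x).choose_spec h
    ((exists_fibre_vert hp hab x).choose.2.trans y.2.symm))

theorem fibreStep_hor (hp : p.IsCovering) {a b : Y.V} {σ : Bool} {h : Y.H}
    (ha : Y.bd σ h = a) (hb : Y.bd (!σ) h = b) (x : Fibre p a) (y : Fibre p b) (k : Y.H)
    (hk : p.onH k = p.onH h) (h1 : Y.bd σ k = x.1) (h2 : Y.bd (!σ) k = y.1) :
    fibreStep hp (.horizontal σ h ha hb) x = y := by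
  obtain ⟨k', e1, e2, e3⟩ := (exists_fibre_hor hp ha hb x).choose_spec
  obtain rfl : k' = k := hp.hor_unique (e2.trans h1.symm) (e1.trans hk.symm)
  exact Subtype.ext (e3.symm.trans h2)

/-- The lifting of paths, as an action of the edge paths of `Y` on the fibres of the covering. -/
noncomputable def fibres (hp : p.IsCovering) : Y.Transport (Fibre p) where
  map := fibreStep hp
  backtrack {a b} s x := by
    cases s with
    | vertical hab =>
      exact fibreStep_vert hp hab.symm _ _ (exists_fibre_vert hp hab x).choose_spec.symm
    | horizontal σ h ha hb =>
      obtain ⟨k, e1, e2, e3⟩ := (exists_fibre_hor hp ha hb x).choose_spec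
      exact fibreStep_hor hp _ _ _ _ k e1 e3 (by rw [Bool.not_not]; exact e2)
  square σ h h' hh x := by
    obtain ⟨k, hk, e⟩ := hp.exists_hor (σ := σ) (a := x.1) (h := p.onH h)
      (by rw [x.2, p.comm])
    obtain ⟨k', hk', e'⟩ := hp.exists_strip (h := k) (k := p.onH h')
      (by rw [e]; exact p.onH.map_adj hh)
    have proj : ∀ τ, p.onV (Y.bd τ k') = p.onV (Y.bd τ h') := fun τ => by
      rw [p.comm, e', ← p.comm]
    have proj' : ∀ τ, p.onV (Y.bd τ k) = p.onV (Y.bd τ h) := fun τ => by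
      rw [p.comm, e, ← p.comm]
    rw [fibreStep_hor hp rfl rfl x ⟨Y.bd (!σ) k, proj' _⟩ k e hk rfl,
      fibreStep_vert hp _ _ ⟨Y.bd (!σ) k', proj _⟩ ((Y.bd (!σ)).map_adj hk'),
      fibreStep_vert hp _ x ⟨Y.bd σ k', proj _⟩ (by rw [← hk]; exact (Y.bd σ).map_adj hk'),
      fibreStep_hor hp rfl rfl _ ⟨Y.bd (!σ) k', proj _⟩ k' e' rfl rfl]

/-- A map on the vertices that is compatible with the covering and extends to the edges. -/
structure IsDeckMap (p : Hom Y X) (φ : Y.V → Y.V) : Prop where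
  proj : ∀ a, p.onV (φ a) = p.onV a
  vert : ∀ a b, Y.vert.Adj a b → Y.vert.Adj (φ a) (φ b)
  hor : ∀ σ h, ∃ k, p.onH k = p.onH h ∧ Y.bd σ k = φ (Y.bd σ h) ∧ Y.bd (!σ) k = φ (Y.bd (!σ) h)

theorem IsDeckMap.comp {φ ψ : Y.V → Y.V} (hφ : IsDeckMap p φ) (hψ : IsDeckMap p ψ) :
    IsDeckMap p (φ ∘ ψ) where
  proj a := (hφ.proj _).trans (hψ.proj a)
  vert a b h := hφ.vert _ _ (hψ.vert a b h)
  hor σ h := by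
    obtain ⟨k, e1, e2, e3⟩ := hψ.hor σ h
    obtain ⟨l, f1, f2, f3⟩ := hφ.hor σ k
    exact ⟨l, f1.trans e1, by rw [f2, e2]; rfl, by rw [f3, e3]; rfl⟩

theorem isDeckMap_id : IsDeckMap p id where
  proj _ := rfl
  vert _ _ h := h
  hor _ h := ⟨h, rfl, rfl, rfl⟩

/-- A deck map is determined by the image of one vertex. -/
theorem IsDeckMap.eq_of_eq (hp : p.IsUniversalCover) {φ ψ : Y.V → Y.V} (hφ : IsDeckMap p φ)
    (hψ : IsDeckMap p ψ) {o : Y.V} (h : φ o = ψ o) : φ = ψ := by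
  have step : ∀ {φ : Y.V → Y.V} (hφ : IsDeckMap p φ) {a b : Y.V} (q : Y.EdgePath a b),
      (fibres hp.1).along q ⟨φ a, hφ.proj a⟩ = ⟨φ b, hφ.proj b⟩ := by
    intro φ hφ a b q
    induction q with
    | nil => rfl
    | cons s q ih =>
      rw [← ih, Transport.along]
      congr 1
      cases s with
      | vertical hab => exact fibreStep_vert hp.1 hab _ _ (hφ.vert _ _ hab)
      | horizontal σ h ha hb =>
        obtain ⟨k, e1, e2, e3⟩ := hφ.hor σ h
        exact fibreStep_hor hp.1 ha hb _ _ k e1 (e2.trans (congrArg φ ha))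
          (e3.trans (congrArg φ hb))
  funext a
  obtain ⟨q⟩ := hp.2.1.2 o a
  have h1 := step hφ q
  have h2 := step hψ q
  have e : (⟨φ o, hφ.proj o⟩ : Fibre p o) = ⟨ψ o, hψ.proj o⟩ := Subtype.ext h
  rw [e, h2] at h1
  exact (congrArg Subtype.val h1).symm

theorem exists_isDeckMap (hp : p.IsUniversalCover) {o o' : Y.V} (h : p.onV o' = p.onV o) :
    ∃ φ, IsDeckMap p φ ∧ φ o = o' := by
  let T := fibres hp.1
  let x : Fibre p o := ⟨o', h⟩
  refine ⟨fun a => (T.carry hp.2 x : Fibre p a).1, ⟨fun a => ?_, fun a b hab => ?_,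
    fun σ h => ?_⟩, ?_⟩
  · exact (T.carry hp.2 x : Fibre p a).2
  · rw [T.carry_step hp.2 x (.vertical hab)]
    exact (exists_fibre_vert hp.1 hab _).choose_spec
  · rw [T.carry_step hp.2 x (.horizontal σ h rfl rfl)]
    exact (exists_fibre_hor hp.1 rfl rfl _).choose_spec
  · exact congrArg Subtype.val (T.carry_self hp.2 x)

theorem IsDeckMap.exists_onH (hp : p.IsCovering) {φ : Y.V → Y.V} (hφ : IsDeckMap p φ) :
    ∃ η : Y.H → Y.H, (∀ h, p.onH (η h) = p.onH h) ∧ (∀ σ h, Y.bd σ (η h) = φ (Y.bd σ h)) ∧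
      ∀ h h', Y.strip.Adj h h' → Y.strip.Adj (η h) (η h') := by
  choose η h1 h2 h3 using hφ.hor false
  have h4 : ∀ σ h, Y.bd σ (η h) = φ (Y.bd σ h) := fun σ h => by
    cases σ
    · exact h2 h
    · exact h3 h
  refine ⟨η, h1, h4, fun h h' hh => ?_⟩
  obtain ⟨k, hk, e⟩ := hp.exists_strip (h := η h) (k := p.onH h')
    (by rw [h1]; exact p.onH.map_adj hh)
  have e1 : Y.bd false k = φ (Y.bd false h') := by
    refine hp.vert_unique (a := φ (Y.bd false h)) ?_ (hφ.vert _ _ ((Y.bd false).map_adj hh)) ?_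
    · rw [← h4]
      exact (Y.bd false).map_adj hk
    · rw [hφ.proj, p.comm, p.comm, e]
  obtain rfl : k = η h' := hp.hor_unique (e1.trans (h4 false h').symm) (e.trans (h1 h').symm)
  exact hk

/-- The deck transformations of the universal covering act transitively on its fibres. -/
theorem exists_deck (hp : p.IsUniversalCover) {o o' : Y.V} (h : p.onV o' = p.onV o) :
    ∃ g : Deck p, g.onV o = o' := by
  obtain ⟨φ, hφ, e⟩ := exists_isDeckMap hp h
  obtain ⟨ψ, hψ, e'⟩ := exists_isDeckMap hp h.symm
  obtain ⟨η, η1, η2, η3⟩ := hφ.exists_onH hp.1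
  obtain ⟨θ, θ1, θ2, θ3⟩ := hψ.exists_onH hp.1
  have l : ∀ a, ψ (φ a) = a := congrFun ((hψ.comp hφ).eq_of_eq hp isDeckMap_id (o := o)
    (by simp [e, e']))
  have r : ∀ a, φ (ψ a) = a := congrFun ((hφ.comp hψ).eq_of_eq hp isDeckMap_id (o := o')
    (by simp [e, e']))
  have l' : ∀ h, θ (η h) = h := fun h =>
    hp.1.hor_unique (σ := false) (by rw [θ2, η2, l]) (by rw [θ1, η1])
  have r' : ∀ h, η (θ h) = h := fun h =>
    hp.1.hor_unique (σ := false) (by rw [η2, θ2, r]) (by rw [η1, θ1])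
  refine ⟨⟨⟨⟨φ, ψ, l, r⟩, ?_⟩, ⟨⟨η, θ, l', r'⟩, ?_⟩, fun σ h => (η2 σ h).symm, hφ.proj, η1⟩, e⟩
  · intro a b
    refine ⟨fun hab => ?_, hφ.vert a b⟩
    have := hψ.vert _ _ hab
    simpa [l] using this
  · intro a b
    refine ⟨fun hab => ?_, η3 a b⟩
    have := θ3 _ _ hab
    simpa [l'] using this

/-- Bi-infinite vertical paths lift. -/
theorem exists_lift_path (hp : p.IsCovering) {c : ℤ → X.V}
    (hadj : ∀ i, X.vert.Adj (c i) (c (i + 1))) (himm : ∀ i, c i ≠ c (i + 2)) {v : Y.V}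
    (hv : p.onV v = c 0) :
    ∃ γ : Y.VerticalPath, γ.toFun 0 = v ∧ ∀ i, p.onV (γ.toFun i) = c i := by
  have up : ∀ (i : ℤ) (a : {a // p.onV a = c i}), ∃ b : {b // p.onV b = c (i + 1)},
      Y.vert.Adj a.1 b.1 := fun i a => by
    obtain ⟨b, hb, e⟩ := hp.exists_vert (a := a.1) (b := c (i + 1)) (by rw [a.2]; exact hadj i)
    exact ⟨⟨b, e⟩, hb⟩
  have down : ∀ (i : ℤ) (a : {a // p.onV a = c (i + 1)}), ∃ b : {b // p.onV b = c i},
      Y.vert.Adj b.1 a.1 := fun i a => by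
    obtain ⟨b, hb, e⟩ := hp.exists_vert (a := a.1) (b := c i) (by rw [a.2]; exact (hadj i).symm)
    exact ⟨⟨b, e⟩, hb.symm⟩
  choose U hU using up
  choose D hD using down
  let f : ∀ n : ℕ, {a // p.onV a = c n} := fun n =>
    Nat.rec (motive := fun n => {a // p.onV a = c n}) ⟨v, by simpa using hv⟩
      (fun n a => ⟨(U n a).1, (U n a).2.trans (by push_cast; rfl)⟩) n
  let b : ∀ n : ℕ, {a // p.onV a = c (-n)} := fun n =>
    Nat.rec (motive := fun n => {a // p.onV a = c (-n)}) ⟨v, by simpa using hv⟩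
      (fun n a => ⟨(D (-(n + 1 : ℕ)) ⟨a.1, a.2.trans (by congr 1; push_cast; ring)⟩).1,
        (D (-(n + 1 : ℕ)) ⟨a.1, a.2.trans (by congr 1; push_cast; ring)⟩).2⟩) n
  have hf : ∀ n : ℕ, Y.vert.Adj (f n).1 (f (n + 1)).1 := fun n => hU n (f n)
  have hb : ∀ n : ℕ, Y.vert.Adj (b (n + 1)).1 (b n).1 := fun n => hD (-(n + 1 : ℕ)) ⟨(b n).1, _⟩
  let γ : ℤ → Y.V := fun i => if 0 ≤ i then (f i.toNat).1 else (b (-i).toNat).1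
  have hγ : ∀ i, p.onV (γ i) = c i := by
    intro i
    simp only [γ]
    split_ifs with h
    · rw [(f i.toNat).2, Int.toNat_of_nonneg h]
    · rw [(b (-i).toNat).2, Int.toNat_of_nonneg (by omega), neg_neg]
  refine ⟨⟨γ, fun i => ?_, fun i e => himm i ?_⟩, rfl, hγ⟩
  · simp only [γ]
    rcases lt_trichotomy i (-1) with h | rfl | h
    · rw [if_neg (by omega), if_neg (by omega)]
      have := hb (-(i + 1)).toNat
      rwa [show (-(i + 1)).toNat + 1 = (-i).toNat by omega] at this
    · exact hb 0
    · rw [if_pos (by omega), if_pos (by omega)]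
      have := hf i.toNat
      rwa [show i.toNat + 1 = (i + 1).toNat by omega] at this
  · rw [← hγ, ← hγ, e]

/-- The lift of a periodic vertical path is an axis. -/
theorem VerticalPath.isPeriodicLine_of_periodic (hp : p.IsUniversalCover) (hI : Y.IsImmersed)
    (γ : Y.VerticalPath) {n : ℕ} (hn : 0 < n)
    (hper : ∀ i, p.onV (γ.toFun (i + n)) = p.onV (γ.toFun i)) : IsPeriodicLine p γ.carrier := by
  obtain ⟨g, hg⟩ := exists_deck hp (o := γ.toFun 0) (o' := γ.toFun (0 + n)) (hper 0)
  refine γ.isPeriodicLine hI hp.2 g hn fun i => ?_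
  induction i using Int.induction_on with
  | zero => exact hg
  | succ i ih =>
    refine hp.1.vert_unique (a := γ.toFun (i + n)) ?_ ?_ ?_
    · rw [← ih]
      exact g.onV.map_adj_iff.2 (γ.adj _)
    · rw [add_right_comm]
      exact γ.adj _
    · rw [g.over_V, hper]
  | pred i ih =>
    refine hp.1.vert_unique (a := γ.toFun (-i + n)) ?_ ?_ ?_
    · rw [← ih]
      refine g.onV.map_adj_iff.2 ?_
      have := γ.adj (-i - 1)
      rw [sub_add_cancel] at this
      exact this.symm
    · have := γ.adj (-i - 1 + n)
      rw [show -(i : ℤ) - 1 + n + 1 = -i + n by ring] at this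
      exact this.symm
    · rw [g.over_V, hper]

end Coverings

/-! ### Links of Brady-Meier complexes -/

section Links

variable {X : GraphOfGraphs.{u}}

theorem link_adj_inl_inr {a : X.V} {b : {b : X.V // X.vert.Adj a b}}
    {x : {x : Bool × X.H // X.bd x.1 x.2 = a}} (h : (X.link a).Adj (Sum.inl b) (Sum.inr x)) :
    ∃ h', X.strip.Adj x.1.2 h' ∧ X.bd x.1.1 h' = b.1 := by
  rw [link, SimpleGraph.fromRel_adj] at h
  rcases h.2 with ⟨b', x', e1, e2, h'⟩ | ⟨b', x', e1, e2, h'⟩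
  · cases e1
    cases e2
    exact h'
  · cases e1

theorem not_link_adj_inl_inl {a : X.V} {b b' : {b : X.V // X.vert.Adj a b}} :
    ¬ (X.link a).Adj (Sum.inl b) (Sum.inl b') := by
  intro h
  rw [link, SimpleGraph.fromRel_adj] at h
  rcases h.2 with ⟨_, _, e1, e2, _⟩ | ⟨_, _, e1, e2, _⟩ <;> cases e2

theorem not_link_adj_inr_inr {a : X.V} {x x' : {x : Bool × X.H // X.bd x.1 x.2 = a}} :
    ¬ (X.link a).Adj (Sum.inr x) (Sum.inr x') := by
  intro h
  rw [link, SimpleGraph.fromRel_adj] at h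
  rcases h.2 with ⟨_, _, e1, e2, _⟩ | ⟨_, _, e1, e2, _⟩ <;> cases e1

/-- Let `u` and `w` be vertical neighbours of `v`. A nonempty set of half-edges at `v`, other than
those towards `u` and `w`, that is saturated for the adjacency in the link away from `u` and `w`
contains a horizontal half-edge that is adjacent to `w`: the link of `v` without `u` is
connected. Here `PH` and `PV` are the horizontal and the vertical half-edges of the set. -/
theorem IsBradyMeier.exists_adjacent (hBM : X.IsBradyMeier) {v u w : X.V}
    (hu : X.vert.Adj v u) (hw : X.vert.Adj v w) (huw : u ≠ w) {PH : Bool → X.H → Prop}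
    {PV : X.V → Prop}
    (hP : ∀ σ h h', X.bd σ h = v → X.strip.Adj h h' → X.bd σ h' ≠ u → X.bd σ h' ≠ w →
      (PH σ h ↔ PV (X.bd σ h')))
    {σ : Bool} {h : X.H} (hv : X.bd σ h = v) (hh : PH σ h) :
    ∃ σ h h', X.bd σ h = v ∧ PH σ h ∧ X.strip.Adj h h' ∧ X.bd σ h' = w := by
  let P : X.HalfEdge v → Prop := Sum.elim (fun b => b.1 ≠ u ∧ b.1 ≠ w ∧ PV b.1)
    (fun x => PH x.1.1 x.1.2)
  let Γ := (X.link v).induce ({Sum.inl ⟨u, hu⟩}ᶜ : Set (X.HalfEdge v))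
  have key : ∀ y z : ({Sum.inl ⟨u, hu⟩}ᶜ : Set (X.HalfEdge v)), Γ.Walk y z → P y.1 →
      z.1 = Sum.inl ⟨w, hw⟩ →
      ∃ σ h h', X.bd σ h = v ∧ PH σ h ∧ X.strip.Adj h h' ∧ X.bd σ h' = w := by
    intro y z q
    induction q with
    | nil =>
      intro hy hz
      rw [hz] at hy
      exact absurd rfl hy.2.1
    | @cons y y' z hyy q ih =>
      intro hy hz
      have hadj : (X.link v).Adj y.1 y'.1 := hyy
      rcases hy1 : y.1 with b | x
      · rcases hy2 : y'.1 with b' | x'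
        · rw [hy1, hy2] at hadj
          exact absurd hadj not_link_adj_inl_inl
        · rw [hy1, hy2] at hadj
          obtain ⟨h', h1, h2⟩ := link_adj_inl_inr hadj
          refine ih ?_ hz
          rw [hy1] at hy
          rw [hy2]
          refine (hP _ _ h' x'.2 h1 ?_ ?_).2 ?_
          · rw [h2]; exact hy.1
          · rw [h2]; exact hy.2.1
          · rw [h2]; exact hy.2.2
      · rcases hy2 : y'.1 with b' | x'
        · rw [hy1, hy2] at hadj
          obtain ⟨h', h1, h2⟩ := link_adj_inl_inr hadj.symm
          rw [hy1] at hy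
          by_cases hbw : b'.1 = w
          · exact ⟨_, _, h', x.2, hy, h1, h2.trans hbw⟩
          · have hbu : b'.1 ≠ u := fun e => y'.2 (hy2.trans (congrArg _ (Subtype.ext e)))
            refine ih ?_ hz
            rw [hy2]
            refine ⟨hbu, hbw, ?_⟩
            rw [← h2]
            refine (hP _ _ h' x.2 h1 ?_ ?_).1 hy
            · rw [h2]; exact hbu
            · rw [h2]; exact hbw
        · rw [hy1, hy2] at hadj
          exact absurd hadj not_link_adj_inr_inr
  obtain ⟨q⟩ := ((hBM v).2.1 (Sum.inl ⟨u, hu⟩)).preconnected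
    ⟨Sum.inr ⟨(σ, h), hv⟩, fun e => by cases e⟩
    ⟨Sum.inl ⟨w, hw⟩, fun e => huw (congrArg Subtype.val (Sum.inl.inj e)).symm⟩
  exact key _ _ q hh rfl

/-- Every vertical edge at a vertex with two vertical edges is a side of a square. -/
theorem IsBradyMeier.exists_square (hBM : X.IsBradyMeier) {v b b' : X.V}
    (hb : X.vert.Adj v b) (hb' : X.vert.Adj v b') (hne : b ≠ b') :
    ∃ σ h h', X.bd σ h = v ∧ X.strip.Adj h h' ∧ X.bd σ h' = b := by
  obtain ⟨q⟩ := (hBM v).1.preconnected (Sum.inl ⟨b, hb⟩) (Sum.inl ⟨b', hb'⟩)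
  cases q with
  | nil => exact absurd rfl hne
  | @cons _ y _ h _ =>
    rcases y with b'' | x
    · exact absurd h not_link_adj_inl_inl
    · obtain ⟨h', h1, h2⟩ := link_adj_inl_inr h
      exact ⟨_, _, h', x.2, h1, h2⟩

end Links

/-! ### Labelled paths -/

/-- A bi-infinite immersed vertical path together with a nonconstant labelling of the half-edges
at its places that leave the path: `vl i b` is the label of the vertical edge towards `b` and
`hl i σ h` that of the `σ`-end of the horizontal edge `h`, at the place `i`. The label is the same
for half-edges that are adjacent in a link, and for the two horizontal sides of a square that
contains an edge of the path. In other words, it is a nonconstant function on the components of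
the regular sphere around the path. -/
structure LabelledPath (X : GraphOfGraphs.{u}) where
  path : ℤ → X.V
  vl : ℤ → X.V → Bool
  hl : ℤ → Bool → X.H → Bool
  adj : ∀ i, X.vert.Adj (path i) (path (i + 1))
  immersed : ∀ i, path i ≠ path (i + 2)
  link : ∀ i σ h h', X.bd σ h = path i → X.strip.Adj h h' → X.bd σ h' ≠ path (i + 1) →
    X.bd σ h' ≠ path (i - 1) → vl i (X.bd σ h') = hl i σ h
  square : ∀ i σ h h', X.bd σ h = path i → X.strip.Adj h h' → X.bd σ h' = path (i + 1) →
    hl (i + 1) σ h' = hl i σ h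
  nonconst : ∀ β, ∃ i σ h, X.bd σ h = path i ∧ hl i σ h = β

namespace LabelledPath

variable {X : GraphOfGraphs.{u}}

/-- The labelled path with its places shifted by `n`. -/
def shift (Λ : X.LabelledPath) (n : ℤ) : X.LabelledPath where
  path i := Λ.path (i + n)
  vl i := Λ.vl (i + n)
  hl i := Λ.hl (i + n)
  adj i := by rw [add_right_comm]; exact Λ.adj _
  immersed i := by rw [add_right_comm]; exact Λ.immersed _
  link i := by
    rw [add_right_comm, sub_add_eq_add_sub]
    exact Λ.link _
  square i := by rw [add_right_comm]; exact Λ.square _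
  nonconst β := by
    obtain ⟨i, σ, h, h1, h2⟩ := Λ.nonconst β
    exact ⟨i - n, σ, h, by rwa [sub_add_cancel], by rwa [sub_add_cancel]⟩

/-- The labelled path with the opposite orientation; its edge from the place `0` to the place `1`
is kept. -/
def reverse (Λ : X.LabelledPath) : X.LabelledPath where
  path i := Λ.path (1 - i)
  vl i := Λ.vl (1 - i)
  hl i := Λ.hl (1 - i)
  adj i := by
    have := Λ.adj (1 - (i + 1))
    rw [show 1 - (i + 1) + 1 = 1 - i by ring] at this
    exact this.symm
  immersed i := by
    have := Λ.immersed (1 - (i + 2))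
    rw [show 1 - (i + 2) + 2 = 1 - i by ring] at this
    exact this.symm
  link i σ h h' hv hh h1 h2 := by
    refine Λ.link (1 - i) σ h h' hv hh ?_ ?_
    · rwa [show 1 - i + 1 = 1 - (i - 1) by ring]
    · rwa [show 1 - i - 1 = 1 - (i + 1) by ring]
  square i σ h h' hv hh h1 := by
    have := Λ.square (1 - (i + 1)) σ h' h h1 hh.symm
    rw [show 1 - (i + 1) + 1 = 1 - i by ring] at this
    exact (this hv).symm
  nonconst β := by
    obtain ⟨i, σ, h, h1, h2⟩ := Λ.nonconst β
    exact ⟨1 - i, σ, h, by rwa [sub_sub_cancel], by rwa [sub_sub_cancel]⟩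

variable (hBM : X.IsBradyMeier)

theorem adj_pred (Λ : X.LabelledPath) (i : ℤ) : X.vert.Adj (Λ.path i) (Λ.path (i - 1)) := by
  have := Λ.adj (i - 1)
  rw [sub_add_cancel] at this
  exact this.symm

theorem pred_ne_succ (Λ : X.LabelledPath) (i : ℤ) : Λ.path (i - 1) ≠ Λ.path (i + 1) := by
  have := Λ.immersed (i - 1)
  rwa [show i - 1 + 2 = i + 1 by ring] at this

include hBM in
/-- The label of a horizontal half-edge occurs at the next edge of the path. -/
theorem exists_succ (Λ : X.LabelledPath) {i : ℤ} {σ : Bool} {h : X.H}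
    (hv : X.bd σ h = Λ.path i) :
    ∃ τ k k', X.bd τ k = Λ.path i ∧ Λ.hl i τ k = Λ.hl i σ h ∧ X.strip.Adj k k' ∧
      X.bd τ k' = Λ.path (i + 1) :=
  hBM.exists_adjacent (Λ.adj_pred i) (Λ.adj i) (Λ.pred_ne_succ i)
    (PH := fun τ k => Λ.hl i τ k = Λ.hl i σ h) (PV := fun b => Λ.vl i b = Λ.hl i σ h)
    (fun τ k k' h1 h2 h3 h4 => by rw [Λ.link i τ k k' h1 h2 h4 h3]) hv rfl

include hBM in
theorem exists_hl_succ (Λ : X.LabelledPath) {i : ℤ} {β : Bool}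
    (h : ∃ σ h, X.bd σ h = Λ.path i ∧ Λ.hl i σ h = β) :
    ∃ σ h, X.bd σ h = Λ.path (i + 1) ∧ Λ.hl (i + 1) σ h = β := by
  obtain ⟨σ, h, hv, rfl⟩ := h
  obtain ⟨τ, k, k', h1, h2, h3, h4⟩ := Λ.exists_succ hBM hv
  exact ⟨τ, k', h4, by rw [Λ.square i τ k k' h1 h3 h4, h2]⟩

include hBM in
/-- Both labels occur at every place. -/
theorem exists_hl (Λ : X.LabelledPath) (β : Bool) (i : ℤ) :
    ∃ σ h, X.bd σ h = Λ.path i ∧ Λ.hl i σ h = β := by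
  obtain ⟨j, σ, h, h1, h2⟩ := Λ.nonconst β
  have up : ∀ (Λ : X.LabelledPath) (j : ℤ), (∃ σ h, X.bd σ h = Λ.path j ∧ Λ.hl j σ h = β) →
      ∀ n : ℕ, ∃ σ h, X.bd σ h = Λ.path (j + n) ∧ Λ.hl (j + n) σ h = β := by
    intro Λ j hj n
    induction n with
    | zero => simpa using hj
    | succ n ih =>
      have := Λ.exists_hl_succ hBM ih
      rw [add_assoc] at this
      exact_mod_cast this
  rcases le_total j i with hij | hij
  · obtain ⟨n, hn⟩ := Int.eq_ofNat_of_zero_le (sub_nonneg.2 hij)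
    have := up Λ j ⟨σ, h, h1, h2⟩ n
    rwa [show j + (n : ℤ) = i by omega] at this
  · obtain ⟨n, hn⟩ := Int.eq_ofNat_of_zero_le (sub_nonneg.2 hij)
    obtain ⟨σ, h, h1, h2⟩ := up Λ.reverse (1 - j) ⟨σ, h, by
      change _ = Λ.path (1 - (1 - j)); rwa [sub_sub_cancel], by
      change Λ.hl (1 - (1 - j)) _ _ = _; rwa [sub_sub_cancel]⟩ n
    have e : 1 - (1 - j + (n : ℤ)) = i := by omega
    change _ = Λ.path (1 - (1 - j + (n : ℤ))) at h1
    change Λ.hl (1 - (1 - j + (n : ℤ))) σ h = β at h2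
    rw [e] at h1 h2
    exact ⟨σ, h, h1, h2⟩

/-- Two labelled paths run through the same edge at the place `i`, with the same labels of the
squares that contain this edge. -/
structure AgreeAt (Λ Λ' : X.LabelledPath) (i : ℤ) : Prop where
  left : Λ.path i = Λ'.path i
  right : Λ.path (i + 1) = Λ'.path (i + 1)
  label : ∀ σ h h', X.bd σ h = Λ.path i → X.strip.Adj h h' → X.bd σ h' = Λ.path (i + 1) →
    Λ.hl i σ h = Λ'.hl i σ h

theorem AgreeAt.symm {Λ Λ' : X.LabelledPath} {i : ℤ} (H : AgreeAt Λ Λ' i) : AgreeAt Λ' Λ i where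
  left := H.left.symm
  right := H.right.symm
  label σ h h' h1 h2 h3 :=
    (H.label σ h h' (h1.trans H.left.symm) h2 (h3.trans H.right.symm)).symm

theorem AgreeAt.trans {Λ Λ' Λ'' : X.LabelledPath} {i : ℤ} (H : AgreeAt Λ Λ' i)
    (H' : AgreeAt Λ' Λ'' i) : AgreeAt Λ Λ'' i where
  left := H.left.trans H'.left
  right := H.right.trans H'.right
  label σ h h' h1 h2 h3 := (H.label σ h h' h1 h2 h3).trans
    (H'.label σ h h' (h1.trans H.left) h2 (h3.trans H.right))

theorem AgreeAt.label' {Λ Λ' : X.LabelledPath} {i : ℤ} (H : AgreeAt Λ Λ' i) {σ : Bool}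
    {h h' : X.H} (h1 : X.bd σ h = Λ.path i) (h2 : X.strip.Adj h h')
    (h3 : X.bd σ h' = Λ.path (i + 1)) : Λ.hl (i + 1) σ h' = Λ'.hl (i + 1) σ h' := by
  rw [Λ.square i σ h h' h1 h2 h3, H.label σ h h' h1 h2 h3,
    Λ'.square i σ h h' (h1.trans H.left) h2 (h3.trans H.right)]

theorem AgreeAt.reverse {Λ Λ' : X.LabelledPath} {i : ℤ} (H : AgreeAt Λ Λ' i) :
    AgreeAt Λ.reverse Λ'.reverse (-i) where
  left := by
    change Λ.path (1 - -i) = Λ'.path (1 - -i)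
    rw [show 1 - -i = i + 1 by ring]
    exact H.right
  right := by
    change Λ.path (1 - (-i + 1)) = Λ'.path (1 - (-i + 1))
    rw [show 1 - (-i + 1) = i by ring]
    exact H.left
  label σ h h' h1 h2 h3 := by
    change _ = Λ.path (1 - -i) at h1
    change _ = Λ.path (1 - (-i + 1)) at h3
    change Λ.hl (1 - -i) σ h = Λ'.hl (1 - -i) σ h
    rw [show 1 - -i = i + 1 by ring] at h1 ⊢
    rw [show 1 - (-i + 1) = i by ring] at h3
    exact H.label' h3 h2.symm h1

include hBM in
/-- The labels at an edge determine the labels at the next edge. -/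
theorem AgreeAt.succ {Λ Λ' : X.LabelledPath} {i : ℤ} (H : AgreeAt Λ Λ' i)
    (h2 : Λ.path (i + 1 + 1) = Λ'.path (i + 1 + 1)) : AgreeAt Λ Λ' (i + 1) := by
  refine ⟨H.right, h2, fun σ h _ hv _ _ => ?_⟩
  have e0 : Λ.path (i + 1 - 1) = Λ'.path (i + 1 - 1) := by
    rw [add_sub_cancel_right]; exact H.left
  obtain ⟨τ, k, k', k1, ⟨k2, k3⟩, k4, k5⟩ := hBM.exists_adjacent (Λ.adj (i + 1))
    (Λ.adj_pred (i + 1)) (Λ.pred_ne_succ (i + 1)).symm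
    (PH := fun τ k => Λ.hl (i + 1) τ k = Λ.hl (i + 1) σ h ∧
      Λ'.hl (i + 1) τ k = Λ'.hl (i + 1) σ h)
    (PV := fun b => Λ.vl (i + 1) b = Λ.hl (i + 1) σ h ∧ Λ'.vl (i + 1) b = Λ'.hl (i + 1) σ h)
    (fun τ k k' h1 h2' h3 h4 => by
      rw [Λ.link _ τ k k' h1 h2' h3 h4,
        Λ'.link _ τ k k' (h1.trans H.right) h2' (by rwa [← h2]) (by rwa [← e0])])
    hv ⟨rfl, rfl⟩
  rw [add_sub_cancel_right] at k5
  rw [← k2, ← k3]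
  exact H.label' k5 k4.symm k1

include hBM in
theorem AgreeAt.add {Λ Λ' : X.LabelledPath} {i : ℤ} (H : AgreeAt Λ Λ' i) (n : ℕ)
    (h : ∀ k : ℕ, k ≤ n → Λ.path (i + k + 1) = Λ'.path (i + k + 1)) :
    AgreeAt Λ Λ' (i + n) := by
  induction n with
  | zero => simpa using H
  | succ n ih =>
    have := (ih fun k hk => h k (by omega)).succ hBM (by
      have := h (n + 1) le_rfl
      push_cast at this
      rwa [add_assoc i n 1])
    rw [add_assoc] at this
    exact_mod_cast this

include hBM in
/-- Labellings of one path that agree at one edge agree at all edges. -/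
theorem AgreeAt.all {Λ Λ' : X.LabelledPath} {i : ℤ} (H : AgreeAt Λ Λ' i)
    (h : ∀ j, Λ.path j = Λ'.path j) (j : ℤ) : AgreeAt Λ Λ' j := by
  rcases le_total i j with hij | hij
  · obtain ⟨n, hn⟩ := Int.eq_ofNat_of_zero_le (sub_nonneg.2 hij)
    obtain rfl : j = i + n := by omega
    exact H.add hBM n fun k _ => h _
  · obtain ⟨n, hn⟩ := Int.eq_ofNat_of_zero_le (sub_nonneg.2 hij)
    have H' := (H.reverse.add hBM n fun k _ => h _).reverse
    rw [show -(-i + (n : ℤ)) = j by omega] at H'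
    refine ⟨h _, h _, fun σ k k' h1 h2 h3 => ?_⟩
    have e : ∀ (Λ : X.LabelledPath) (i : ℤ), Λ.reverse.reverse.hl i = Λ.hl i := fun Λ i => by
      change Λ.hl (1 - (1 - i)) = _
      rw [sub_sub_cancel]
    have e' : ∀ (Λ : X.LabelledPath) (i : ℤ), Λ.reverse.reverse.path i = Λ.path i := fun Λ i => by
      change Λ.path (1 - (1 - i)) = _
      rw [sub_sub_cancel]
    have := H'.label σ k k' (by rwa [e']) h2 (by rwa [e'])
    rwa [e, e] at this

include hBM in
/-- When two labelled paths agree at an edge and part after it, they part to different sides: if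
`w` and `w'` are the next vertices, and `r` is the label of `w'`, consider a half-edge with the
other label. Its component in the link without the three vertical half-edges avoids `w'`, hence it
reaches both the common edge, which carries its label over to the second path, and `w`. -/
theorem AgreeAt.vl_ne {Λ Λ' : X.LabelledPath} {i : ℤ} (H : AgreeAt Λ Λ' i)
    (hne : Λ.path (i + 1 + 1) ≠ Λ'.path (i + 1 + 1)) :
    Λ'.vl (i + 1) (Λ.path (i + 1 + 1)) = !Λ.vl (i + 1) (Λ'.path (i + 1 + 1)) := by
  set w := Λ.path (i + 1 + 1) with hw
  set w' := Λ'.path (i + 1 + 1) with hw'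
  set r := Λ.vl (i + 1) w' with hr
  have e0 : Λ.path (i + 1 - 1) = Λ'.path (i + 1 - 1) := by
    rw [add_sub_cancel_right]; exact H.left
  obtain ⟨σ, h, hv, hh⟩ := Λ.exists_hl hBM (!r) (i + 1)
  have hP : ∀ τ k k', X.bd τ k = Λ.path (i + 1) → X.strip.Adj k k' →
      X.bd τ k' ≠ Λ.path (i + 1 - 1) → X.bd τ k' ≠ w →
      ((Λ.hl (i + 1) τ k = !r ∧ Λ'.hl (i + 1) τ k = Λ'.hl (i + 1) σ h) ↔
        (X.bd τ k' ≠ w' ∧ Λ.vl (i + 1) (X.bd τ k') = !r ∧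
          Λ'.vl (i + 1) (X.bd τ k') = Λ'.hl (i + 1) σ h)) := by
    intro τ k k' h1 h2 h3 h4
    rw [← Λ.link _ τ k k' h1 h2 h4 h3]
    by_cases hb : X.bd τ k' = w'
    · rw [hb, ← hr]
      simp
    · rw [Λ'.link _ τ k k' (h1.trans H.right) h2 hb (by rwa [← e0])]
      simp [hb]
  -- The label `!r` of the first path agrees with the label of the second one at `h`.
  obtain ⟨τ, k, k', k1, ⟨k2, k3⟩, k4, k5⟩ := hBM.exists_adjacent (Λ.adj (i + 1))
    (Λ.adj_pred (i + 1)) (Λ.pred_ne_succ (i + 1)).symm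
    (PH := fun τ k => Λ.hl (i + 1) τ k = !r ∧ Λ'.hl (i + 1) τ k = Λ'.hl (i + 1) σ h)
    (PV := fun b => b ≠ w' ∧ Λ.vl (i + 1) b = !r ∧ Λ'.vl (i + 1) b = Λ'.hl (i + 1) σ h)
    (fun τ k k' h1 h2 h3 h4 => hP τ k k' h1 h2 h4 h3) hv ⟨hh, rfl⟩
  rw [add_sub_cancel_right] at k5
  have e1 := H.label' k5 k4.symm k1
  rw [k2, k3] at e1
  obtain ⟨τ, l, l', l1, ⟨l2, l3⟩, l4, l5⟩ := hBM.exists_adjacent (Λ.adj_pred (i + 1))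
    (Λ.adj (i + 1)) (Λ.pred_ne_succ (i + 1))
    (PH := fun τ k => Λ.hl (i + 1) τ k = !r ∧ Λ'.hl (i + 1) τ k = Λ'.hl (i + 1) σ h)
    (PV := fun b => b ≠ w' ∧ Λ.vl (i + 1) b = !r ∧ Λ'.vl (i + 1) b = Λ'.hl (i + 1) σ h)
    hP hv ⟨hh, rfl⟩
  have e2 := Λ'.link (i + 1) τ l l' (l1.trans H.right) l4
    (by rw [l5]; exact hne) (by rw [l5, ← e0]; exact (Λ.pred_ne_succ _).symm)
  rw [l5, ← hw, l3, ← e1] at e2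
  exact e2

/-! ### Periodic labelled paths -/

/-- The path, and the labels of the squares that contain its edges, have period `M`. -/
def IsPeriodic (Λ : X.LabelledPath) (M : ℕ) : Prop :=
  ∀ i, AgreeAt (Λ.shift M) Λ i

include hBM in
/-- A labelling of a periodic path is periodic, since there are finitely many possibilities for
the labels at one edge. -/
theorem exists_isPeriodic [Finite X.H] (Λ : X.LabelledPath) {m : ℕ} (hm : 0 < m)
    (hper : ∀ i, Λ.path (i + m) = Λ.path i) : ∃ M, 0 < M ∧ Λ.IsPeriodic M := by
  have hper' : ∀ (n : ℕ) (i : ℤ), Λ.path (i + (n * m : ℕ)) = Λ.path i := by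
    intro n
    induction n with
    | zero => simp
    | succ n ih =>
      intro i
      have := ih (i + m)
      rw [hper] at this
      rw [← this]
      congr 1
      push_cast
      ring
  have key : ∀ n n' : ℕ, n < n' → Λ.hl (n * m : ℕ) = Λ.hl (n' * m : ℕ) →
      ∃ M, 0 < M ∧ Λ.IsPeriodic M := by
    intro n n' hn e
    have H : AgreeAt (Λ.shift (n' * m : ℕ)) (Λ.shift (n * m : ℕ)) 0 := by
      refine ⟨(hper' _ _).trans (hper' _ _).symm, (hper' _ _).trans (hper' _ _).symm,
        fun σ h _ _ _ _ => ?_⟩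
      change Λ.hl (0 + (n' * m : ℕ)) σ h = Λ.hl (0 + (n * m : ℕ)) σ h
      rw [zero_add, zero_add, e]
    have H' := H.all hBM fun j => (hper' n' j).trans (hper' n j).symm
    refine ⟨(n' - n) * m, Nat.mul_pos (by omega) hm, fun i => ?_⟩
    have H2 := H' (i - (n * m : ℕ))
    have e1 : i - (n * m : ℕ) + (n' * m : ℕ) = i + ((n' - n) * m : ℕ) := by
      rw [Nat.sub_mul, Nat.cast_sub (Nat.mul_le_mul_right m hn.le)]
      ring
    refine ⟨hper' _ _, hper' _ _, fun σ h h' h1 h2 h3 => ?_⟩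
    change X.bd σ h = Λ.path (i + ((n' - n) * m : ℕ)) at h1
    change X.bd σ h' = Λ.path (i + 1 + ((n' - n) * m : ℕ)) at h3
    have := H2.label σ h h' (by
      change _ = Λ.path (i - (n * m : ℕ) + (n' * m : ℕ)); rwa [e1]) h2 (by
      change _ = Λ.path (i - (n * m : ℕ) + 1 + (n' * m : ℕ))
      rwa [add_right_comm, e1, add_right_comm])
    change Λ.hl (i - (n * m : ℕ) + (n' * m : ℕ)) σ h =
      Λ.hl (i - (n * m : ℕ) + (n * m : ℕ)) σ h at this
    rw [e1, sub_add_cancel] at this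
    exact this
  obtain ⟨n, n', hne, e⟩ := Finite.exists_ne_map_eq_of_infinite
    fun n : ℕ => Λ.hl (n * m : ℕ)
  rcases lt_or_gt_of_ne hne with h | h
  · exact key n n' h e
  · exact key n' n h e.symm

theorem IsPeriodic.path_add {Λ : X.LabelledPath} {M : ℕ} (H : Λ.IsPeriodic M) (i : ℤ) :
    Λ.path (i + M) = Λ.path i := (H i).left

theorem IsPeriodic.path_add_mul {Λ : X.LabelledPath} {M : ℕ} (H : Λ.IsPeriodic M) (i n : ℤ) :
    Λ.path (i + n * M) = Λ.path i := by
  have h : Function.Periodic Λ.path (M : ℤ) := H.path_add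
  simpa using h.int_mul n i

theorem IsPeriodic.shift {Λ : X.LabelledPath} {M : ℕ} (H : Λ.IsPeriodic M) (n : ℤ) :
    (Λ.shift n).IsPeriodic M := by
  intro i
  obtain ⟨h1, h2, h3⟩ := H (i + n)
  refine ⟨?_, ?_, ?_⟩
  · change Λ.path (i + M + n) = _
    rw [add_right_comm]
    exact h1
  · change Λ.path (i + 1 + M + n) = Λ.path (i + 1 + n)
    rw [show i + 1 + (M : ℤ) + n = i + n + 1 + M by ring, show i + 1 + n = i + n + 1 by ring]
    exact h2
  · change ∀ σ h h', _ = Λ.path (i + M + n) → _ → _ = Λ.path (i + 1 + M + n) →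
      Λ.hl (i + M + n) σ h = _
    rw [add_right_comm i, show i + 1 + (M : ℤ) + n = i + n + 1 + M by ring]
    exact h3

theorem IsPeriodic.reverse {Λ : X.LabelledPath} {M : ℕ} (H : Λ.IsPeriodic M) :
    Λ.reverse.IsPeriodic M := by
  intro i
  have hp : ∀ j, Λ.path (1 - (j + M)) = Λ.path (1 - j) := fun j => by
    rw [← H.path_add, show 1 - (j + (M : ℤ)) + M = 1 - j by ring]
  refine ⟨hp i, hp (i + 1), fun σ h h' h1 h2 h3 => ?_⟩
  have h1' := h1.trans (hp i)
  have h3' := h3.trans (hp (i + 1))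
  rw [show 1 - (i + 1) = -i by ring] at h3'
  rw [show 1 - i = -i + 1 by ring] at h1'
  have e := (H (-i - M)).label' (σ := σ) (h := h') (h' := h)
    (by change _ = Λ.path (-i - M + M); rwa [sub_add_cancel]) h2.symm
    (by change _ = Λ.path (-i - M + 1 + M)
        rwa [show -i - (M : ℤ) + 1 + M = -i + 1 by ring])
  change Λ.hl (-i - M + 1 + M) σ h = Λ.hl (-i - M + 1) σ h at e
  change Λ.hl (1 - (i + M)) σ h = Λ.hl (1 - i) σ h
  rw [show 1 - (i + (M : ℤ)) = -i - M + 1 by ring, ← e,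
    show -i - (M : ℤ) + 1 + M = 1 - i by ring]

/-- Periodic labelled paths that agree at the place `0` agree at all multiples of the period. -/
theorem AgreeAt.of_dvd {Λ Λ' : X.LabelledPath} {M : ℕ} (h : AgreeAt Λ Λ' 0)
    (H : Λ.IsPeriodic M) (H' : Λ'.IsPeriodic M) {i : ℤ} (hi : (M : ℤ) ∣ i) : AgreeAt Λ Λ' i := by
  have iff : ∀ i : ℤ, AgreeAt Λ Λ' (i + M) ↔ AgreeAt Λ Λ' i := by
    have aux : ∀ i : ℤ, AgreeAt (Λ.shift M) (Λ'.shift M) i ↔ AgreeAt Λ Λ' (i + M) := by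
      intro i
      constructor
      · rintro ⟨h1, h2, h3⟩
        change Λ.path (i + 1 + M) = Λ'.path (i + 1 + M) at h2
        change ∀ σ h h', _ = Λ.path (i + M) → _ → _ = Λ.path (i + 1 + M) → _ at h3
        rw [add_right_comm] at h2 h3
        exact ⟨h1, h2, h3⟩
      · rintro ⟨h1, h2, h3⟩
        rw [add_right_comm] at h2 h3
        exact ⟨h1, h2, h3⟩
    intro i
    rw [← aux]
    exact ⟨fun h => ((H i).symm.trans h).trans (H' i), fun h => ((H i).trans h).trans (H' i).symm⟩
  obtain ⟨n, rfl⟩ := hi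
  induction n using Int.induction_on with
  | zero => simpa using h
  | succ n ih =>
    rw [mul_add, mul_one]
    exact (iff _).2 ih
  | pred n ih =>
    rw [mul_sub, mul_one, ← iff, sub_add_cancel]
    exact ih

/-! ### Periodic paths made of pieces of two labelled paths -/

/-- The labelled path `Λ` on the places `1, …, M`, the labelled path `Λ'` on the places
`1 - M, …, 0`, and so on with period `2 M`. -/
def alternate (Λ Λ' : X.LabelledPath) (M : ℕ) (i : ℤ) : X.LabelledPath :=
  if (i - 1) / (M : ℤ) % 2 = 0 then Λ else Λ'

theorem alternate_eq {Λ Λ' : X.LabelledPath} {M : ℕ} (hM : 0 < M) {i : ℤ} (hi : ¬ (M : ℤ) ∣ i) :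
    alternate Λ Λ' M (i + 1) = alternate Λ Λ' M i := by
  have hM' : (0 : ℤ) < M := by exact_mod_cast hM
  have e : (i + 1 - 1) / (M : ℤ) = (i - 1) / (M : ℤ) := by
    rw [add_sub_cancel_right]
    have h1 := Int.emod_add_mul_ediv i M
    have h2 := Int.emod_nonneg i hM'.ne'
    have h3 := Int.emod_lt_of_pos i hM'
    have h4 : i % M ≠ 0 := fun e => hi (Int.dvd_of_emod_eq_zero e)
    symm
    rw [Int.ediv_eq_iff_of_pos hM']
    constructor
    · rw [mul_comm]; omega
    · rw [mul_comm]; omega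
  rw [alternate, alternate, e]

theorem alternate_of_pos {Λ Λ' : X.LabelledPath} {M : ℕ} {i : ℤ} (h1 : 1 ≤ i) (h2 : i ≤ M) :
    alternate Λ Λ' M i = Λ := by
  rw [alternate, Int.ediv_eq_zero_of_lt (by omega) (by omega), if_pos (by decide)]

theorem alternate_of_nonpos {Λ Λ' : X.LabelledPath} {M : ℕ} {i : ℤ} (h1 : -M < i) (h2 : i ≤ 0) :
    alternate Λ Λ' M i = Λ' := by
  have e : (i - 1) / (M : ℤ) = -1 := by
    rw [Int.ediv_eq_iff_of_pos (by omega)]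
    constructor <;> omega
  rw [alternate, e, if_neg (by decide)]

theorem alternate_cases (Λ Λ' : X.LabelledPath) (M : ℕ) (i : ℤ) :
    alternate Λ Λ' M i = Λ ∨ alternate Λ Λ' M i = Λ' := by
  rw [alternate]
  split_ifs
  · exact Or.inl rfl
  · exact Or.inr rfl

section Glue

variable {Λ Λ' : X.LabelledPath} {M : ℕ} (hM : 0 < M) (h : AgreeAt Λ Λ' 0)
  (H : Λ.IsPeriodic M) (H' : Λ'.IsPeriodic M)
include hM h H H'

theorem agreeAt_alternate (i : ℤ) :
    AgreeAt (alternate Λ Λ' M i) (alternate Λ Λ' M (i + 1)) i := by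
  by_cases hi : (M : ℤ) ∣ i
  · have hΛ := h.of_dvd H H' hi
    have r : ∀ Λ : X.LabelledPath, AgreeAt Λ Λ i := fun Λ => ⟨rfl, rfl, fun _ _ _ _ _ _ => rfl⟩
    rcases alternate_cases Λ Λ' M i with e | e <;>
    rcases alternate_cases Λ Λ' M (i + 1) with e' | e' <;> rw [e, e']
    · exact r _
    · exact hΛ
    · exact hΛ.symm
    · exact r _
  · rw [alternate_eq hM hi]
    exact ⟨rfl, rfl, fun _ _ _ _ _ _ => rfl⟩

theorem alternate_path_succ (i : ℤ) :
    (alternate Λ Λ' M (i + 1)).path (i + 1) = (alternate Λ Λ' M i).path (i + 1) :=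
  (agreeAt_alternate hM h H H' i).right.symm

theorem alternate_path_pred (i : ℤ) :
    (alternate Λ Λ' M (i - 1)).path (i - 1) = (alternate Λ Λ' M i).path (i - 1) := by
  have := (agreeAt_alternate hM h H H' (i - 1)).left
  rwa [sub_add_cancel] at this

include hBM in
theorem exists_glue : ∃ Θ : X.LabelledPath,
    (∀ i, Θ.path i = (alternate Λ Λ' M i).path i) ∧
      ∀ i, Θ.vl i = (alternate Λ Λ' M i).vl i := by
  refine ⟨⟨fun i => (alternate Λ Λ' M i).path i, fun i => (alternate Λ Λ' M i).vl i,
    fun i => (alternate Λ Λ' M i).hl i, fun i => ?_, fun i => ?_, fun i σ k k' h1 h2 h3 h4 => ?_,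
    fun i σ k k' h1 h2 h3 => ?_, fun β => ?_⟩, fun _ => rfl, fun _ => rfl⟩
  · rw [alternate_path_succ hM h H H']
    exact (alternate Λ Λ' M i).adj i
  · have e1 := alternate_path_pred hM h H H' (i + 1)
    have e2 := alternate_path_succ hM h H H' (i + 1)
    rw [add_sub_cancel_right] at e1
    rw [show i + 2 = i + 1 + 1 by ring, e1, e2, show i + 1 + 1 = i + 2 by ring]
    exact (alternate Λ Λ' M (i + 1)).immersed i
  · rw [alternate_path_succ hM h H H'] at h3
    rw [alternate_path_pred hM h H H'] at h4
    exact (alternate Λ Λ' M i).link i σ k k' h1 h2 h3 h4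
  · have A := agreeAt_alternate hM h H H' i
    rw [A.label σ k k' h1 h2 (h3.trans A.right.symm)]
    exact (alternate Λ Λ' M (i + 1)).square i σ k k' (h1.trans A.left) h2 h3
  · obtain ⟨σ, k, h1, h2⟩ := Λ.exists_hl hBM β 1
    have e : alternate Λ Λ' M 1 = Λ := alternate_of_pos le_rfl (by omega)
    exact ⟨1, σ, k, by rw [e]; exact h1, by rw [e]; exact h2⟩

omit h in
theorem alternate_path_add (i : ℤ) :
    (alternate Λ Λ' M (i + (2 * M : ℕ))).path (i + (2 * M : ℕ)) = (alternate Λ Λ' M i).path i := by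
  have e : alternate Λ Λ' M (i + (2 * M : ℕ)) = alternate Λ Λ' M i := by
    have : (i + (2 * M : ℕ) - 1) / (M : ℤ) = (i - 1) / (M : ℤ) + 2 := by
      rw [← Int.add_mul_ediv_right _ _ (by omega)]
      congr 1
      push_cast
      ring
    rw [alternate, alternate, this, Int.add_emod_right]
  rw [e]
  have key : ∀ {Λ : X.LabelledPath}, Λ.IsPeriodic M → Λ.path (i + (2 * M : ℕ)) = Λ.path i :=
    fun H => by
      have := H.path_add_mul i 2
      rwa [show i + 2 * (M : ℤ) = i + (2 * M : ℕ) by push_cast; ring] at this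
  rcases alternate_cases Λ Λ' M i with e | e <;> rw [e]
  · exact key H
  · exact key H'

end Glue

/-! ### Labelled paths that part -/

/-- Starting from the place `0`, the paths first part after the place `n + 1`. -/
def PartsAt (Λ Λ' : X.LabelledPath) (n : ℕ) : Prop :=
  (∀ i : ℤ, 0 ≤ i → i ≤ n + 1 → Λ.path i = Λ'.path i) ∧ Λ.path (n + 2) ≠ Λ'.path (n + 2)

theorem PartsAt.symm {Λ Λ' : X.LabelledPath} {n : ℕ} (h : PartsAt Λ Λ' n) : PartsAt Λ' Λ n :=
  ⟨fun i h0 h1 => (h.1 i h0 h1).symm, h.2.symm⟩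

theorem PartsAt.unique {Λ Λ' : X.LabelledPath} {n n' : ℕ} (h : PartsAt Λ Λ' n)
    (h' : PartsAt Λ Λ' n') : n = n' := by
  rcases lt_trichotomy n n' with hn | hn | hn
  · exact absurd (h'.1 (n + 2) (by omega) (by omega)) h.2
  · exact hn
  · exact absurd (h.1 (n' + 2) (by omega) (by omega)) h'.2

theorem exists_partsAt {Λ Λ' : X.LabelledPath} {M : ℕ} (hM : 0 < M) (h : AgreeAt Λ Λ' 0)
    (H : Λ.IsPeriodic M) (H' : Λ'.IsPeriodic M) (hne : Λ.path ≠ Λ'.path) :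
    ∃ n : ℕ, n + 2 < M ∧ PartsAt Λ Λ' n := by
  classical
  obtain ⟨z, hz⟩ := Function.ne_iff.1 hne
  have hM' : (0 : ℤ) < M := by exact_mod_cast hM
  have hz' : Λ.path (z % M) ≠ Λ'.path (z % M) := by
    have e : z % M = z + -(z / M) * M := by
      have := Int.emod_add_mul_ediv z M
      rw [neg_mul, mul_comm]
      omega
    rw [e, H.path_add_mul, H'.path_add_mul]
    exact hz
  have ex : ∃ n : ℕ, Λ.path n ≠ Λ'.path n :=
    ⟨(z % M).toNat, by rwa [Int.toNat_of_nonneg (Int.emod_nonneg _ hM'.ne')]⟩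
  have hlt : Nat.find ex < M := by
    refine (Nat.find_min' ex (m := (z % M).toNat) ?_).trans_lt ?_
    · rwa [Int.toNat_of_nonneg (Int.emod_nonneg _ hM'.ne')]
    · have := Int.emod_lt_of_pos z hM'
      omega
  have h0 : Nat.find ex ≠ 0 := fun e => by
    have := Nat.find_spec ex
    rw [e] at this
    exact this h.left
  have h1 : Nat.find ex ≠ 1 := fun e => by
    have := Nat.find_spec ex
    rw [e] at this
    exact this h.right
  obtain ⟨n, hn⟩ : ∃ n, Nat.find ex = n + 2 := ⟨Nat.find ex - 2, by omega⟩
  refine ⟨n, by omega, fun i hi hi' => ?_, ?_⟩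
  · by_contra hi2
    have := Nat.find_min' ex (m := i.toNat) (by rwa [Int.toNat_of_nonneg hi])
    omega
  · have := Nat.find_spec ex
    rw [hn] at this
    exact_mod_cast this

include hBM in
/-- Two labelled paths that agree at the place `0` part to different sides. -/
theorem PartsAt.vl_eq_not {Λ Λ' : X.LabelledPath} {n : ℕ} (hn : PartsAt Λ Λ' n)
    (h : AgreeAt Λ Λ' 0) :
    Λ'.vl (n + 1) (Λ.path (n + 2)) = !Λ.vl (n + 1) (Λ'.path (n + 2)) := by
  have H := h.add hBM n fun k hk => hn.1 _ (by omega) (by omega)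
  have := H.vl_ne hBM
  simp only [zero_add] at this
  rw [show (n : ℤ) + 1 + 1 = n + 2 by ring] at this
  exact this hn.2

/-- Among three labelled paths, pairwise on different sides of one another to the right (`R k j` is
the side of the `k`-th path to which the `j`-th one parts), there is one that has the two others
on different sides; to the left, one of them departs to the side opposite to one of these. -/
theorem exists_ne_of_tournament {R L : Fin 3 → Fin 3 → Bool}
    (hR : ∀ i j, i ≠ j → R j i = !R i j) : ∃ i j k, i ≠ k ∧ j ≠ k ∧ R k j ≠ L k i := by
  obtain ⟨k, a, b, ha, hb, hne⟩ : ∃ k a b, a ≠ k ∧ b ≠ k ∧ R k a ≠ R k b := by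
    have h01 := hR 0 1 (by decide)
    have h02 := hR 0 2 (by decide)
    have h12 := hR 1 2 (by decide)
    by_cases h0 : R 0 1 = R 0 2
    · by_cases h1 : R 1 0 = R 1 2
      · refine ⟨2, 0, 1, by decide, by decide, ?_⟩
        rw [h02, h12, ← h0, ← h1, h01]
        simp
      · exact ⟨1, 0, 2, by decide, by decide, h1⟩
    · exact ⟨0, 1, 2, by decide, by decide, h0⟩
  by_cases h : R k a = L k a
  · exact ⟨a, b, k, ha, hb, fun e => hne (h.trans e.symm)⟩
  · exact ⟨a, a, k, ha, ha, h⟩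

include hBM in
/-- Three distinct periodic labelled paths that agree at the place `0` give a periodic labelled
path that crosses one of them: it comes from one of them and continues along another one, such
that it enters and leaves the third one on different sides. -/
theorem exists_crossing {Λ : Fin 3 → X.LabelledPath} {M : ℕ} (hM : 0 < M)
    (hper : ∀ i, (Λ i).IsPeriodic M) (hagree : ∀ i j, AgreeAt (Λ i) (Λ j) 0)
    (hne : ∀ i j, i ≠ j → (Λ i).path ≠ (Λ j).path) :
    ∃ (k : Fin 3) (Θ : X.LabelledPath) (N n m : ℕ), 0 < N ∧ (∀ i, Θ.path (i + N) = Θ.path i) ∧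
      PartsAt (Λ k) Θ n ∧ PartsAt (Λ k).reverse Θ.reverse m ∧
      (Λ k).vl (n + 1) (Θ.path (n + 2)) ≠ (Λ k).reverse.vl (m + 1) (Θ.reverse.path (m + 2)) ∧
      Θ.vl (n + 1) ((Λ k).path (n + 2)) ≠ Θ.reverse.vl (m + 1) ((Λ k).reverse.path (m + 2)) := by
  have hagree' : ∀ i j, AgreeAt (Λ i).reverse (Λ j).reverse 0 := fun i j => by
    simpa using (hagree i j).reverse
  have hne' : ∀ i j, i ≠ j → (Λ i).reverse.path ≠ (Λ j).reverse.path := fun i j hij e => by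
    refine hne i j hij (funext fun x => ?_)
    have := congrFun e (1 - x)
    change (Λ i).path (1 - (1 - x)) = (Λ j).path (1 - (1 - x)) at this
    rwa [sub_sub_cancel] at this
  have ex : ∀ i j, ∃ n : ℕ, i ≠ j → n + 2 < M ∧ PartsAt (Λ i) (Λ j) n := fun i j => by
    by_cases hij : i = j
    · exact ⟨0, fun h => absurd hij h⟩
    · obtain ⟨n, hn⟩ := exists_partsAt hM (hagree i j) (hper i) (hper j) (hne i j hij)
      exact ⟨n, fun _ => hn⟩
  have ex' : ∀ i j, ∃ n : ℕ, i ≠ j → n + 2 < M ∧ PartsAt (Λ i).reverse (Λ j).reverse n :=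
    fun i j => by
      by_cases hij : i = j
      · exact ⟨0, fun h => absurd hij h⟩
      · obtain ⟨n, hn⟩ := exists_partsAt hM (hagree' i j) (hper i).reverse (hper j).reverse
          (hne' i j hij)
        exact ⟨n, fun _ => hn⟩
  choose n hn using ex
  choose m hm using ex'
  obtain ⟨i, j, k, hik, hjk, hRL⟩ := exists_ne_of_tournament
    (R := fun i j => (Λ i).vl (n i j + 1) ((Λ j).path (n i j + 2)))
    (L := fun i j => (Λ i).reverse.vl (m i j + 1) ((Λ j).reverse.path (m i j + 2)))
    (fun i j hij => by
      have e : n i j = n j i := (hn i j hij).2.unique (hn j i hij.symm).2.symm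
      have := (hn i j hij).2.vl_eq_not hBM (hagree i j)
      rwa [e] at this ⊢)
  obtain ⟨Θ, hΘ, hΘ'⟩ := exists_glue hBM hM (hagree j i) (hper j) (hper i)
  obtain ⟨hnM, hnk⟩ := hn k j hjk.symm
  obtain ⟨hmM, hmk⟩ := hm k i hik.symm
  have hj : ∀ x : ℤ, 0 ≤ x → x ≤ M → Θ.path x = (Λ j).path x := by
    intro x h0 h1
    rw [hΘ]
    rcases h0.eq_or_lt with rfl | h0
    · rw [alternate_of_nonpos (by omega) le_rfl]
      exact (hagree i j).left
    · rw [alternate_of_pos (by omega) h1]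
  have hi : ∀ x : ℤ, -M < x → x ≤ 1 → Θ.path x = (Λ i).path x := by
    intro x h0 h1
    rw [hΘ]
    rcases h1.eq_or_lt with rfl | h1
    · rw [alternate_of_pos le_rfl (by omega)]
      exact (hagree j i).right
    · rw [alternate_of_nonpos h0 (by omega)]
  have hj' : Θ.vl (n k j + 1) = (Λ j).vl (n k j + 1) := by
    rw [hΘ', alternate_of_pos (by omega) (by omega)]
  have hi' : Θ.reverse.vl (m k i + 1) = (Λ i).reverse.vl (m k i + 1) := by
    change Θ.vl (1 - (m k i + 1)) = (Λ i).vl (1 - (m k i + 1))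
    rw [hΘ', alternate_of_nonpos (by omega) (by omega)]
  have hir : ∀ x : ℤ, 0 ≤ x → x ≤ M → Θ.reverse.path x = (Λ i).reverse.path x :=
    fun x h0 h1 => hi (1 - x) (by omega) (by omega)
  refine ⟨k, Θ, 2 * M, n k j, m k i, by omega, fun x => ?_, ⟨fun x h0 h1 => ?_, ?_⟩,
    ⟨fun x h0 h1 => ?_, ?_⟩, ?_, ?_⟩
  · rw [hΘ, hΘ, alternate_path_add hM (hper j) (hper i)]
  · rw [hj x h0 (by omega)]
    exact hnk.1 x h0 h1
  · rw [hj _ (by omega) (by omega)]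
    exact hnk.2
  · rw [hir x h0 (by omega)]
    exact hmk.1 x h0 h1
  · rw [hir _ (by omega) (by omega)]
    exact hmk.2
  · rw [hj _ (by omega) (by omega), hir _ (by omega) (by omega)]
    exact hRL
  · rw [hj', hi', hnk.vl_eq_not hBM (hagree k j), hmk.vl_eq_not hBM (hagree' k i)]
    exact fun e => hRL (by simpa using e)

end LabelledPath

/-! ### The position of a vertical path in the complex -/

section Position

variable {Y : GraphOfGraphs.{u}} (γ : Y.VerticalPath)

theorem VerticalPath.reachable (i j : ℤ) : Y.vert.Reachable (γ.toFun i) (γ.toFun j) := by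
  have up : ∀ (i : ℤ) (n : ℕ), Y.vert.Reachable (γ.toFun i) (γ.toFun (i + n)) := by
    intro i n
    induction n with
    | zero => simp
    | succ n ih =>
      have := ih.trans (γ.adj (i + n)).reachable
      rw [add_assoc] at this
      exact_mod_cast this
  rcases le_total i j with h | h
  · have := up i (j - i).toNat
    rwa [Int.toNat_of_nonneg (by omega), add_sub_cancel] at this
  · have := up j (i - j).toNat
    rw [Int.toNat_of_nonneg (by omega), add_sub_cancel] at this
    exact this.symm

/-- A vertical path meets at most one of the two vertical sides of a square. -/
theorem VerticalPath.notMem_or_notMem (hI : Y.IsImmersed) (hY : Y.IsSimplyConnected) {σ : Bool}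
    {h h' : Y.H} (hh : h = h' ∨ Y.strip.Adj h h') (h1 : Y.bd σ h ∈ Set.range γ.toFun) :
    Y.bd (!σ) h' ∉ Set.range γ.toFun := by
  rintro ⟨j, hj⟩
  obtain ⟨i, hi⟩ := h1
  refine not_reachable_of_horizontal hI hY σ h ?_
  have h2 : Y.vert.Reachable (Y.bd (!σ) h) (Y.bd (!σ) h') := by
    rcases hh with rfl | hh
    · exact SimpleGraph.Reachable.refl _
    · exact ((Y.bd (!σ)).map_adj hh).reachable
  rw [← hi]
  rw [← hj] at h2
  exact h2.trans (γ.reachable j i)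

theorem VerticalPath.exists_side (hI : Y.IsImmersed) (hY : Y.IsSimplyConnected) {h h' : Y.H}
    (hh : Y.strip.Adj h h') :
    ∃ σ, Y.bd σ h ∉ Set.range γ.toFun ∧ Y.bd σ h' ∉ Set.range γ.toFun := by
  by_cases h1 : Y.bd false h ∈ Set.range γ.toFun
  · exact ⟨true, γ.notMem_or_notMem hI hY (Or.inl rfl) h1,
      γ.notMem_or_notMem hI hY (Or.inr hh) h1⟩
  · by_cases h2 : Y.bd false h' ∈ Set.range γ.toFun
    · exact ⟨true, γ.notMem_or_notMem hI hY (Or.inr hh.symm) h2,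
        γ.notMem_or_notMem hI hY (Or.inl rfl) h2⟩
    · exact ⟨false, h1, h2⟩

/-- The points of a vertical edge that lie on a vertical path. -/
def VerticalPath.MemEdge (d : Y.vert.Dart) (s : unitInterval) : Prop :=
  (d.fst ∈ Set.range γ.toFun ∧ d.snd ∈ Set.range γ.toFun) ∨
    (s = 0 ∧ d.fst ∈ Set.range γ.toFun) ∨ (s = 1 ∧ d.snd ∈ Set.range γ.toFun)

/-- The points of the closed cells that lie on a vertical path. -/
def VerticalPath.MemCell : Y.CellPoint → Prop
  | .vertex a => a ∈ Set.range γ.toFun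
  | .vedge d s => γ.MemEdge d s
  | .hedge h t => ∃ σ, t = sideEnd σ ∧ Y.bd σ h ∈ Set.range γ.toFun
  | .square d s t => ∃ σ, t = sideEnd σ ∧ γ.MemEdge ((Y.bd σ).mapDart d) s

theorem VerticalPath.memEdge_symm (d : Y.vert.Dart) (s : unitInterval) :
    γ.MemEdge d.symm (unitInterval.symm s) ↔ γ.MemEdge d s := by
  have e1 : unitInterval.symm s = 0 ↔ s = 1 := by
    rw [← unitInterval.symm_one, unitInterval.symm_inj]
  have e2 : unitInterval.symm s = 1 ↔ s = 0 := by
    rw [← unitInterval.symm_zero, unitInterval.symm_inj]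
  simp only [MemEdge, SimpleGraph.Dart.symm, Prod.fst_swap, Prod.snd_swap, e1, e2]
  tauto

theorem sideEnd_inj {σ τ : Bool} : sideEnd σ = sideEnd τ ↔ σ = τ := by
  cases σ <;> cases τ <;> simp [sideEnd]

theorem VerticalPath.memCell_of_glue {x y : Y.CellPoint} (h : Y.Glue x y) :
    γ.MemCell x ↔ γ.MemCell y := by
  have z : ∀ d : Y.vert.Dart, γ.MemEdge d 0 ↔ d.fst ∈ Set.range γ.toFun := fun d => by
    simp only [MemEdge, zero_ne_one, false_and, or_false, true_and]
    tauto
  cases h with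
  | vedge_symm d s => exact (γ.memEdge_symm d s).symm
  | vedge_start d => exact z d
  | hedge_end h σ =>
    simp only [MemCell, sideEnd_inj]
    simp
  | square_symm d s t =>
    exact exists_congr fun σ => and_congr_right fun _ =>
      (γ.memEdge_symm ((Y.bd σ).mapDart d) s).symm
  | square_start d t => exact exists_congr fun σ => and_congr_right fun _ => z _
  | square_side d s σ =>
    simp only [MemCell, sideEnd_inj]
    simp

theorem VerticalPath.vertex_mem_carrier {a : Y.V} (h : a ∈ Set.range γ.toFun) :
    ofCell (.vertex a) ∈ γ.carrier := by
  obtain ⟨i, rfl⟩ := h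
  exact ⟨i, 0, (ofCell_vedge_zero (γ.dart i)).symm⟩

theorem VerticalPath.mem_carrier_of_memEdge (hI : Y.IsImmersed) (hY : Y.IsSimplyConnected)
    {d : Y.vert.Dart} {s : unitInterval} (h : γ.MemEdge d s) :
    ofCell (.vedge d s) ∈ γ.carrier := by
  rcases h with ⟨⟨i, hi⟩, ⟨j, hj⟩⟩ | ⟨rfl, h⟩ | ⟨rfl, h⟩
  · have hd := d.adj
    rw [← hi, ← hj] at hd
    rcases γ.eq_of_adj hI hY hd with rfl | rfl
    · refine ⟨i, s, ?_⟩
      congr 2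
      exact SimpleGraph.Dart.ext _ _ (Prod.ext hi.symm hj.symm)
    · refine ⟨j, unitInterval.symm s, ?_⟩
      rw [ofCell_vedge_symm]
      congr 2
      exact SimpleGraph.Dart.ext _ _ (Prod.ext hj.symm hi.symm)
  · rw [ofCell_vedge_zero]
    exact γ.vertex_mem_carrier h
  · rw [ofCell_vedge_one]
    exact γ.vertex_mem_carrier h

theorem VerticalPath.mem_carrier_iff (hI : Y.IsImmersed) (hY : Y.IsSimplyConnected)
    {x : Y.CellPoint} : ofCell x ∈ γ.carrier ↔ γ.MemCell x := by
  constructor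
  · rintro ⟨i, s, e⟩
    let P : Y.Realization → Prop :=
      Quot.lift γ.MemCell fun x y h => propext (γ.memCell_of_glue h)
    have h : P (ofCell (.vedge (γ.dart i) s)) := Or.inl ⟨⟨i, rfl⟩, ⟨i + 1, rfl⟩⟩
    have e' : P (ofCell x) = P (ofCell (.vedge (γ.dart i) s)) := congrArg P e
    rw [← e'] at h
    exact h
  · intro h
    cases x with
    | vertex a => exact γ.vertex_mem_carrier h
    | vedge d s => exact γ.mem_carrier_of_memEdge hI hY h
    | hedge k t =>
      obtain ⟨σ, rfl, h⟩ := h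
      rw [ofCell_hedge_end]
      exact γ.vertex_mem_carrier h
    | square d s t =>
      obtain ⟨σ, rfl, h⟩ := h
      rw [ofCell_square_side]
      exact γ.mem_carrier_of_memEdge hI hY h

end Position

/-! ### Splittings of the complement of a line -/

section Splittings

variable {Y : GraphOfGraphs.{u}}

/-- The open sets `u false` and `u true` split the complement of `S`. -/
structure IsSplitting (S : Set Y.Realization) (u : Bool → Set Y.Realization) : Prop where
  isOpen : ∀ β, IsOpen (u β)
  cover : Sᶜ ⊆ u false ∪ u true
  disjoint : Sᶜ ∩ (u false ∩ u true) = ∅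
  nonempty : ∀ β, (Sᶜ ∩ u β).Nonempty

theorem IsSplitting.not_isPreconnected {S : Set Y.Realization} {u : Bool → Set Y.Realization}
    (h : IsSplitting S u) : ¬ IsPreconnected Sᶜ := fun hc => by
  have := hc _ _ (h.isOpen false) (h.isOpen true) h.cover (h.nonempty _) (h.nonempty _)
  rw [h.disjoint] at this
  exact Set.not_nonempty_empty this

theorem exists_isSplitting {S : Set Y.Realization} (h : ¬ IsPreconnected Sᶜ) :
    ∃ u, IsSplitting S u := by
  simp only [IsPreconnected] at h
  push Not at h
  obtain ⟨u, v, hu, hv, h1, h2, h3, h4⟩ := h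
  refine ⟨fun β => if β then v else u, fun β => ?_, h1, h4, fun β => ?_⟩
  · cases β
    · exact hu
    · exact hv
  · cases β
    · exact h2
    · exact h3

theorem IsSplitting.subset_of_isPreconnected {S : Set Y.Realization}
    {u : Bool → Set Y.Realization} (h : IsSplitting S u) {T : Set Y.Realization}
    (hT : IsPreconnected T) (hTS : T ⊆ Sᶜ) : ∃ β, T ⊆ u β := by
  rw [isPreconnected_iff_subset_of_disjoint] at hT
  rcases hT _ _ (h.isOpen false) (h.isOpen true) (hTS.trans h.cover)
    (Set.eq_empty_of_subset_empty (by
      rw [← h.disjoint]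
      exact Set.inter_subset_inter_left _ hTS)) with h | h
  · exact ⟨_, h⟩
  · exact ⟨_, h⟩

theorem IsSplitting.eq_of_mem {S : Set Y.Realization} {u : Bool → Set Y.Realization}
    (h : IsSplitting S u) {x : Y.Realization} (hx : x ∉ S) {β β' : Bool} (h1 : x ∈ u β)
    (h2 : x ∈ u β') : β = β' := by
  have key : ¬ (x ∈ u false ∧ x ∈ u true) := fun hx' => by
    have : x ∈ Sᶜ ∩ (u false ∩ u true) := ⟨hx, hx'⟩
    rw [h.disjoint] at this
    exact this
  cases β <;> cases β'
  · rfl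
  · exact absurd ⟨h1, h2⟩ key
  · exact absurd ⟨h2, h1⟩ key
  · rfl

/-- A connected subset of the complement of `S` lies on one side of a splitting. -/
theorem IsSplitting.mem_iff {S : Set Y.Realization} {u : Bool → Set Y.Realization}
    (h : IsSplitting S u) {T : Set Y.Realization} (hT : IsPreconnected T) (hTS : T ⊆ Sᶜ)
    {x y : Y.Realization} (hx : x ∈ T) (hy : y ∈ T) (β : Bool) : x ∈ u β ↔ y ∈ u β := by
  obtain ⟨β', hβ⟩ := h.subset_of_isPreconnected hT hTS
  constructor
  · intro h'
    rw [h.eq_of_mem (hTS hx) h' (hβ hx)]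
    exact hβ hy
  · intro h'
    rw [h.eq_of_mem (hTS hy) h' (hβ hy)]
    exact hβ hx

/-- A set that meets both sides of a splitting of the complement of `L` crosses `L`. -/
theorem IsSplitting.crosses {L L' : Set Y.Realization} {u : Bool → Set Y.Realization}
    (h : IsSplitting L u) {x y : Y.Realization} (hx : x ∈ L') (hy : y ∈ L') (hxL : x ∉ L)
    (hyL : y ∉ L) {β β' : Bool} (hβ : β ≠ β') (hxu : x ∈ u β) (hyu : y ∈ u β') :
    Crosses L' L := by
  rintro A ⟨z, hz, rfl⟩ hA
  obtain ⟨δ, hδ⟩ := h.subset_of_isPreconnected isPreconnected_connectedComponentIn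
    (connectedComponentIn_subset Lᶜ z)
  -- A point on a side lies in the closure of the component only if the component meets the side.
  have key : ∀ w ∈ L', w ∉ L → ∀ δ', w ∈ u δ' → δ' = δ := by
    intro w hw hwL δ' hw'
    obtain ⟨t, ht, ht'⟩ := mem_closure_iff.1 (hA hw) (u δ') (h.isOpen δ') hw'
    exact h.eq_of_mem (connectedComponentIn_subset _ _ ht') ht (hδ ht')
  exact hβ ((key x hx hxL β hxu).trans (key y hy hyL β' hyu).symm)

/-- The labels of the vertical edges that leave the path are the sides on which their other ends
lie. -/
def IsCompatible {X : GraphOfGraphs.{v}} (p : Hom Y X) (γ : Y.VerticalPath)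
    (Λ : X.LabelledPath) (u : Bool → Set Y.Realization) : Prop :=
  ∀ i b, Y.vert.Adj (γ.toFun i) b → b ∉ Set.range γ.toFun →
    ofCell (.vertex b) ∈ u (Λ.vl i (p.onV b))

end Splittings

/-! ### A splitting gives a labelling -/

section ToLabelling

variable {X : GraphOfGraphs.{v}} {Y : GraphOfGraphs.{u}} {p : Hom Y X} {γ : Y.VerticalPath}
  (hI : Y.IsImmersed) (hY : Y.IsSimplyConnected) {u : Bool → Set Y.Realization}
  (hu : IsSplitting γ.carrier u)

include hI hY

theorem vertex_notMem_carrier {a : Y.V} (h : a ∉ Set.range γ.toFun) :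
    ofCell (.vertex a) ∉ γ.carrier := by
  rwa [γ.mem_carrier_iff hI hY]

include hu

theorem IsSplitting.mem_vert_iff {a b : Y.V} (hab : Y.vert.Adj a b)
    (ha : a ∉ Set.range γ.toFun) (hb : b ∉ Set.range γ.toFun) (β : Bool) :
    ofCell (.vertex a) ∈ u β ↔ ofCell (.vertex b) ∈ u β := by
  refine hu.mem_iff (isPreconnected_range (continuous_vedge ⟨(a, b), hab⟩)) ?_
    ⟨0, ofCell_vedge_zero _⟩ ⟨1, ofCell_vedge_one _⟩ β
  rintro _ ⟨s, rfl⟩ h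
  rw [γ.mem_carrier_iff hI hY] at h
  rcases h with h | h | h
  · exact ha h.1
  · exact ha h.2
  · exact hb h.2

theorem IsSplitting.mem_hor_iff {h : Y.H} (hh : ∀ τ, Y.bd τ h ∉ Set.range γ.toFun)
    (σ τ : Bool) (β : Bool) :
    ofCell (.vertex (Y.bd σ h)) ∈ u β ↔ ofCell (.vertex (Y.bd τ h)) ∈ u β := by
  refine hu.mem_iff (isPreconnected_range (continuous_hedge h)) ?_
    ⟨_, ofCell_hedge_end h σ⟩ ⟨_, ofCell_hedge_end h τ⟩ β
  rintro _ ⟨s, rfl⟩ h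
  rw [γ.mem_carrier_iff hI hY] at h
  obtain ⟨τ, -, h⟩ := h
  exact hh τ h

theorem IsSplitting.exists_vertex_of_vedge {d : Y.vert.Dart} {s : unitInterval}
    (h : ofCell (.vedge d s) ∉ γ.carrier) :
    ∃ a ∉ Set.range γ.toFun, ∀ β, ofCell (.vedge d s) ∈ u β ↔ ofCell (.vertex a) ∈ u β := by
  have key : ∀ (d : Y.vert.Dart) (s : unitInterval), ofCell (.vedge d s) ∉ γ.carrier →
      d.fst ∉ Set.range γ.toFun →
      ∀ β, ofCell (.vedge d s) ∈ u β ↔ ofCell (.vertex d.fst) ∈ u β := by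
    intro d s h hd β
    refine hu.mem_iff (isPreconnected_Iic.image _ (continuous_vedge d).continuousOn) ?_
      ⟨s, Set.mem_Iic.2 le_rfl, rfl⟩ ⟨0, Set.mem_Iic.2 unitInterval.nonneg', ofCell_vedge_zero d⟩ β
    rintro _ ⟨r, hr, rfl⟩ h'
    rw [γ.mem_carrier_iff hI hY] at h h'
    rcases h' with h' | h' | ⟨rfl, h'⟩
    · exact hd h'.1
    · exact hd h'.2
    · exact h (Or.inr (Or.inr ⟨le_antisymm unitInterval.le_one' hr, h'⟩))
  by_cases hd : d.fst ∈ Set.range γ.toFun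
  · have hd' : d.snd ∉ Set.range γ.toFun := fun hd' => by
      rw [γ.mem_carrier_iff hI hY] at h
      exact h (Or.inl ⟨hd, hd'⟩)
    rw [ofCell_vedge_symm] at h ⊢
    exact ⟨d.snd, hd', key _ _ h hd'⟩
  · exact ⟨d.fst, hd, key d s h hd⟩

/-- Every point off the path can be joined to a vertex off the path inside a cell. -/
theorem IsSplitting.exists_vertex {x : Y.Realization} (hx : x ∉ γ.carrier) :
    ∃ a ∉ Set.range γ.toFun, ∀ β, x ∈ u β ↔ ofCell (.vertex a) ∈ u β := by
  obtain ⟨c, rfl⟩ := exists_ofCell x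
  cases c with
  | vertex a =>
    rw [γ.mem_carrier_iff hI hY] at hx
    exact ⟨a, hx, fun _ => Iff.rfl⟩
  | vedge d s => exact hu.exists_vertex_of_vedge hI hY hx
  | hedge h t =>
    have hx' := hx
    rw [γ.mem_carrier_iff hI hY] at hx'
    by_cases h0 : Y.bd false h ∈ Set.range γ.toFun
    · have h1 := γ.notMem_or_notMem hI hY (Or.inl rfl) h0
      refine ⟨_, h1, fun β => hu.mem_iff
        (isPreconnected_Ici.image _ (continuous_hedge h).continuousOn) ?_
        ⟨t, Set.mem_Ici.2 le_rfl, rfl⟩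
        ⟨1, Set.mem_Ici.2 unitInterval.le_one', ofCell_hedge_end h true⟩ β⟩
      rintro _ ⟨r, hr, rfl⟩ h'
      rw [γ.mem_carrier_iff hI hY] at h'
      obtain ⟨τ, rfl, h'⟩ := h'
      cases τ
      · exact hx' ⟨false, le_antisymm hr unitInterval.nonneg', h0⟩
      · exact h1 h'
    · refine ⟨_, h0, fun β => hu.mem_iff
        (isPreconnected_Iic.image _ (continuous_hedge h).continuousOn) ?_
        ⟨t, Set.mem_Iic.2 le_rfl, rfl⟩
        ⟨0, Set.mem_Iic.2 unitInterval.nonneg', ofCell_hedge_end h false⟩ β⟩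
      rintro _ ⟨r, hr, rfl⟩ h'
      rw [γ.mem_carrier_iff hI hY] at h'
      obtain ⟨τ, rfl, h'⟩ := h'
      cases τ
      · exact h0 h'
      · exact hx' ⟨true, le_antisymm unitInterval.le_one' hr, h'⟩
  | square d s t =>
    have hx' := hx
    rw [γ.mem_carrier_iff hI hY] at hx'
    obtain ⟨σ, h1, h2⟩ := γ.exists_side hI hY d.adj
    have off : ∀ s, ¬ γ.MemEdge ((Y.bd σ).mapDart d) s := by
      rintro s (h | h | h)
      · exact h1 h.1
      · exact h1 h.2
      · exact h2 h.2
    have off' : ofCell (.square d s (sideEnd σ)) ∉ γ.carrier := by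
      rw [ofCell_square_side, γ.mem_carrier_iff hI hY]
      exact off s
    obtain ⟨a, ha, hβ⟩ := hu.exists_vertex_of_vedge hI hY (ofCell_square_side d s σ ▸ off')
    rw [← ofCell_square_side] at hβ
    refine ⟨a, ha, fun β => Iff.trans ?_ (hβ β)⟩
    cases σ
    · refine hu.mem_iff
        (isPreconnected_Iic.image _ (continuous_square d s).continuousOn) ?_
        ⟨t, Set.mem_Iic.2 le_rfl, rfl⟩ ⟨0, Set.mem_Iic.2 unitInterval.nonneg', rfl⟩ β
      rintro _ ⟨r, hr, rfl⟩ h'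
      rw [γ.mem_carrier_iff hI hY] at h'
      obtain ⟨τ, rfl, h'⟩ := h'
      cases τ
      · exact off s h'
      · exact hx' ⟨true, le_antisymm unitInterval.le_one' hr, h'⟩
    · refine hu.mem_iff
        (isPreconnected_Ici.image _ (continuous_square d s).continuousOn) ?_
        ⟨t, Set.mem_Ici.2 le_rfl, rfl⟩ ⟨1, Set.mem_Ici.2 unitInterval.le_one', rfl⟩ β
      rintro _ ⟨r, hr, rfl⟩ h'
      rw [γ.mem_carrier_iff hI hY] at h'
      obtain ⟨τ, rfl, h'⟩ := h'
      cases τ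
      · exact hx' ⟨false, le_antisymm hr unitInterval.nonneg', h'⟩
      · exact off s h'

/-- Following a path from a vertex off the line until it meets the line, one finds a half-edge at
the line on the same side. -/
theorem IsSplitting.exists_half_edge {a b : Y.V} (q : Y.EdgePath a b)
    (hb : b ∈ Set.range γ.toFun) (ha : a ∉ Set.range γ.toFun) {β : Bool}
    (hβ : ofCell (.vertex a) ∈ u β) :
    ∃ i b, b ∉ Set.range γ.toFun ∧ ofCell (.vertex b) ∈ u β ∧
      (Y.vert.Adj (γ.toFun i) b ∨ ∃ σ h, Y.bd σ h = γ.toFun i ∧ Y.bd (!σ) h = b) := by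
  induction q with
  | nil => exact absurd hb ha
  | @cons a a' b s q ih =>
    by_cases ha' : a' ∈ Set.range γ.toFun
    · obtain ⟨i, rfl⟩ := ha'
      refine ⟨i, a, ha, hβ, ?_⟩
      cases s with
      | vertical h => exact Or.inl h.symm
      | horizontal σ h h1 h2 => exact Or.inr ⟨!σ, h, h2, by rw [Bool.not_not]; exact h1⟩
    · refine ih hb ha' ?_
      cases s with
      | vertical h => exact (hu.mem_vert_iff hI hY h ha ha' β).1 hβ
      | horizontal σ h h1 h2 =>
        subst h2
        rw [← h1] at hβ ha
        refine (hu.mem_hor_iff hI hY (fun τ => ?_) σ (!σ) β).1 hβ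
        cases σ <;> cases τ <;> assumption

open Classical in
/-- The sides of the half-edges along a separating vertical path form a labelling. -/
theorem IsSplitting.exists_labelledPath (hBM : X.IsBradyMeier) (hp : p.IsCovering) :
    ∃ Λ : X.LabelledPath, (∀ i, p.onV (γ.toFun i) = Λ.path i) ∧ IsCompatible p γ Λ u := by
  let V : ℤ → X.V → Bool := fun i b =>
    decide (∃ b', Y.vert.Adj (γ.toFun i) b' ∧ p.onV b' = b ∧ ofCell (.vertex b') ∈ u true)
  let W : ℤ → Bool → X.H → Bool := fun i σ h =>
    decide (∃ h', Y.bd σ h' = γ.toFun i ∧ p.onH h' = h ∧ ofCell (.vertex (Y.bd (!σ) h')) ∈ u true)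
  have mem : ∀ a, a ∉ Set.range γ.toFun →
      ofCell (.vertex a) ∈ u (decide (ofCell (.vertex a) ∈ u true)) := by
    intro a ha
    by_cases h : ofCell (.vertex a) ∈ u true
    · simp only [h, decide_true]
    · simp only [h, decide_false]
      exact (hu.cover (vertex_notMem_carrier hI hY ha)).resolve_right h
  have hV : ∀ i b, Y.vert.Adj (γ.toFun i) b →
      V i (p.onV b) = decide (ofCell (.vertex b) ∈ u true) := by
    intro i b hb
    simp only [V]
    congr 1
    refine propext ⟨?_, fun h => ⟨b, hb, rfl, h⟩⟩
    rintro ⟨b', h1, h2, h3⟩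
    rwa [← hp.vert_unique h1 hb h2]
  have hW : ∀ i σ h, Y.bd σ h = γ.toFun i →
      W i σ (p.onH h) = decide (ofCell (.vertex (Y.bd (!σ) h)) ∈ u true) := by
    intro i σ h hb
    simp only [W]
    congr 1
    refine propext ⟨?_, fun h' => ⟨h, hb, rfl, h'⟩⟩
    rintro ⟨h', h1, h2, h3⟩
    rwa [← hp.hor_unique (h1.trans hb.symm) h2]
  -- Around a square, the three vertices off the path are on the same side.
  have hVW : ∀ i σ h h', Y.bd σ h = γ.toFun i → Y.strip.Adj h h' →
      Y.bd σ h' ∉ Set.range γ.toFun → V i (p.onV (Y.bd σ h')) = W i σ (p.onH h) := by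
    intro i σ h h' h1 h2 h3
    have n1 := γ.notMem_or_notMem hI hY (h := h) (h' := h) (Or.inl rfl) ⟨i, h1.symm⟩
    have n2 := γ.notMem_or_notMem hI hY (h := h) (h' := h') (Or.inr h2) ⟨i, h1.symm⟩
    rw [hV i _ (by rw [← h1]; exact (Y.bd σ).map_adj h2), hW i σ h h1]
    congr 1
    refine propext ((hu.mem_hor_iff hI hY (fun τ => ?_) σ (!σ) true).trans
      (hu.mem_vert_iff hI hY ((Y.bd (!σ)).map_adj h2.symm) n2 n1 true))
    cases σ <;> cases τ <;> assumption
  have himm : ∀ i, p.onV (γ.toFun i) ≠ p.onV (γ.toFun (i + 2)) := by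
    intro i e
    refine γ.immersed i (hp.vert_unique (γ.adj i).symm ?_ e)
    have := γ.adj (i + 1)
    rwa [add_assoc] at this
  have hprev : ∀ i, Y.vert.Adj (γ.toFun i) (γ.toFun (i - 1)) := fun i => by
    have := γ.adj (i - 1)
    rw [sub_add_cancel] at this
    exact this.symm
  have hlink : ∀ i σ h h', X.bd σ h = p.onV (γ.toFun i) → X.strip.Adj h h' →
      X.bd σ h' ≠ p.onV (γ.toFun (i + 1)) → X.bd σ h' ≠ p.onV (γ.toFun (i - 1)) →
      V i (X.bd σ h') = W i σ h := by
    intro i σ h h' h1 h2 h3 h4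
    obtain ⟨k, hk, rfl⟩ := hp.exists_hor h1
    obtain ⟨k', hk', rfl⟩ := hp.exists_strip h2
    rw [← p.comm] at h3 h4 ⊢
    refine hVW i σ k k' hk hk' ?_
    rintro ⟨j, hj⟩
    have hadj : Y.vert.Adj (γ.toFun i) (γ.toFun j) := by
      rw [← hk, hj]
      exact (Y.bd σ).map_adj hk'
    rw [← hj] at h3 h4
    rcases γ.eq_of_adj hI hY hadj with rfl | rfl
    · exact h3 rfl
    · exact h4 (by rw [add_sub_cancel_right])
  refine ⟨⟨fun i => p.onV (γ.toFun i), V, W, fun i => p.onV.map_adj (γ.adj i), himm, hlink,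
    ?_, ?_⟩, fun _ => rfl, ?_⟩
  · intro i σ h h' h1 h2 h3
    obtain ⟨k, hk, rfl⟩ := hp.exists_hor h1
    obtain ⟨k', hk', rfl⟩ := hp.exists_strip h2
    have hk2 : Y.bd σ k' = γ.toFun (i + 1) := by
      refine hp.vert_unique (a := γ.toFun i) ?_ (γ.adj i) (by rw [p.comm, h3])
      rw [← hk]
      exact (Y.bd σ).map_adj hk'
    have n1 := γ.notMem_or_notMem hI hY (h := k) (h' := k) (Or.inl rfl) ⟨i, hk.symm⟩
    have n2 := γ.notMem_or_notMem hI hY (h := k') (h' := k') (Or.inl rfl) ⟨i + 1, hk2.symm⟩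
    rw [hW _ _ _ hk, hW _ _ _ hk2]
    congr 1
    exact propext (hu.mem_vert_iff hI hY ((Y.bd (!σ)).map_adj hk'.symm) n2 n1 true)
  · intro β
    obtain ⟨x, hx, hxu⟩ := hu.nonempty β
    obtain ⟨a, ha, hax⟩ := hu.exists_vertex hI hY hx
    obtain ⟨q⟩ := hY.1.2 a (γ.toFun 0)
    obtain ⟨i, b, hb, hbu, h⟩ := hu.exists_half_edge hI hY q ⟨0, rfl⟩ ha ((hax β).1 hxu)
    have hval : decide (ofCell (.vertex b) ∈ u true) = β :=
      hu.eq_of_mem (vertex_notMem_carrier hI hY hb) (mem b hb) hbu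
    rcases h with h | ⟨σ, h, h1, rfl⟩
    · have ne : ∀ j, p.onV (γ.toFun j) ≠ p.onV b ∨ ¬ Y.vert.Adj (γ.toFun i) (γ.toFun j) := by
        intro j
        by_contra! hc
        exact hb ⟨j, hp.vert_unique hc.2 h hc.1⟩
      have ne1 := (ne (i + 1)).resolve_right (not_not.2 (γ.adj i))
      have ne2 := (ne (i - 1)).resolve_right (not_not.2 (hprev i))
      obtain ⟨σ, k, k', h1, h2, h3⟩ := hBM.exists_square (p.onV.map_adj h)
        (p.onV.map_adj (γ.adj i)) ne1.symm
      refine ⟨i, σ, k, h1, ?_⟩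
      rw [← hlink i σ k k' h1 h2 (by rw [h3]; exact ne1.symm) (by rw [h3]; exact ne2.symm), h3,
        hV i b h, hval]
    · exact ⟨i, σ, p.onH h, by rw [← p.comm, h1], by rw [hW i σ h h1, hval]⟩
  · intro i b hb hb'
    change _ ∈ u (V i (p.onV b))
    rw [hV i b hb]
    exact mem b hb'

end ToLabelling

/-! ### A labelling gives a splitting -/

section FromLabelling

variable {X : GraphOfGraphs.{v}} {Y : GraphOfGraphs.{u}} (p : Hom Y X) (γ : Y.VerticalPath)
  (Λ : X.LabelledPath)

open Classical in
/-- The label of the vertical half-edge from `a` to `b` if it leaves the path at `a`, and `false`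
otherwise. -/
noncomputable def vertLabel (a b : Y.V) : Bool :=
  if H : a ∈ Set.range γ.toFun ∧ b ∉ Set.range γ.toFun then Λ.vl H.1.choose (p.onV b) else false

open Classical in
/-- The label of the `σ`-end of `h` if it lies on the path, and `false` otherwise. -/
noncomputable def horLabel (σ : Bool) (h : Y.H) : Bool :=
  if H : Y.bd σ h ∈ Set.range γ.toFun then Λ.hl H.choose σ (p.onH h) else false

variable {p γ Λ}

theorem vertLabel_of_mem (hγ : Function.Injective γ.toFun) (i : ℤ) {b : Y.V}
    (hb : b ∉ Set.range γ.toFun) : vertLabel p γ Λ (γ.toFun i) b = Λ.vl i (p.onV b) := by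
  have H : γ.toFun i ∈ Set.range γ.toFun := ⟨i, rfl⟩
  rw [vertLabel, dif_pos ⟨H, hb⟩, hγ H.choose_spec]

theorem vertLabel_of_notMem_left {a b : Y.V} (ha : a ∉ Set.range γ.toFun) :
    vertLabel p γ Λ a b = false :=
  dif_neg fun H => ha H.1

theorem vertLabel_of_mem_right {a b : Y.V} (hb : b ∈ Set.range γ.toFun) :
    vertLabel p γ Λ a b = false :=
  dif_neg fun H => H.2 hb

theorem horLabel_of_mem (hγ : Function.Injective γ.toFun) {i : ℤ} {σ : Bool} {h : Y.H}
    (hi : Y.bd σ h = γ.toFun i) : horLabel p γ Λ σ h = Λ.hl i σ (p.onH h) := by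
  have H : Y.bd σ h ∈ Set.range γ.toFun := ⟨i, hi.symm⟩
  rw [horLabel, dif_pos H, hγ (H.choose_spec.trans hi)]

theorem horLabel_of_notMem {σ : Bool} {h : Y.H} (ha : Y.bd σ h ∉ Set.range γ.toFun) :
    horLabel p γ Λ σ h = false :=
  dif_neg ha

variable (hI : Y.IsImmersed) (hY : Y.IsSimplyConnected) (hp : p.IsCovering)
  (hΛ : ∀ i, p.onV (γ.toFun i) = Λ.path i)

/-- The change of side along an oriented edge. -/
noncomputable def sideChange (p : Hom Y X) (γ : Y.VerticalPath) (Λ : X.LabelledPath) :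
    {a b : Y.V} → Y.Step a b → Bool
  | a, b, .vertical _ => vertLabel p γ Λ a b ^^ vertLabel p γ Λ b a
  | _, _, .horizontal σ h _ _ => horLabel p γ Λ σ h ^^ horLabel p γ Λ (!σ) h

include hI hY hp hΛ in
/-- The changes of side cancel along each vertical side of a square. -/
theorem horLabel_xor {σ : Bool} {h h' : Y.H} (hh : Y.strip.Adj h h') :
    horLabel p γ Λ σ h' = (horLabel p γ Λ σ h ^^
      (vertLabel p γ Λ (Y.bd σ h) (Y.bd σ h') ^^ vertLabel p γ Λ (Y.bd σ h') (Y.bd σ h))) := by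
  have hinj := VerticalPath.injective hI hY γ
  have hadj : Y.vert.Adj (Y.bd σ h) (Y.bd σ h') := (Y.bd σ).map_adj hh
  have succ : ∀ {h h' : Y.H} (_ : Y.strip.Adj h h') (i : ℤ), Y.bd σ h = γ.toFun i →
      Y.bd σ h' = γ.toFun (i + 1) → horLabel p γ Λ σ h' = horLabel p γ Λ σ h := by
    intro h h' hh i h1 h2
    rw [horLabel_of_mem hinj h1, horLabel_of_mem hinj h2]
    exact Λ.square i σ _ _ (by rw [← p.comm, h1, hΛ]) (p.onH.map_adj hh)
      (by rw [← p.comm, h2, hΛ])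
  have link : ∀ {h h' : Y.H} (_ : Y.strip.Adj h h'), Y.bd σ h ∈ Set.range γ.toFun →
      Y.bd σ h' ∉ Set.range γ.toFun →
      vertLabel p γ Λ (Y.bd σ h) (Y.bd σ h') = horLabel p γ Λ σ h := by
    rintro h h' hh ⟨i, hi⟩ hn
    have hadj : Y.vert.Adj (γ.toFun i) (Y.bd σ h') := by
      rw [hi]
      exact (Y.bd σ).map_adj hh
    rw [horLabel_of_mem hinj hi.symm, ← hi, vertLabel_of_mem hinj i hn, p.comm]
    refine Λ.link i σ _ _ (by rw [← p.comm, ← hi, hΛ]) (p.onH.map_adj hh) ?_ ?_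
    · rw [← hΛ, ← p.comm]
      exact fun e => hn ⟨_, hp.vert_unique (γ.adj i) hadj e.symm⟩
    · rw [← hΛ, ← p.comm]
      intro e
      have := γ.adj (i - 1)
      rw [sub_add_cancel] at this
      exact hn ⟨_, hp.vert_unique this.symm hadj e.symm⟩
  by_cases h1 : Y.bd σ h ∈ Set.range γ.toFun <;> by_cases h2 : Y.bd σ h' ∈ Set.range γ.toFun
  · rw [vertLabel_of_mem_right h1, vertLabel_of_mem_right h2, Bool.xor_false, Bool.xor_false]
    obtain ⟨i, hi⟩ := h1
    obtain ⟨j, hj⟩ := h2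
    rw [← hi, ← hj] at hadj
    rcases γ.eq_of_adj hI hY hadj with rfl | rfl
    · exact succ hh i hi.symm hj.symm
    · exact (succ hh.symm j hj.symm hi.symm).symm
  · rw [link hh h1 h2, vertLabel_of_notMem_left h2, horLabel_of_notMem h2]
    simp
  · rw [link hh.symm h2 h1, vertLabel_of_notMem_left h1, horLabel_of_notMem h1]
    simp
  · rw [vertLabel_of_notMem_left h1, vertLabel_of_notMem_left h2, horLabel_of_notMem h1,
      horLabel_of_notMem h2]
    simp

include hI hY hp hΛ in
/-- The changes of side are the differences of a function on the vertices, because they cancel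
around backtracks and squares and the complex is simply connected. -/
theorem exists_side_function : ∃ φ : Y.V → Bool, (∀ i, φ (γ.toFun i) = false) ∧
    ∀ a b (s : Y.Step a b), φ b = (φ a ^^ sideChange p γ Λ s) := by
  let T : Y.Transport fun _ => Bool :=
    { map := fun s x => x ^^ sideChange p γ Λ s
      backtrack := by
        intro a b s x
        cases s with
        | vertical hab =>
          change ((x ^^ (vertLabel p γ Λ a b ^^ vertLabel p γ Λ b a)) ^^
            (vertLabel p γ Λ b a ^^ vertLabel p γ Λ a b)) = x
          cases x <;> cases vertLabel p γ Λ a b <;> cases vertLabel p γ Λ b a <;> rfl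
        | horizontal σ h ha hb =>
          change ((x ^^ (horLabel p γ Λ σ h ^^ horLabel p γ Λ (!σ) h)) ^^
            (horLabel p γ Λ (!σ) h ^^ horLabel p γ Λ (!!σ) h)) = x
          rw [Bool.not_not]
          cases x <;> cases horLabel p γ Λ σ h <;> cases horLabel p γ Λ (!σ) h <;> rfl
      square := by
        intro σ h h' hh x
        change ((x ^^ (horLabel p γ Λ σ h ^^ horLabel p γ Λ (!σ) h)) ^^
            (vertLabel p γ Λ (Y.bd (!σ) h) (Y.bd (!σ) h') ^^
              vertLabel p γ Λ (Y.bd (!σ) h') (Y.bd (!σ) h))) =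
          ((x ^^ (vertLabel p γ Λ (Y.bd σ h) (Y.bd σ h') ^^
              vertLabel p γ Λ (Y.bd σ h') (Y.bd σ h))) ^^
            (horLabel p γ Λ σ h' ^^ horLabel p γ Λ (!σ) h'))
        rw [horLabel_xor hI hY hp hΛ (σ := σ) hh, horLabel_xor hI hY hp hΛ (σ := !σ) hh]
        generalize (vertLabel p γ Λ (Y.bd σ h) (Y.bd σ h') ^^
          vertLabel p γ Λ (Y.bd σ h') (Y.bd σ h)) = y
        generalize (vertLabel p γ Λ (Y.bd (!σ) h) (Y.bd (!σ) h') ^^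
          vertLabel p γ Λ (Y.bd (!σ) h') (Y.bd (!σ) h)) = z
        cases x <;> cases y <;> cases z <;> cases horLabel p γ Λ σ h <;>
          cases horLabel p γ Λ (!σ) h <;> rfl }
  let φ : Y.V → Bool := fun a => T.carry hY (a := γ.toFun 0) (b := a) false
  have hstep : ∀ a b (s : Y.Step a b), φ b = (φ a ^^ sideChange p γ Λ s) := fun a b s =>
    T.carry_step hY _ s
  have hsucc : ∀ i, φ (γ.toFun (i + 1)) = φ (γ.toFun i) := by
    intro i
    rw [hstep _ _ (.vertical (γ.adj i)), sideChange, vertLabel_of_mem_right ⟨_, rfl⟩,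
      vertLabel_of_mem_right ⟨_, rfl⟩]
    simp
  refine ⟨φ, fun i => ?_, hstep⟩
  induction i using Int.induction_on with
  | zero => exact T.carry_self hY _
  | succ i ih => rw [hsucc, ih]
  | pred i ih => rw [← hsucc, sub_add_cancel, ih]

open Classical in
/-- The function that vanishes on the path and has the sign given by `φ` off the path. -/
noncomputable def signFunction (γ : Y.VerticalPath) (φ : Y.V → Bool) (a : Y.V) : ℝ :=
  if a ∈ Set.range γ.toFun then 0 else if φ a then 1 / 2 else -1 / 2

theorem signFunction_of_mem {φ : Y.V → Bool} {a : Y.V} (h : a ∈ Set.range γ.toFun) :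
    signFunction γ φ a = 0 := if_pos h

theorem signFunction_of_notMem {φ : Y.V → Bool} {a : Y.V} (h : a ∉ Set.range γ.toFun) :
    signFunction γ φ a = if φ a then 1 / 2 else -1 / 2 := if_neg h

theorem signFunction_ne_zero {φ : Y.V → Bool} {a : Y.V} (h : a ∉ Set.range γ.toFun) :
    signFunction γ φ a ≠ 0 := by
  rw [signFunction_of_notMem h]
  split_ifs <;> norm_num

theorem abs_signFunction_sub_le {φ : Y.V → Bool} {a b : Y.V}
    (h : a ∉ Set.range γ.toFun → b ∉ Set.range γ.toFun → φ b = φ a) :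
    |signFunction γ φ b - signFunction γ φ a| ≤ 1 / 2 := by
  by_cases ha : a ∈ Set.range γ.toFun <;> by_cases hb : b ∈ Set.range γ.toFun
  · rw [signFunction_of_mem ha, signFunction_of_mem hb]
    norm_num
  · rw [signFunction_of_mem ha, signFunction_of_notMem hb]
    split_ifs <;> norm_num [abs_le]
  · rw [signFunction_of_notMem ha, signFunction_of_mem hb]
    split_ifs <;> norm_num [abs_le]
  · rw [signFunction_of_notMem ha, signFunction_of_notMem hb, h ha hb]
    norm_num

theorem memEdge_of_interp_eq_zero {φ : Y.V → Bool}
    (hv : ∀ a b, Y.vert.Adj a b → a ∉ Set.range γ.toFun → b ∉ Set.range γ.toFun → φ b = φ a)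
    {d : Y.vert.Dart} {s : unitInterval}
    (h : interp s (signFunction γ φ d.fst) (signFunction γ φ d.snd) = 0) : γ.MemEdge d s := by
  by_cases ha : d.fst ∈ Set.range γ.toFun <;> by_cases hb : d.snd ∈ Set.range γ.toFun
  · exact Or.inl ⟨ha, hb⟩
  · rw [signFunction_of_mem ha, interp, mul_zero, zero_add] at h
    exact Or.inr (Or.inl ⟨Subtype.ext ((mul_eq_zero.1 h).resolve_right
      (signFunction_ne_zero hb)), ha⟩)
  · rw [signFunction_of_mem hb, interp, mul_zero, add_zero] at h
    have := (mul_eq_zero.1 h).resolve_right (signFunction_ne_zero ha)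
    refine Or.inr (Or.inr ⟨Subtype.ext ?_, hb⟩)
    change (s : ℝ) = 1
    linarith
  · have e : signFunction γ φ d.snd = signFunction γ φ d.fst := by
      rw [signFunction_of_notMem ha, signFunction_of_notMem hb, hv _ _ d.adj ha hb]
    rw [e, interp, ← add_mul, sub_add_cancel, one_mul] at h
    exact absurd h (signFunction_ne_zero ha)

/-- In a square whose side `t = 1` is off the path, the corners off the path have the value `ε` and
the other corners have the value `0`. The multilinear extension vanishes only on the opposite side,
where the linear extension from the ends of that side vanishes. -/
theorem eq_zero_of_interp_eq_zero {s t x y ε : ℝ} (hs0 : 0 ≤ s) (hs1 : s ≤ 1) (ht0 : 0 ≤ t)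
    (ht1 : t ≤ 1) (hε : ε ≠ 0) (hx : x = 0 ∨ x = ε) (hy : y = 0 ∨ y = ε)
    (h : (1 - t) * interp s x y + t * ε = 0) : t = 0 ∧ interp s x y = 0 := by
  obtain ⟨μ, hμ, e⟩ : ∃ μ, 0 ≤ μ ∧ interp s x y = μ * ε := by
    rcases hx with rfl | rfl <;> rcases hy with rfl | rfl
    · exact ⟨0, le_rfl, by simp [interp]⟩
    · exact ⟨s, hs0, by simp [interp]⟩
    · exact ⟨1 - s, by linarith, by simp [interp]⟩
    · exact ⟨1, zero_le_one, by simp only [interp]; ring⟩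
  rw [e] at h ⊢
  have h' : ((1 - t) * μ + t) * ε = 0 := by rw [← h]; ring
  have h2 := (mul_eq_zero.1 h').resolve_right hε
  have h3 : 0 ≤ (1 - t) * μ := mul_nonneg (by linarith) hμ
  have h4 : t = 0 := by linarith
  rw [h4] at h2
  exact ⟨h4, by rw [show μ = 0 by linarith, zero_mul]⟩

include hI hY in
/-- The multilinear extension of the sign function vanishes on the path only: in every cell the
vertices off the path have the same sign, and the others span a face. -/
theorem mem_carrier_of_hat_eq_zero {φ : Y.V → Bool}
    (hv : ∀ a b, Y.vert.Adj a b → a ∉ Set.range γ.toFun → b ∉ Set.range γ.toFun → φ b = φ a)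
    (hh : ∀ σ h, Y.bd σ h ∉ Set.range γ.toFun → Y.bd (!σ) h ∉ Set.range γ.toFun →
      φ (Y.bd (!σ) h) = φ (Y.bd σ h)) {x : Y.Realization}
    (hx : hat (signFunction γ φ) x = 0) : x ∈ γ.carrier := by
  obtain ⟨c, rfl⟩ := exists_ofCell x
  rw [hat_ofCell] at hx
  rw [γ.mem_carrier_iff hI hY]
  set f := signFunction γ φ with hf
  have hor : ∀ σ h ε, Y.bd σ h ∉ Set.range γ.toFun → f (Y.bd σ h) = ε →
      f (Y.bd (!σ) h) = 0 ∨ f (Y.bd (!σ) h) = ε := by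
    intro σ h ε h1 h2
    by_cases h3 : Y.bd (!σ) h ∈ Set.range γ.toFun
    · exact Or.inl (signFunction_of_mem h3)
    · right
      rw [← h2, hf, signFunction_of_notMem h1, signFunction_of_notMem h3, hh σ h h1 h3]
  cases c with
  | vertex a =>
    by_contra h
    exact signFunction_ne_zero h hx
  | vedge d s => exact memEdge_of_interp_eq_zero hv hx
  | hedge h t =>
    by_cases h0 : Y.bd false h ∈ Set.range γ.toFun
    · have h1 := γ.notMem_or_notMem hI hY (Or.inl rfl) h0
      change interp t (f (Y.bd false h)) (f (Y.bd true h)) = 0 at hx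
      rw [hf, signFunction_of_mem h0, interp, mul_zero, zero_add] at hx
      exact ⟨false, Subtype.ext ((mul_eq_zero.1 hx).resolve_right (signFunction_ne_zero h1)), h0⟩
    · have h2 := eq_zero_of_interp_eq_zero (s := 0) (t := 1 - t) (x := f (Y.bd true h))
        (y := f (Y.bd true h)) le_rfl zero_le_one (by linarith [t.2.2]) (by linarith [t.2.1])
        (signFunction_ne_zero h0) (hor false h _ h0 rfl) (hor false h _ h0 rfl)
        (by rw [← hx]; simp only [hatCell, interp]; ring)
      by_cases h1 : Y.bd true h ∈ Set.range γ.toFun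
      · refine ⟨true, Subtype.ext ?_, h1⟩
        change (t : ℝ) = 1
        linarith [h2.1]
      · exact absurd (by simpa [interp] using h2.2) (signFunction_ne_zero (φ := φ) h1)
  | square d s t =>
    obtain ⟨σ, h1, h2⟩ := γ.exists_side hI hY d.adj
    have e : f (Y.bd σ d.snd) = f (Y.bd σ d.fst) := by
      rw [hf, signFunction_of_notMem h1, signFunction_of_notMem h2,
        hv _ _ ((Y.bd σ).map_adj d.adj) h1 h2]
    have c1 := hor σ d.fst _ h1 rfl
    have c2 := hor σ d.snd _ h2 e
    cases σ
    · have h3 := eq_zero_of_interp_eq_zero (t := 1 - t) s.2.1 s.2.2 (by linarith [t.2.2])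
        (by linarith [t.2.1]) (signFunction_ne_zero h1) c1 c2
        (by rw [← hx]; simp only [hatCell, interp, e, Bool.not_false]; ring)
      refine ⟨true, Subtype.ext ?_, memEdge_of_interp_eq_zero hv h3.2⟩
      change (t : ℝ) = 1
      linarith [h3.1]
    · have h3 := eq_zero_of_interp_eq_zero s.2.1 s.2.2 t.2.1
        t.2.2 (signFunction_ne_zero h1) c1 c2
        (by rw [← hx]; simp only [hatCell, interp, e, Bool.not_true]; ring)
      exact ⟨false, Subtype.ext h3.1, memEdge_of_interp_eq_zero hv h3.2⟩

include hI hY hp hΛ in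
/-- A lift of a labelled path separates: the labels are the changes of side across the path, and
in a simply connected complex they integrate to a function on the vertices. -/
theorem exists_isSplitting_of_labelledPath :
    ∃ u, IsSplitting γ.carrier u ∧ IsCompatible p γ Λ u := by
  have hinj := VerticalPath.injective hI hY γ
  obtain ⟨φ, hφ, hstep⟩ := exists_side_function hI hY hp hΛ
  have hv : ∀ a b, Y.vert.Adj a b → a ∉ Set.range γ.toFun → b ∉ Set.range γ.toFun →
      φ b = φ a := by
    intro a b hab ha hb
    rw [hstep _ _ (.vertical hab), sideChange, vertLabel_of_notMem_left ha,
      vertLabel_of_notMem_left hb]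
    simp
  have hh : ∀ σ h, Y.bd σ h ∉ Set.range γ.toFun → Y.bd (!σ) h ∉ Set.range γ.toFun →
      φ (Y.bd (!σ) h) = φ (Y.bd σ h) := by
    intro σ h h1 h2
    rw [hstep _ _ (.horizontal σ h rfl rfl), sideChange, horLabel_of_notMem h1,
      horLabel_of_notMem h2]
    simp
  have hF : Continuous (hat (signFunction γ φ)) := by
    refine (lipschitzWith_hat (A := 1 / 2) (B := 1 / 2) (by norm_num) (by norm_num)
      (by norm_num) (fun a b hab => abs_signFunction_sub_le (hv a b hab))
      fun h => abs_signFunction_sub_le (hh false h)).continuous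
  set F := hat (signFunction γ φ) with hFdef
  let u : Bool → Set Y.Realization := fun β => if β then {x | 0 < F x} else {x | F x < 0}
  have hmem : ∀ a, a ∉ Set.range γ.toFun → ofCell (.vertex a) ∈ u (φ a) := by
    intro a ha
    have e : F (ofCell (.vertex a)) = signFunction γ φ a := rfl
    simp only [u]
    rw [signFunction_of_notMem ha] at e
    split_ifs with h
    · rw [if_pos h] at e
      change 0 < F _
      rw [e]
      norm_num
    · rw [if_neg h] at e
      change F _ < 0
      rw [e]
      norm_num
  refine ⟨u, ⟨fun β => ?_, fun x hx => ?_, ?_, fun β => ?_⟩, fun i b hb hb' => ?_⟩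
  · cases β
    · exact isOpen_lt hF continuous_const
    · exact isOpen_lt continuous_const hF
  · exact lt_or_gt_of_ne fun e => hx (mem_carrier_of_hat_eq_zero hI hY hv hh e)
  · refine Set.eq_empty_of_forall_notMem fun x hx => ?_
    have h1 : F x < 0 := hx.2.1
    have h2 : 0 < F x := hx.2.2
    exact lt_asymm h1 h2
  · obtain ⟨i, σ, h, h1, rfl⟩ := Λ.nonconst β
    obtain ⟨k, hk, rfl⟩ := hp.exists_hor (h1.trans (hΛ i).symm)
    have n := γ.notMem_or_notMem hI hY (h := k) (h' := k) (Or.inl rfl) ⟨i, hk.symm⟩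
    refine ⟨_, vertex_notMem_carrier hI hY n, ?_⟩
    have := hstep _ _ (.horizontal σ k rfl rfl)
    rw [sideChange, horLabel_of_mem hinj hk, horLabel_of_notMem n, hk, hφ, Bool.xor_false,
      Bool.false_xor] at this
    rw [← this]
    exact hmem _ n
  · have := hstep _ _ (.vertical hb)
    rw [sideChange, vertLabel_of_mem hinj i hb', vertLabel_of_notMem_left hb', hφ,
      Bool.xor_false, Bool.false_xor] at this
    rw [← this]
    exact hmem _ hb'

end FromLabelling

/-! ### Reparametrisations of vertical paths -/

section Reparametrisation

variable {Y : GraphOfGraphs.{u}}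

/-- The vertical path with its places shifted by `n`. -/
def VerticalPath.shift (γ : Y.VerticalPath) (n : ℤ) : Y.VerticalPath where
  toFun i := γ.toFun (i + n)
  adj i := by rw [add_right_comm]; exact γ.adj _
  immersed i := by rw [add_right_comm]; exact γ.immersed _

/-- The vertical path with the opposite orientation; its edge from the place `0` to the place `1`
is kept. -/
def VerticalPath.reverse (γ : Y.VerticalPath) : Y.VerticalPath where
  toFun i := γ.toFun (1 - i)
  adj i := by
    have := γ.adj (1 - (i + 1))
    rw [show 1 - (i + 1) + 1 = 1 - i by ring] at this
    exact this.symm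
  immersed i := by
    have := γ.immersed (1 - (i + 2))
    rw [show 1 - (i + 2) + 2 = 1 - i by ring] at this
    exact this.symm

theorem VerticalPath.mem_carrier_of_eq {γ : Y.VerticalPath} {d : Y.vert.Dart} {i : ℤ}
    (h1 : d.fst = γ.toFun i) (h2 : d.snd = γ.toFun (i + 1)) (s : unitInterval) :
    ofCell (.vedge d s) ∈ γ.carrier := by
  refine ⟨i, s, ?_⟩
  congr 2
  exact SimpleGraph.Dart.ext _ _ (Prod.ext h1 h2)

theorem VerticalPath.carrier_shift (γ : Y.VerticalPath) (n : ℤ) :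
    (γ.shift n).carrier = γ.carrier := by
  apply Set.Subset.antisymm
  · rintro _ ⟨i, s, rfl⟩
    refine mem_carrier_of_eq (i := i + n) rfl ?_ s
    change γ.toFun (i + 1 + n) = _
    rw [add_right_comm]
  · rintro _ ⟨i, s, rfl⟩
    refine mem_carrier_of_eq (i := i - n) ?_ ?_ s
    · change γ.toFun i = γ.toFun (i - n + n)
      rw [sub_add_cancel]
    · change γ.toFun (i + 1) = γ.toFun (i - n + 1 + n)
      congr 1
      ring

theorem VerticalPath.carrier_reverse (γ : Y.VerticalPath) : γ.reverse.carrier = γ.carrier := by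
  apply Set.Subset.antisymm
  · rintro _ ⟨i, s, rfl⟩
    rw [ofCell_vedge_symm]
    refine mem_carrier_of_eq (i := -i) ?_ ?_ _
    · change γ.toFun (1 - (i + 1)) = _
      congr 1
      ring
    · change γ.toFun (1 - i) = _
      congr 1
      ring
  · rintro _ ⟨i, s, rfl⟩
    rw [ofCell_vedge_symm]
    refine mem_carrier_of_eq (i := -i) ?_ ?_ _
    · change γ.toFun (i + 1) = γ.toFun (1 - -i)
      congr 1
      ring
    · change γ.toFun i = γ.toFun (1 - (-i + 1))
      congr 1
      ring

theorem VerticalPath.exists_affine (γ : Y.VerticalPath) (ε : ℤˣ) (k : ℤ) :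
    ∃ β : Y.VerticalPath, β.carrier = γ.carrier ∧ ∀ i, β.toFun i = γ.toFun (ε * i + k) := by
  rcases Int.units_eq_one_or ε with rfl | rfl
  · exact ⟨γ.shift k, γ.carrier_shift k, fun i => by simp [shift]⟩
  · refine ⟨(γ.shift (k - 1)).reverse, (carrier_reverse _).trans (carrier_shift _ _), fun i => ?_⟩
    simp only [shift, reverse, Units.val_neg, Units.val_one]
    congr 1
    ring

variable {X : GraphOfGraphs.{v}} {p : Hom Y X} {γ : Y.VerticalPath} {Λ : X.LabelledPath}
  {u : Bool → Set Y.Realization}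

theorem IsCompatible.shift (h : IsCompatible p γ Λ u) (n : ℤ) :
    IsCompatible p (γ.shift n) (Λ.shift n) u := by
  intro i b hb hb'
  refine h (i + n) b hb fun ⟨j, hj⟩ => hb' ⟨j - n, ?_⟩
  change γ.toFun (j - n + n) = b
  rwa [sub_add_cancel]

theorem IsCompatible.reverse (h : IsCompatible p γ Λ u) :
    IsCompatible p γ.reverse Λ.reverse u := by
  intro i b hb hb'
  refine h (1 - i) b hb fun ⟨j, hj⟩ => hb' ⟨1 - j, ?_⟩
  change γ.toFun (1 - (1 - j)) = b
  rwa [sub_sub_cancel]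

end Reparametrisation

/-! ### Crossing -/

section Crossing

variable {X : GraphOfGraphs.{v}} {Y : GraphOfGraphs.{u}} {p : Hom Y X} {δ θ : Y.VerticalPath}
  {Λ Θ : X.LabelledPath}

/-- Lifts that start at the same vertex part where their images part. -/
theorem LabelledPath.PartsAt.lift (hI : Y.IsImmersed) (hY : Y.IsSimplyConnected)
    (hp : p.IsCovering) (hδ : ∀ i, p.onV (δ.toFun i) = Λ.path i)
    (hθ : ∀ i, p.onV (θ.toFun i) = Θ.path i) (h0 : δ.toFun 0 = θ.toFun 0) {n : ℕ}
    (hn : Λ.PartsAt Θ n) :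
    Y.vert.Adj (δ.toFun (n + 1)) (θ.toFun (n + 2)) ∧ θ.toFun (n + 2) ∉ Set.range δ.toFun := by
  have common : ∀ k : ℕ, k ≤ n + 1 → δ.toFun k = θ.toFun k := by
    intro k
    induction k with
    | zero => exact fun _ => h0
    | succ k ih =>
      intro hk
      have e := ih (by omega)
      push_cast
      refine hp.vert_unique (δ.adj k) (by rw [e]; exact θ.adj k) ?_
      rw [hδ, hθ]
      exact hn.1 _ (by omega) (by omega)
  have e1 := common (n + 1) le_rfl
  have e0 := common n (by omega)
  push_cast at e1
  have hadj : Y.vert.Adj (δ.toFun (n + 1)) (θ.toFun (n + 2)) := by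
    rw [e1]
    have := θ.adj (n + 1)
    rwa [add_assoc] at this
  refine ⟨hadj, fun ⟨j, hj⟩ => ?_⟩
  rw [← hj] at hadj
  rcases δ.eq_of_adj hI hY hadj with rfl | h
  · refine hn.2 ?_
    rw [← hδ, ← hθ, ← hj, show (n : ℤ) + 1 + 1 = n + 2 by ring]
  · obtain rfl : j = n := by omega
    rw [e0] at hj
    exact θ.immersed n hj

/-- A vertical path that parts from a labelled line at both ends of a common segment, towards
different sides, crosses the line. -/
theorem IsSplitting.crosses_of_partsAt (hI : Y.IsImmersed) (hY : Y.IsSimplyConnected)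
    (hp : p.IsCovering) {u : Bool → Set Y.Realization} (hu : IsSplitting δ.carrier u)
    (hc : IsCompatible p δ Λ u) (hδ : ∀ i, p.onV (δ.toFun i) = Λ.path i)
    (hθ : ∀ i, p.onV (θ.toFun i) = Θ.path i) (h0 : δ.toFun 0 = θ.toFun 0) {n m : ℕ}
    (hn : Λ.PartsAt Θ n) (hm : Λ.reverse.PartsAt Θ.reverse m)
    (hne : Λ.vl (n + 1) (Θ.path (n + 2)) ≠ Λ.reverse.vl (m + 1) (Θ.reverse.path (m + 2))) :
    Crosses θ.carrier δ.carrier := by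
  have h1 : δ.toFun (0 + 1) = θ.toFun (0 + 1) := by
    refine hp.vert_unique (δ.adj 0) (by rw [h0]; exact θ.adj 0) ?_
    rw [hδ, hθ]
    exact hn.1 _ (by omega) (by omega)
  obtain ⟨a1, a2⟩ := hn.lift hI hY hp hδ hθ h0
  obtain ⟨b1, b2⟩ := hm.lift hI hY hp (δ := δ.reverse) (θ := θ.reverse)
    (Λ := Λ.reverse) (Θ := Θ.reverse) (fun i => hδ (1 - i)) (fun i => hθ (1 - i)) h1
  have a3 := hc _ _ a1 a2
  have b3 := hc.reverse _ _ b1 b2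
  have e : p.onV (θ.reverse.toFun (m + 2)) = Θ.reverse.path (m + 2) := hθ _
  rw [hθ] at a3
  rw [e] at b3
  have b4 := vertex_notMem_carrier hI hY b2
  rw [VerticalPath.carrier_reverse] at b4
  refine hu.crosses (θ.vertex_mem_carrier ⟨_, rfl⟩) ?_ (vertex_notMem_carrier hI hY a2) b4 hne
    a3 b3
  rw [← VerticalPath.carrier_reverse]
  exact θ.reverse.vertex_mem_carrier ⟨_, rfl⟩

end Crossing

/-! ### The labels on the orthogonal sphere -/

section OrthogonalSphere

variable {X : GraphOfGraphs.{u}} (Λ : X.LabelledPath) (P : ℕ → X.V) {m : ℕ}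

open Classical in
/-- The label of the component of a vertex of the sphere. -/
noncomputable def sphereLabel : X.SphereVertex → Bool
  | .horiz i σ h => Λ.hl i σ h
  | .vert i b => Λ.vl i b
  | .corner i σ h _ => Λ.hl i σ h
  | .mid j σ q => decide (∃ h ∈ q, X.bd σ h = P j ∧ Λ.hl j σ h = true)

variable {Λ P} (hm : 0 < m) (hper : ∀ i, Λ.path (i + m) = Λ.path i)
  (hP : ∀ i : ℕ, i ≤ m → P i = Λ.path i)

include hP in
theorem sphereLabel_mid {j : ℕ} {σ : Bool} {h h' : X.H} (hj : j < m) (h1 : X.bd σ h = P j)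
    (h2 : X.bd σ h' = P (j + 1)) : sphereLabel Λ P (.mid j σ s(h, h')) = Λ.hl j σ h := by
  have hne : P (j + 1) ≠ P j := by
    rw [hP _ hj, hP _ hj.le]
    push_cast
    exact (Λ.adj j).ne'
  have e : (∃ k ∈ s(h, h'), X.bd σ k = P j ∧ Λ.hl j σ k = true) ↔ Λ.hl j σ h = true := by
    constructor
    · rintro ⟨k, hk, h3, h4⟩
      rcases Sym2.mem_iff.1 hk with rfl | rfl
      · exact h4
      · exact absurd (h2.symm.trans h3) hne
    · exact fun h3 => ⟨h, Sym2.mem_mk_left _ _, h1, h3⟩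
  exact (decide_eq_decide.2 e).trans (Bool.decide_coe _)

include hm hper hP

/-- The labels are constant on the components of the orthogonal sphere. The two excluded vertices
are those where the closed path would continue. -/
theorem sphereLabel_eq_of_edge {x y : X.SphereVertex} (h : SphereEdge P m x y)
    (h0 : x ≠ .vert 0 (P (m - 1))) (h1 : x ≠ .vert m (P 1)) :
    sphereLabel Λ P x = sphereLabel Λ P y := by
  cases h with
  | horiz i σ h h' hi hv hh => rfl
  | vert i σ h h' hi hv hh hnext hprev =>
    refine Λ.link i σ h h' (by rw [hv, hP i hi]) hh ?_ ?_
    · rcases hi.lt_or_eq with hi | rfl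
      · have := hnext hi
        rw [hP _ hi] at this
        exact_mod_cast this
      · intro e
        rw [add_comm, hper] at e
        refine h1 ?_
        rw [e, hP 1 hm]
        simp
    · rcases Nat.eq_zero_or_pos i with rfl | hi'
      · intro e
        rw [← hper] at e
        refine h0 ?_
        rw [e, hP (m - 1) (by omega)]
        congr 2
        push_cast [Nat.cast_sub (show 1 ≤ m from hm)]
        ring
      · have := hprev hi'
        rw [hP _ (by omega), Nat.cast_sub (show 1 ≤ i from hi')] at this
        exact_mod_cast this
  | mid_left j σ h h' hj hv hv' hh => exact sphereLabel_mid hP hj hv hv'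
  | mid_right j σ h h' hj hv hv' hh =>
    rw [sphereLabel_mid hP hj hv hv']
    have := Λ.square j σ h h' (by rw [hv, hP j hj.le]) hh
      (by rw [hv', hP _ hj]; push_cast; rfl)
    rw [← this]
    simp [sphereLabel]

theorem sphereLabel_eq_of_adj {x y : X.SphereVertex} (h : (orthogonalSphere P m).Adj x y) :
    sphereLabel Λ P x = sphereLabel Λ P y := by
  obtain ⟨h1, h2⟩ := h
  have hx := h2 x (Or.inl rfl)
  have hy := h2 y (Or.inr rfl)
  rw [regularSphere, SimpleGraph.fromRel_adj] at h1
  rcases h1.2 with h | h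
  · exact sphereLabel_eq_of_edge hm hper hP h (fun e => hx.1 (Or.inl e)) fun e => hx.2 (Or.inl e)
  · exact (sphereLabel_eq_of_edge hm hper hP h (fun e => hy.1 (Or.inl e))
      fun e => hy.2 (Or.inl e)).symm

theorem sphereLabel_eq_of_mem_supp {K : (orthogonalSphere P m).ConnectedComponent}
    {x y : X.SphereVertex} (hx : x ∈ K.supp) (hy : y ∈ K.supp) :
    sphereLabel Λ P x = sphereLabel Λ P y := by
  obtain ⟨q⟩ := SimpleGraph.ConnectedComponent.exact (hx.trans hy.symm)
  clear hx hy
  induction q with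
  | nil => rfl
  | cons h _ ih => exact (sphereLabel_eq_of_adj hm hper hP h).trans ih

end OrthogonalSphere

/-! ### Maximal cycles -/

section Maximal

variable {X : GraphOfGraphs.{u}} {C : X.Cycle}

theorem Cycle.periodic_mul (C : X.Cycle) (n x : ℤ) : C.toFun (x + n * C.len) = C.toFun x := by
  have h : Function.Periodic C.toFun (C.len : ℤ) := C.periodic
  simpa using h.int_mul n x

/-- A maximal cycle has no period that is smaller than its length. -/
theorem Cycle.IsMaximal.not_periodic (hC : C.IsMaximal) {d : ℕ} (hd : 0 < d) (hd' : d < C.len) :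
    ¬ ∀ x : ℤ, C.toFun (x + d) = C.toFun x := by
  intro h
  have hpos := Nat.gcd_pos_of_pos_left C.len hd
  have hg : ∀ x : ℤ, C.toFun (x + (d.gcd C.len : ℕ)) = C.toFun x := by
    intro x
    have h' : Function.Periodic C.toFun (d : ℤ) := h
    have h1 := h'.int_mul (d.gcdA C.len) (x + d.gcdB C.len * C.len)
    rw [Nat.gcd_eq_gcd_ab, ← C.periodic_mul (d.gcdB C.len) x, ← h1]
    congr 1
    simp only [Int.cast_id]
    ring
  obtain ⟨n, hn⟩ := Nat.gcd_dvd_right d C.len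
  have hle : d.gcd C.len < C.len := (Nat.gcd_le_left _ hd).trans_lt hd'
  refine hC ⟨d.gcd C.len, hpos, C.toFun, hg, C.adj, C.immersed⟩ n ?_
    ⟨by rw [mul_comm]; exact hn, 1, 0, fun i => by simp⟩
  by_contra hn2
  have : n = 0 ∨ n = 1 := by omega
  rcases this with rfl | rfl
  · have := C.len_pos
    omega
  · omega

/-- An immersed path is not symmetric under a reflection: the reflection fixes a vertex or inverts
an edge. -/
theorem LabelledPath.not_reflection (Λ : X.LabelledPath) (z : ℤ) :
    ¬ ∀ x, Λ.path (z - x) = Λ.path x := by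
  intro h
  obtain ⟨y, hy | hy⟩ := Int.even_or_odd' z
  · have := h (y + 1)
    rw [show z - (y + 1) = y - 1 by omega] at this
    exact Λ.pred_ne_succ y this
  · have := h y
    rw [show z - y = y + 1 by omega] at this
    exact (Λ.adj y).ne' this

/-- A way of placing a labelled path with the edge at the place `n` moved to the place `0`. -/
def LabelledPath.IsPlacement (Λ : X.LabelledPath) (n : ℤ) (Λ' : X.LabelledPath) : Prop :=
  Λ' = Λ.shift n ∨ Λ' = (Λ.shift n).reverse

/-- The placements of a maximal cycle at different edges are different. -/
theorem LabelledPath.IsPlacement.path_ne {Λ Λ₁ Λ₂ : X.LabelledPath} {m : ℕ}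
    (hmax : ∀ d : ℕ, 0 < d → d < m → ¬ ∀ x, Λ.path (x + d) = Λ.path x) {n₁ n₂ : ℕ}
    (h1 : Λ.IsPlacement n₁ Λ₁) (h2 : Λ.IsPlacement n₂ Λ₂) (hn₁ : n₁ < m) (hn₂ : n₂ < m)
    (hne : n₁ ≠ n₂) : Λ₁.path ≠ Λ₂.path := by
  have same : ¬ ∀ x, Λ.path (x + n₁) = Λ.path (x + n₂) := by
    intro h
    rcases lt_or_gt_of_ne hne with hlt | hlt
    · refine hmax (n₂ - n₁) (by omega) (by omega) fun x => ?_
      have := h (x - n₁)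
      rw [sub_add_cancel] at this
      rw [this, Nat.cast_sub hlt.le]
      congr 1
      ring
    · refine hmax (n₁ - n₂) (by omega) (by omega) fun x => ?_
      have := h (x - n₂)
      rw [sub_add_cancel] at this
      rw [← this, Nat.cast_sub hlt.le]
      congr 1
      ring
  intro e
  rcases h1 with rfl | rfl <;> rcases h2 with rfl | rfl
  · exact same fun x => congrFun e x
  · refine Λ.not_reflection (1 + n₁ + n₂) fun x => ?_
    have : Λ.path (x - n₁ + n₁) = Λ.path (1 - (x - n₁) + n₂) := congrFun e (x - n₁)
    rw [sub_add_cancel] at this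
    rw [this]
    congr 1
    ring
  · refine Λ.not_reflection (1 + n₁ + n₂) fun x => ?_
    have : Λ.path (1 - (x - n₂) + n₁) = Λ.path (x - n₂ + n₂) := congrFun e (x - n₂)
    rw [sub_add_cancel] at this
    rw [← this]
    congr 1
    ring
  · refine same fun x => ?_
    have : Λ.path (1 - (1 - x) + n₁) = Λ.path (1 - (1 - x) + n₂) := congrFun e (1 - x)
    rwa [sub_sub_cancel] at this

theorem LabelledPath.IsPlacement.isPeriodic {Λ Λ' : X.LabelledPath} {n : ℤ} {M : ℕ}
    (h : Λ.IsPlacement n Λ') (H : Λ.IsPeriodic M) : Λ'.IsPeriodic M := by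
  rcases h with rfl | rfl
  · exact H.shift n
  · exact (H.shift n).reverse

theorem LabelledPath.IsPlacement.exists_lift {Y : GraphOfGraphs.{v}} {p : Hom Y X}
    {γ : Y.VerticalPath} {u : Bool → Set Y.Realization} {Λ Λ' : X.LabelledPath} {n : ℤ}
    (h : Λ.IsPlacement n Λ') (hγ : ∀ i, p.onV (γ.toFun i) = Λ.path i)
    (hc : IsCompatible p γ Λ u) :
    ∃ δ : Y.VerticalPath, δ.carrier = γ.carrier ∧ (∀ i, p.onV (δ.toFun i) = Λ'.path i) ∧
      IsCompatible p δ Λ' u := by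
  rcases h with rfl | rfl
  · exact ⟨γ.shift n, γ.carrier_shift n, fun i => hγ _, hc.shift n⟩
  · exact ⟨(γ.shift n).reverse, (VerticalPath.carrier_reverse _).trans (γ.carrier_shift n),
      fun i => hγ _, (hc.shift n).reverse⟩

end Maximal

/-! ### Repetitive cycles -/

section Repetitive

variable {X : GraphOfGraphs.{u}}

/-- A labelled path with a repeated edge `{a, b}` can be placed with each occurrence of the edge
running from `a`, at the place `0`, to `b`. If the pre-images of each square around the occurrences
are in one component of the orthogonal sphere, the placements agree there. -/
theorem exists_placements {Λ : X.LabelledPath} {P : ℕ → X.V} {m : ℕ} (hm : 0 < m)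
    (hper : ∀ i, Λ.path (i + m) = Λ.path i) (hP : ∀ i : ℕ, i ≤ m → P i = Λ.path i) {k : ℕ}
    {a b : X.V} {f : Fin k → ℕ} (hf : ∀ i, f i < m ∧ s(P (f i), P (f i + 1)) = s(a, b))
    (hK : ∀ (σ : Bool) (q : Sym2 X.H), q ∈ X.strip.edgeSet → q.map (X.bd σ) = s(a, b) →
        ∃ K : (orthogonalSphere P m).ConnectedComponent,
          ∀ i, squarePreimage P (f i) σ q ⊆ K.supp) :
    ∃ Λ' : Fin k → X.LabelledPath, (∀ i, Λ.IsPlacement (f i) (Λ' i)) ∧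
      ∀ i j, (Λ' i).AgreeAt (Λ' j) 0 := by
  have key : ∀ i, ∃ Λ' : X.LabelledPath, Λ.IsPlacement (f i) Λ' ∧ Λ'.path 0 = a ∧
      Λ'.path (0 + 1) = b ∧ ∀ σ h h', X.bd σ h = a → X.bd σ h' = b →
        ∃ x ∈ squarePreimage P (f i) σ s(h, h'), sphereLabel Λ P x = Λ'.hl 0 σ h := by
    intro i
    obtain ⟨hi, he⟩ := hf i
    have e0 := hP (f i) hi.le
    have e1 := hP (f i + 1) hi
    push_cast at e1
    rcases Sym2.eq_iff.1 he with ⟨ha, hb⟩ | ⟨hb, ha⟩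
    · refine ⟨Λ.shift (f i), Or.inl rfl, ?_, ?_, fun σ h h' h1 h2 =>
        ⟨.horiz (f i) σ h, ⟨h, h', rfl, h1.trans ha.symm, h2.trans hb.symm, Or.inl rfl⟩, ?_⟩⟩
      · change Λ.path (0 + f i) = a
        rw [zero_add, ← e0, ha]
      · change Λ.path (0 + 1 + f i) = b
        rw [zero_add, add_comm, ← e1, hb]
      · change Λ.hl (f i) σ h = Λ.hl (0 + f i) σ h
        rw [zero_add]
    · refine ⟨(Λ.shift (f i)).reverse, Or.inr rfl, ?_, ?_, fun σ h h' h1 h2 =>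
        ⟨.horiz (f i + 1) σ h, ⟨h', h, Sym2.eq_swap, h2.trans hb.symm, h1.trans ha.symm,
          Or.inr (Or.inr (Or.inr (Or.inr rfl)))⟩, ?_⟩⟩
      · change Λ.path (1 - 0 + f i) = a
        rw [sub_zero, add_comm, ← e1, ha]
      · change Λ.path (1 - (0 + 1) + f i) = b
        rw [zero_add, sub_self, zero_add, ← e0, hb]
      · change Λ.hl (f i + 1 : ℕ) σ h = Λ.hl (1 - 0 + f i) σ h
        rw [sub_zero, add_comm (1 : ℤ)]
        push_cast
        rfl
  choose Λ' h1 h2 h3 h4 using key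
  refine ⟨Λ', h1, fun i j => ⟨(h2 i).trans (h2 j).symm, (h3 i).trans (h3 j).symm,
    fun σ h h' ha hh hb => ?_⟩⟩
  rw [h2] at ha
  rw [h3] at hb
  obtain ⟨x, hx, ex⟩ := h4 i σ h h' ha hb
  obtain ⟨y, hy, ey⟩ := h4 j σ h h' ha hb
  obtain ⟨K, hK'⟩ := hK σ s(h, h') hh (by rw [← ha, ← hb]; rfl)
  rw [← ex, ← ey]
  exact sphereLabel_eq_of_mem_supp hm hper hP (hK' i hx) (hK' j hy)

end Repetitive

end GraphOfGraphs

theorem mainTheorem6 {X : GraphOfGraphs.{u}} {Y : GraphOfGraphs.{v}}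
    (hX : X.IsTubular) (hBM : X.IsBradyMeier)
    (p : GraphOfGraphs.Hom Y X) (hp : p.IsUniversalCover)
    (C : X.Cycle) (hmax : C.IsMaximal) (hsep : C.IsUCSeparating p) (hrep : C.IsRepetitive 3)
    (γ : Y.VerticalPath) (hγ : C.IsLift p γ) :
    ∃ L' : Set Y.Realization,
      GraphOfGraphs.IsVerticalLine L' ∧ GraphOfGraphs.IsPeriodicLine p L' ∧
      GraphOfGraphs.IsSeparatingLine L' ∧
      GraphOfGraphs.Crosses L' γ.carrier ∧ GraphOfGraphs.Crosses γ.carrier L' := by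
  open GraphOfGraphs in
  have hI : Y.IsImmersed := hp.1.isImmersed hX.immersion
  have := hX.finite_H
  obtain ⟨e, he, P, ⟨ε, k, hPC⟩, f, hf, hfe, hK⟩ := hrep
  obtain ⟨β, hβ, hβ'⟩ := γ.exists_affine ε k
  obtain ⟨u, hu⟩ := exists_isSplitting (hsep γ hγ).2
  rw [← hβ] at hu ⊢
  obtain ⟨Λ, hΛ, hc⟩ := hu.exists_labelledPath hI hp.2 hBM hp.1
  have hΛC : ∀ i, Λ.path i = C.toFun (ε * i + k) := fun i => by
    rw [← hΛ, hβ', hγ]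
  have hper : ∀ i, Λ.path (i + C.len) = Λ.path i := fun i => by
    rw [hΛC, hΛC, mul_add, add_right_comm, C.periodic_mul]
  have hP : ∀ i : ℕ, i ≤ C.len → P i = Λ.path i := fun i hi => by rw [hPC i hi, hΛC]
  -- No period of the path is smaller than the length of the cycle.
  have hmin : ∀ d : ℕ, 0 < d → d < C.len → ¬ ∀ x, Λ.path (x + d) = Λ.path x := by
    intro d hd hd' h
    refine hmax.not_periodic hd hd' fun x => ?_
    rcases Int.units_eq_one_or ε with rfl | rfl
    · have := h (x - k)
      simp only [hΛC, Units.val_one, one_mul] at this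
      rw [show x - k + d + k = x + d by ring, sub_add_cancel] at this
      exact this
    · have := h (k - x - d)
      simp only [hΛC, Units.val_neg, Units.val_one, neg_mul, one_mul] at this
      rw [show -(k - x - d + d) + k = x by ring, show -(k - x - d) + k = x + d by ring] at this
      exact this.symm
  induction e using Sym2.ind with
  | _ a b =>
  obtain ⟨Λ', hpl, hagree⟩ := exists_placements C.len_pos hper hP hfe hK
  obtain ⟨M, hM, hMper⟩ := Λ.exists_isPeriodic hBM C.len_pos hper
  obtain ⟨κ, Θ, N, n, m, hN, hΘ, hn, hm, hne, hne'⟩ := LabelledPath.exists_crossing hBM hM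
    (fun i => (hpl i).isPeriodic hMper) hagree
    (fun i j hij => (hpl i).path_ne hmin (hpl j) (hfe i).1 (hfe j).1 fun e => hij (hf e))
  obtain ⟨δ, hδβ, hδ, hδc⟩ := (hpl κ).exists_lift hΛ hc
  rw [← hδβ] at hu ⊢
  obtain ⟨θ, hθ0, hθ⟩ := exists_lift_path hp.1 Θ.adj Θ.immersed (v := δ.toFun 0)
    ((hδ 0).trans (hn.1 0 le_rfl (by omega)))
  obtain ⟨u', hu', hc'⟩ := exists_isSplitting_of_labelledPath hI hp.2 hp.1 hθ
  have hline := θ.isVerticalLine hI hp.2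
  refine ⟨θ.carrier, hline, ?_, ⟨hline.1, hu'.not_isPreconnected⟩, ?_, ?_⟩
  · exact θ.isPeriodicLine_of_periodic hp hI hN fun i => by rw [hθ, hθ, hΘ]
  · exact hu.crosses_of_partsAt hI hp.2 hp.1 hδc hδ hθ hθ0.symm hn hm hne
  · exact hu'.crosses_of_partsAt hI hp.2 hp.1 hc' hθ hδ hθ0 hn.symm hm.symm hne'
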